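/- Let $n\ge 1$ and let $M$ be a (Hausdorff, not necessarily connected) complex manifold of dimension $2n$. A *holomorphic $SL(2)$-web* on $M$ is a family $S_t\subset TM$, $t\in\mathbb{CP}^1$, of rank $n$ holomorphic subbundles, depending holomorphically on $(t,x)\in\mathbb{CP}^1\times M$, such that (i) each $S_t$ is involutive; (ii) $S_t\cap S_{t'}=0$ for $t\ne t'$; (iii) at each point $x$, the projections $P_{t,t'}$ of $T_xM$ to $S_t$ along $S_{t'}$, for all $t\neq t'$, span a $4$-dimensional subspace of $\operatorname{End}(T_xM)$. A *Chern connection* of a triple $(S_{t_1},S_{t_2},S_{t_3})$ with $t_1,t_2,t_3$ distinct is a holomorphic connection on $TM$ that preserves the three subbundles and whose torsion $T$ satisfies $T(S_{t_1},S_{t_2})=0$. The holonomy group of a connection at $x$ consists of the parallel transports along piecewise $C^1$ loops at $x$. We say that its holonomy lies in $GL(n,\mathbb C)$ if for each $x\in M$ there is an action of $SL(2,\mathbb C)$ on $T_xM$, isomorphic to a direct sum of $n$ copies of the irreducible representation of weight 1 (the standard representation $\mathbb C^2$), such that the holonomy group at $x$ is contained in the centralizer of this action in $GL(T_xM)$.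 **Theorem.** (1) Let $(S_t)$ be a holomorphic $SL(2)$-web on $M$. Then there is a connection $\nabla$ on $TM$ which is, for every triple of distinct points $t_1,t_2,t_3$ of $\mathbb{CP}^1$, the unique Chern connection of $(S_{t_1},S_{t_2},S_{t_3})$ (so $\nabla$ is "the Chern connection" of the web). This $\nabla$ is a torsion-free holomorphic affine connection, and its holonomy lies in $GL(n,\mathbb C)$. (2) For every action of $SL(2,\mathbb C)$ on a tangent space $T_xM$ that is a direct sum of $n$ irreducible representations of weight 1, the centralizer of the action in $GL(T_xM)$ is isomorphic to $GL(n,\mathbb C)$. (3) Conversely, for every torsion-free holomorphic affine connection $\nabla$ on $M$ whose holonomy lies in $GL(n,\mathbb C)$ there is a holomorphic $SL(2)$-web $(S_t)$ on $M$ such that $\nabla$ preserves $S_t$ for every $t\in\mathbb{CP}^1$. -/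

import Mathlib

open scoped Manifold ContDiff Matrix

noncomputable section

namespace SL2Web

/-- The complex projective line, whose points are the lines in `ℂ²`. -/
abbrev CP1 : Type := Projectivization ℂ (Fin 2 → ℂ)

section Webs

variable {E : Type*} [NormedAddCommGroup E] [NormedSpace ℂ E]
  {M : Type*} [TopologicalSpace M] [ChartedSpace E M]

/-- The vector field `X` is holomorphic on `U`. -/
def IsHolomorphicOn [IsManifold 𝓘(ℂ, E) 1 M]
    (X : ∀ x : M, TangentSpace 𝓘(ℂ, E) x) (U : Set M) : Prop :=
  ContMDiffOn 𝓘(ℂ, E) (𝓘(ℂ, E).prod 𝓘(ℂ, E)) ω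
    (fun x ↦ (⟨x, X x⟩ : TangentBundle 𝓘(ℂ, E) M)) U

/-- `S` is a holomorphic family, parametrized by `ℂP¹`, of holomorphic rank `n` subbundles of
`TM`: near every point, the `S t x` have a frame which is holomorphic jointly in `x` and in the
homogeneous coordinates `u` of `t`. -/
def IsHolomorphicFamily [IsManifold 𝓘(ℂ, E) 1 M] (n : ℕ)
    (S : CP1 → ∀ x : M, Submodule ℂ (TangentSpace 𝓘(ℂ, E) x)) : Prop :=
  ∀ (u₀ : Fin 2 → ℂ) (x₀ : M), u₀ ≠ 0 →
    ∃ (W : Set ((Fin 2 → ℂ) × M))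
      (s : Fin n → (Fin 2 → ℂ) → ∀ x : M, TangentSpace 𝓘(ℂ, E) x),
      IsOpen W ∧ (u₀, x₀) ∈ W ∧
      (∀ i, ContMDiffOn (𝓘(ℂ, Fin 2 → ℂ).prod 𝓘(ℂ, E)) (𝓘(ℂ, E).prod 𝓘(ℂ, E)) ω
        (fun p : (Fin 2 → ℂ) × M ↦ (⟨p.2, s i p.1 p.2⟩ : TangentBundle 𝓘(ℂ, E) M)) W) ∧
      ∀ (u : Fin 2 → ℂ) (x : M) (hu : u ≠ 0), (u, x) ∈ W →
        LinearIndependent ℂ (fun i ↦ s i u x) ∧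
        S (Projectivization.mk ℂ u hu) x = Submodule.span ℂ (Set.range fun i ↦ s i u x)

/-- `[F, F] ⊆ F`, for local holomorphic sections of `F`. -/
def IsInvolutive [IsManifold 𝓘(ℂ, E) 1 M]
    (F : ∀ x : M, Submodule ℂ (TangentSpace 𝓘(ℂ, E) x)) : Prop :=
  ∀ (U : Set M) (X Y : ∀ x : M, TangentSpace 𝓘(ℂ, E) x), IsOpen U →
    IsHolomorphicOn X U → IsHolomorphicOn Y U →
    (∀ x ∈ U, X x ∈ F x) → (∀ x ∈ U, Y x ∈ F x) →
    ∀ x ∈ U, VectorField.mlieBracket 𝓘(ℂ, E) X Y x ∈ F x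

/-- The set of the operators `P_{t,t'}` at `x`: the projections of `T_x M` to `S t x` along
`S t' x`, for distinct `t` and `t'`. -/
def webProjections (S : CP1 → ∀ x : M, Submodule ℂ (TangentSpace 𝓘(ℂ, E) x)) (x : M) :
    Set (Module.End ℂ (TangentSpace 𝓘(ℂ, E) x)) :=
  {P | ∃ (t t' : CP1) (h : IsCompl (S t x) (S t' x)), t ≠ t' ∧ P = Submodule.projection (S t x) (S t' x) h}

/-- Holomorphic `SL(2)`-webs, on a complex manifold of dimension `2n`. -/
structure IsSL2Web [IsManifold 𝓘(ℂ, E) 1 M] (n : ℕ)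
    (S : CP1 → ∀ x : M, Submodule ℂ (TangentSpace 𝓘(ℂ, E) x)) : Prop where
  holomorphic : IsHolomorphicFamily n S
  involutive : ∀ t, IsInvolutive (S t)
  transversal : ∀ t t', t ≠ t' → ∀ x, S t x ⊓ S t' x = ⊥
  finrank_span : ∀ x, Module.finrank ℂ (Submodule.span ℂ (webProjections S x)) = 4

end Webs

section Connections

variable {E : Type*} [NormedAddCommGroup E] [NormedSpace ℂ E]
  {M : Type*} [TopologicalSpace M] [ChartedSpace E M]

variable (E M) in
/-- Affine connections, that is, connections on `TM`. Here `∇ Y x (X x)` is `(∇_X Y)(x)`, and `∇`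
can be applied to any vector field that is holomorphic near `x`. -/
abbrev AffineConnection [IsManifold 𝓘(ℂ, E) 1 M] : Type _ :=
  CovariantDerivative 𝓘(ℂ, E) E (TangentSpace 𝓘(ℂ, E) : M → Type _)

/-- `∇` maps local holomorphic vector fields to local holomorphic sections of `Hom(TM, TM)`. -/
def IsHolomorphicConnection [IsManifold 𝓘(ℂ, E) 1 M] (D : AffineConnection E M) : Prop :=
  ∀ U : Set M, IsOpen U → ContMDiffCovariantDerivativeOn E ω D.toFun U

/-- `∇` maps local holomorphic sections of `F` to `F`-valued forms. -/
def Preserves [IsManifold 𝓘(ℂ, E) 1 M] (D : AffineConnection E M)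
    (F : ∀ x : M, Submodule ℂ (TangentSpace 𝓘(ℂ, E) x)) : Prop :=
  ∀ (U : Set M) (X : ∀ x : M, TangentSpace 𝓘(ℂ, E) x), IsOpen U → IsHolomorphicOn X U →
    (∀ x ∈ U, X x ∈ F x) → ∀ x ∈ U, ∀ v : TangentSpace 𝓘(ℂ, E) x, D X x v ∈ F x

/-- `∇` is a Chern connection of the 3-web `F₁, F₂, F₃`: it is holomorphic, it preserves the three
foliations, and its torsion vanishes on `F₁ ⊗ F₂`. -/
structure IsChernConnection [IsManifold 𝓘(ℂ, E) 2 M] [CompleteSpace E] [FiniteDimensional ℂ E]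
    (F₁ F₂ F₃ : ∀ x : M, Submodule ℂ (TangentSpace 𝓘(ℂ, E) x))
    (D : AffineConnection E M) : Prop where
  holomorphic : IsHolomorphicConnection D
  preserves₁ : Preserves D F₁
  preserves₂ : Preserves D F₂
  preserves₃ : Preserves D F₃
  torsion : ∀ x, ∀ v ∈ F₁ x, ∀ w ∈ F₂ x, D.torsion x v w = 0

/-- Equality of connections. The values of a `CovariantDerivative` on vector fields that are not
differentiable carry no meaning, and they are not compared. -/
def SameConnection [IsManifold 𝓘(ℂ, E) 1 M] (D D' : AffineConnection E M) : Prop :=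
  ∀ (X : ∀ x : M, TangentSpace 𝓘(ℂ, E) x) (x : M),
    MDifferentiableAt 𝓘(ℂ, E) (𝓘(ℂ, E).prod 𝓘(ℂ, E))
      (fun y ↦ (⟨y, X y⟩ : TangentBundle 𝓘(ℂ, E) M)) x → D X x = D' X x

/-- The vector field `c` along the curve `t ↦ (c t).proj` is parallel on `[0, 1]`. At time `t`, in
the trivialization `e` of `TM` given by the chart at the point `(c t).proj`, the covariant
derivative of `c` is the derivative of the coordinates of `c`, plus `∇_w Y`, where `w` is the
velocity of the curve and `Y` is the vector field with constant coordinates that extends `c t`. -/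
def IsParallel [IsManifold 𝓘(ℂ, E) 1 M] (D : AffineConnection E M)
    (c : ℝ → TangentBundle 𝓘(ℂ, E) M) : Prop :=
  ∀ t ∈ Set.Icc (0 : ℝ) 1, ∃ w : E,
    HasDerivWithinAt (fun u ↦ extChartAt 𝓘(ℂ, E) (c t).proj (c u).proj) w (Set.Icc 0 1) t ∧
    HasDerivWithinAt
      (fun u ↦ (trivializationAt E (TangentSpace 𝓘(ℂ, E)) (c t).proj (c u)).2)
      (-(D (FiberBundle.extend E (c t).2) (c t).proj w : E)) (Set.Icc 0 1) t

/-- `f : T_x M → T_y M` is the parallel transport along some piecewise `C¹` curve from `x` to `y`,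
that is, along a finite concatenation of `C¹` curves. -/
inductive IsParallelTransport [IsManifold 𝓘(ℂ, E) 1 M] (D : AffineConnection E M) :
    ∀ x y : M, (TangentSpace 𝓘(ℂ, E) x ≃ₗ[ℂ] TangentSpace 𝓘(ℂ, E) y) → Prop
  | curve (x y : M) (f : TangentSpace 𝓘(ℂ, E) x ≃ₗ[ℂ] TangentSpace 𝓘(ℂ, E) y) (γ : ℝ → M)
      (hγ : ContMDiffOn 𝓘(ℝ, ℝ) 𝓘(ℝ, E) 1 γ (Set.Icc 0 1))
      (h : ∀ v : TangentSpace 𝓘(ℂ, E) x, ∃ c : ℝ → TangentBundle 𝓘(ℂ, E) M,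
        (∀ t, (c t).proj = γ t) ∧ IsParallel D c ∧ c 0 = ⟨x, v⟩ ∧ c 1 = ⟨y, f v⟩) :
      IsParallelTransport D x y f
  | trans (x y z : M) (f : TangentSpace 𝓘(ℂ, E) x ≃ₗ[ℂ] TangentSpace 𝓘(ℂ, E) y)
      (g : TangentSpace 𝓘(ℂ, E) y ≃ₗ[ℂ] TangentSpace 𝓘(ℂ, E) z) :
      IsParallelTransport D x y f → IsParallelTransport D y z g →
      IsParallelTransport D x z (f.trans g)

theorem isParallelTransport_refl [IsManifold 𝓘(ℂ, E) 1 M] (D : AffineConnection E M) (x : M) :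
    IsParallelTransport D x x (LinearEquiv.refl ℂ _) := by
  refine .curve x x _ (fun _ ↦ x) contMDiffOn_const fun v ↦
    ⟨fun _ ↦ ⟨x, v⟩, fun _ ↦ rfl, fun t _ ↦ ⟨0, hasDerivWithinAt_const _ _ _, ?_⟩, rfl, rfl⟩
  have h0 : (-(D (FiberBundle.extend E v) x (0 : TangentSpace 𝓘(ℂ, E) x) :
      TangentSpace 𝓘(ℂ, E) x)) = 0 := by
    rw [map_zero, neg_zero]
  exact (hasDerivWithinAt_const t _ _).congr_deriv h0.symm

theorem isParallel_reverse [IsManifold 𝓘(ℂ, E) 1 M] (D : AffineConnection E M)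
    {c : ℝ → TangentBundle 𝓘(ℂ, E) M} (hc : IsParallel D c) :
    IsParallel D (fun t ↦ c (1 - t)) := by
  intro t ht
  have hr : ∀ s ∈ Set.Icc (0 : ℝ) 1, 1 - s ∈ Set.Icc (0 : ℝ) 1 :=
    fun s hs ↦ ⟨by linarith [hs.2], by linarith [hs.1]⟩
  have hd : HasDerivWithinAt (fun s : ℝ ↦ 1 - s) (-1) (Set.Icc 0 1) t :=
    (hasDerivWithinAt_id t _).const_sub 1
  obtain ⟨w, h₁, h₂⟩ := hc (1 - t) (hr t ht)
  refine ⟨-w, ?_, ?_⟩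
  · exact (HasDerivWithinAt.scomp t h₁ hd hr).congr_deriv (by simp)
  · refine (HasDerivWithinAt.scomp t h₂ hd hr).congr_deriv ?_
    have key : ∀ (A : E →L[ℂ] E) (v : E), (-1 : ℝ) • -(A v) = -(A (-v)) := fun A v ↦ by simp
    exact key _ _

theorem IsParallelTransport.symm [IsManifold 𝓘(ℂ, E) 1 M] {D : AffineConnection E M} {x y : M}
    {f : TangentSpace 𝓘(ℂ, E) x ≃ₗ[ℂ] TangentSpace 𝓘(ℂ, E) y}
    (hf : IsParallelTransport D x y f) : IsParallelTransport D y x f.symm := by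
  induction hf with
  | curve x y f γ hγ h =>
    refine .curve y x _ (fun t ↦ γ (1 - t)) ?_ fun v ↦ ?_
    · refine hγ.comp (t := Set.Icc 0 1) ?_ fun s hs ↦ ⟨by linarith [hs.2], by linarith [hs.1]⟩
      exact (contDiff_const.sub contDiff_id).contMDiff.contMDiffOn
    · obtain ⟨c, hc, hp, h0, h1⟩ := h (f.symm v)
      exact ⟨fun t ↦ c (1 - t), fun t ↦ hc _, isParallel_reverse D hp, by simp [h1], by simp [h0]⟩
  | trans x y z f g _ _ hf hg => exact .trans z y x g.symm f.symm hg hf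

/-- The holonomy group of `∇` at `x`: the parallel transports along piecewise `C¹` loops. -/
def holonomy [IsManifold 𝓘(ℂ, E) 1 M] (D : AffineConnection E M) (x : M) :
    Subgroup (TangentSpace 𝓘(ℂ, E) x ≃ₗ[ℂ] TangentSpace 𝓘(ℂ, E) x) where
  carrier := {f | IsParallelTransport D x x f}
  one_mem' := isParallelTransport_refl D x
  mul_mem' {f g} hf hg := .trans x x x g f hg hf
  inv_mem' hf := hf.symm

end Connections

section Representations

variable {V : Type*} [AddCommGroup V] [Module ℂ V]

/-- The representation `ρ` of `SL(2, ℂ)` is a direct sum of `n` copies of the irreducible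
representation of weight 1, which is `ℂ²` with its standard action. -/
def IsSumOfWeightOne (n : ℕ)
    (ρ : Matrix.SpecialLinearGroup (Fin 2) ℂ →* (V ≃ₗ[ℂ] V)) : Prop :=
  ∃ φ : V ≃ₗ[ℂ] (Fin n → Fin 2 → ℂ),
    ∀ (A : Matrix.SpecialLinearGroup (Fin 2) ℂ) (v : V) (i : Fin n),
      φ (ρ A v) i = (A : Matrix (Fin 2) (Fin 2) ℂ) *ᵥ φ v i

/-- The centralizer in `GL(V)` of the image of `ρ`. -/
def actionCentralizer (ρ : Matrix.SpecialLinearGroup (Fin 2) ℂ →* (V ≃ₗ[ℂ] V)) :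
    Subgroup (V ≃ₗ[ℂ] V) :=
  Subgroup.centralizer (Set.range ρ)

end Representations

/-- At every base point, the holonomy of `∇` lies in the centralizer of an action of `SL(2, ℂ)` on
the tangent space that makes it a sum of `n` irreducible representations of weight 1. -/
def HasHolonomyInGL {E : Type*} [NormedAddCommGroup E] [NormedSpace ℂ E]
    {M : Type*} [TopologicalSpace M] [ChartedSpace E M] [IsManifold 𝓘(ℂ, E) 1 M] (n : ℕ)
    (D : AffineConnection E M) : Prop :=
  ∀ x : M, ∃ ρ : Matrix.SpecialLinearGroup (Fin 2) ℂ →*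
      (TangentSpace 𝓘(ℂ, E) x ≃ₗ[ℂ] TangentSpace 𝓘(ℂ, E) x),
    IsSumOfWeightOne n ρ ∧ holonomy D x ≤ actionCentralizer ρ

end SL2Web

end

/-!
The idea is that an `SL(2)`-web is the same thing as a holomorphic field of matrix units
`e i j : T_x M → T_x M`, with `i, j : Fin 2`, whose members are the distributions
`S_[u] = {v | u 0 • e 0 1 v = u 1 • e 0 0 v}`. In other words, `TM = ℂ² ⊗ W` with `S_[u] = u ⊗ W`.
The condition that the holonomy commutes with an action of `SL(2, ℂ)` of weight 1 says that such
matrix units are invariant under parallel transport, because the image of `SL(2, ℂ)` spans the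
algebra of `2 × 2` matrices.

*Matrix units of a web.* The projections among the members at `0`, `1` and `∞` give the matrix units
(`webUnits`). Since all the projections span a space of dimension 4, they are combinations of these
units, and the member at `[1 : z]` belongs to a vector `(1, a z)`. The function `a` is entire and
injective, it has a pole at infinity and fixes `0` and `1`, so it is the identity
(`eq_id_of_injective_of_pole`, `web_eq_lineSpace`, `IsSL2Web.exists_isUnitsField`).

*The connection of a web.* With `i'` the index other than `i`, the formula
`∇_X Y = ∑ i j, e j i' [e i i X, e i' j Y]` defines a holomorphic connection. It makes the units
parallel (`isParallelEnd_unitsConnection`), so it preserves all members of the web, and it is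
torsion-free because finitely many members are involutive (`torsion_unitsConnection`). A Chern
connection of three members is unique: the difference of two of them is a tensor that preserves
three pairwise complementary subspaces and is symmetric on two of them, so it vanishes
(`eq_zero_of_preserves_three`). Parallel endomorphisms commute with parallel transport by uniqueness
for linear differential equations (`IsParallelTransport.comm`), which gives the holonomy.

*From the holonomy to a web.* Matrix units at a base point of each component that commute with the
holonomy are spread by parallel transport (`exists_isUnitsField_of_holonomy`). A field of
endomorphisms that commutes with all parallel transports satisfies, along short segments in a chart,
a differential equation with holomorphic coefficients; so it is smooth, hence analytic
(`analyticAt_of_contDiffOn_infty`), and it is parallel (`isHolEnd_and_isParallelEnd_of_comm`). The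
connection therefore preserves every `S_[u]`, and `[X, Y] = ∇_X Y - ∇_Y X` makes `S_[u]` involutive
(`Preserves.isInvolutive`).

The centralizer of the action consists of the maps that act on the factor `W = ℂⁿ` alone
(`IsSumOfWeightOne.nonempty_actionCentralizer_mulEquiv`).
-/

noncomputable section

namespace SL2Web

/-! ### Holomorphic functions of several variables are analytic -/

section SeveralVariables

universe w

variable {V : Type w} [NormedAddCommGroup V] [NormedSpace ℂ V]

/-- The Cauchy estimate for the first derivative. -/
theorem norm_fderiv_le_of_closedBall {G : Type*} [NormedAddCommGroup G] [NormedSpace ℂ G]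
    {U : Set V} (hU : IsOpen U) {f : V → G} (hf : DifferentiableOn ℂ f U) {y : V} {δ C : ℝ}
    (hδ : 0 < δ) (hsub : Metric.closedBall y δ ⊆ U)
    (hC : ∀ z ∈ Metric.closedBall y δ, ‖f z‖ ≤ C) : ‖fderiv ℂ f y‖ ≤ C / δ := by
  have hC0 : 0 ≤ C := (norm_nonneg _).trans (hC y (Metric.mem_closedBall_self hδ.le))
  refine ContinuousLinearMap.opNorm_le_bound _ (by positivity) fun v ↦ ?_
  rcases eq_or_ne v 0 with rfl | hv
  · simp
  have hv' : 0 < ‖v‖ := norm_pos_iff.2 hv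
  have hmem : ∀ z ∈ Metric.closedBall (0 : ℂ) (δ / ‖v‖), y + z • v ∈ Metric.closedBall y δ := by
    intro z hz
    rw [mem_closedBall_zero_iff, le_div_iff₀ hv'] at hz
    simpa [norm_smul] using hz
  have hline : ∀ z : ℂ, HasDerivAt (fun z : ℂ ↦ y + z • v) v z := fun z ↦ by
    simpa using ((hasDerivAt_id z).smul_const v).const_add y
  have hd : DifferentiableOn ℂ (fun z : ℂ ↦ f (y + z • v)) (Metric.closedBall 0 (δ / ‖v‖)) := by
    refine hf.comp (fun z _ ↦ (hline z).differentiableAt.differentiableWithinAt) ?_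
    exact fun z hz ↦ hsub (hmem z hz)
  have h1 := Complex.norm_deriv_le_of_forall_mem_sphere_norm_le (c := 0) (R := δ / ‖v‖) (C := C)
    (by positivity) (hd.diffContOnCl_ball subset_rfl)
    (fun z hz ↦ hC _ (hmem z (Metric.sphere_subset_closedBall hz)))
  have h2 : HasDerivAt (fun z : ℂ ↦ f (y + z • v)) (fderiv ℂ f y v) 0 := by
    have hfy : HasFDerivAt f (fderiv ℂ f y) (y + (0 : ℂ) • v) := by
      have := (hf.differentiableAt (hU.mem_nhds (hsub (Metric.mem_closedBall_self hδ.le))))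
      simpa using this.hasFDerivAt
    exact hfy.comp_hasDerivAt 0 (hline 0)
  rw [h2.deriv] at h1
  calc _ ≤ C / (δ / ‖v‖) := h1
    _ = C / δ * ‖v‖ := by field_simp

/-- The iterated Cauchy estimate: each differentiation costs a factor `1 / δ` and a shrinking of
the radius by `δ`. -/
theorem norm_iteratedFDeriv_le_of_closedBall {U : Set V} (hU : IsOpen U) (k : ℕ) :
    ∀ {G : Type w} [NormedAddCommGroup G] [NormedSpace ℂ G] {f : V → G},
      ContDiffOn ℂ ∞ f U → ∀ {x : V} {δ C : ℝ}, 0 < δ → Metric.closedBall x (k * δ) ⊆ U →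
      (∀ z ∈ Metric.closedBall x (k * δ), ‖f z‖ ≤ C) → ‖iteratedFDeriv ℂ k f x‖ ≤ C / δ ^ k := by
  induction k with
  | zero =>
    intro G _ _ f _ x δ C _ _ hC
    simpa using hC x (by simp)
  | succ k ih =>
    intro G _ _ f hf x δ C hδ hsub hC
    have hball : ∀ y ∈ Metric.closedBall x (k * δ),
        Metric.closedBall y δ ⊆ Metric.closedBall x ((k + 1 : ℕ) * δ) := fun y hy ↦ by
      refine Metric.closedBall_subset_closedBall' ?_
      rw [Metric.mem_closedBall] at hy
      push_cast
      linarith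
    have h := ih (f := fderiv ℂ f) (hf.fderiv_of_isOpen hU (by simp)) (x := x) (C := C / δ) hδ
      (fun y hy ↦ hsub (hball y hy (Metric.mem_closedBall_self hδ.le)))
      (fun y hy ↦ norm_fderiv_le_of_closedBall hU (hf.differentiableOn (by simp)) hδ
        ((hball y hy).trans hsub) fun z hz ↦ hC z (hball y hy hz))
    rw [norm_iteratedFDeriv_fderiv, div_div, ← pow_succ'] at h
    exact h

theorem iteratedDeriv_comp_line {G : Type*} [NormedAddCommGroup G] [NormedSpace ℂ G]
    {U : Set V} (hU : IsOpen U) {f : V → G} (hf : ContDiffOn ℂ ∞ f U) (x y : V) (n : ℕ) :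
    ∀ z : ℂ, x + z • y ∈ U →
      iteratedDeriv n (fun z : ℂ ↦ f (x + z • y)) z = iteratedFDeriv ℂ n f (x + z • y) fun _ ↦ y := by
  induction n with
  | zero => simp
  | succ n ih =>
    intro z hz
    have hcont : Continuous fun z : ℂ ↦ x + z • y := by fun_prop
    have hev : (iteratedDeriv n fun z : ℂ ↦ f (x + z • y)) =ᶠ[nhds z]
        fun z ↦ iteratedFDeriv ℂ n f (x + z • y) fun _ ↦ y :=
      Filter.mem_of_superset ((hU.preimage hcont).mem_nhds hz) fun z' hz' ↦ ih z' hz'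
    rw [iteratedDeriv_succ, hev.deriv_eq, iteratedFDeriv_succ_apply_left]
    have hline : HasDerivAt (fun z : ℂ ↦ x + z • y) y z := by
      simpa using ((hasDerivAt_id z).smul_const y).const_add x
    have hd : DifferentiableAt ℂ (iteratedFDeriv ℂ n f) (x + z • y) :=
      (hf.contDiffAt (hU.mem_nhds hz)).differentiableAt_iteratedFDeriv
        (by exact_mod_cast WithTop.coe_lt_top _)
    have h1 := hd.hasFDerivAt.comp_hasDerivAt z hline
    exact ((ContinuousMultilinearMap.apply ℂ (fun _ : Fin n ↦ V) G
      (fun _ ↦ y)).hasFDerivAt.comp_hasDerivAt z h1).deriv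

/-- A complex function which is infinitely differentiable on an open set of a normed space is
analytic there: by the iterated Cauchy estimates with `δ = R / k`, and by `k ^ k ≤ k! * exp k`, its
Taylor series has radius of convergence at least `R / e`. -/
theorem analyticAt_of_contDiffOn_infty {G : Type w} [NormedAddCommGroup G] [NormedSpace ℂ G]
    [CompleteSpace G] {U : Set V} (hU : IsOpen U) {f : V → G} (hf : ContDiffOn ℂ ∞ f U) {x : V}
    (hx : x ∈ U) : AnalyticAt ℂ f x := by
  obtain ⟨R, hR, C, hsub, hC⟩ : ∃ R > 0, ∃ C : ℝ, Metric.closedBall x R ⊆ U ∧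
      ∀ z ∈ Metric.closedBall x R, ‖f z‖ ≤ C := by
    have h1 : ∀ᶠ z in nhds x, z ∈ U ∧ ‖f z‖ < ‖f x‖ + 1 := by
      refine Filter.Eventually.and (hU.mem_nhds hx) ?_
      exact (hf.continuousOn.continuousAt (hU.mem_nhds hx)).norm.eventually_lt
        continuousAt_const (lt_add_one _)
    obtain ⟨R, hR, h⟩ := Metric.nhds_basis_closedBall.eventually_iff.1 h1
    exact ⟨R, hR, _, fun z hz ↦ (h hz).1, fun z hz ↦ (h hz).2.le⟩
  have hC0 : 0 ≤ C := (norm_nonneg _).trans (hC x (Metric.mem_closedBall_self hR.le))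
  set p : FormalMultilinearSeries ℂ V G := fun k ↦ ((k.factorial : ℂ)⁻¹) • iteratedFDeriv ℂ k f x
  have hbound : ∀ k : ℕ, ‖p k‖ * (R / Real.exp 1) ^ k ≤ C := by
    intro k
    rcases Nat.eq_zero_or_pos k with rfl | hk
    · simpa [p] using hC x (Metric.mem_closedBall_self hR.le)
    have hk' : (0 : ℝ) < k := by exact_mod_cast hk
    have hkR : (k : ℝ) * (R / k) = R := by field_simp
    have h1 := norm_iteratedFDeriv_le_of_closedBall hU k hf (x := x) (δ := R / k) (C := C)
      (by positivity) (by rwa [hkR]) (by rwa [hkR])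
    have h2 := Real.pow_div_factorial_le_exp k hk'.le k
    have h3 : ‖p k‖ ≤ (k.factorial : ℝ)⁻¹ * (C / (R / k) ^ k) := by
      simp only [p, norm_smul, norm_inv, Complex.norm_natCast]
      gcongr
    calc ‖p k‖ * (R / Real.exp 1) ^ k
        ≤ ((k.factorial : ℝ)⁻¹ * (C / (R / k) ^ k)) * (R / Real.exp 1) ^ k := by gcongr
      _ = C * ((k : ℝ) ^ k / k.factorial) / Real.exp k := by
          rw [← Real.exp_one_pow k, div_pow, div_pow]
          field_simp
      _ ≤ C * Real.exp k / Real.exp k := by gcongr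
      _ = C := by field_simp
  have hr : (0 : ℝ) < R / Real.exp 1 := by positivity
  have hexp : R / Real.exp 1 < R := div_lt_self hR (Real.one_lt_exp_iff.2 one_pos)
  refine ⟨p, ENNReal.ofReal (R / Real.exp 1), ?_, by simpa using hr, ?_⟩
  · exact p.le_radius_of_bound C fun n ↦ by simpa [Real.coe_toNNReal _ hr.le] using hbound n
  · intro y hy
    have hy' : ‖y‖ < R / Real.exp 1 := by
      rwa [Metric.eball_ofReal, mem_ball_zero_iff] at hy
    have hyR : ‖y‖ < R := hy'.trans hexp
    -- The Taylor expansion of `f` along the complex line through `x` and `x + y`.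
    obtain ⟨ρ, hρ, hρR⟩ : ∃ ρ : ℝ, 1 < ρ ∧ ρ * ‖y‖ ≤ R := by
      rcases eq_or_ne ‖y‖ 0 with h0 | h0
      · exact ⟨2, by norm_num, by simp [h0, hR.le]⟩
      · have : 0 < ‖y‖ := lt_of_le_of_ne (norm_nonneg _) (Ne.symm h0)
        exact ⟨R / ‖y‖, (one_lt_div this).2 hyR, by field_simp; rfl⟩
    have hmem : ∀ z ∈ Metric.ball (0 : ℂ) ρ, x + z • y ∈ U := fun z hz ↦ by
      refine hsub ?_
      rw [mem_ball_zero_iff] at hz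
      rw [Metric.mem_closedBall, dist_self_add_left, norm_smul]
      exact (mul_le_mul_of_nonneg_right hz.le (norm_nonneg _)).trans hρR
    have hd : DifferentiableOn ℂ (fun z : ℂ ↦ f (x + z • y)) (Metric.ball 0 ρ) :=
      (hf.differentiableOn (by simp)).comp (by fun_prop) hmem
    have h := Complex.hasSum_taylorSeries_on_ball hd (z := 1) (by simpa using hρ)
    simp only [one_smul, sub_zero, one_pow] at h
    convert h using 2 with k
    have := iteratedDeriv_comp_line hU hf x y k 0 (by simpa using hx)
    simp only [zero_smul, add_zero] at this
    rw [this]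
    simp [p]

end SeveralVariables

/-! ### Injective entire functions with a pole at infinity -/

section Entire

open Filter Topology

/-- An injective entire function `a` with a pole at infinity is affine, hence the identity if it
fixes `0` and `1`. The hypothesis at infinity is that `1 / a (1 / s)` extends to a function `g` that
is differentiable at `0` and vanishes there. At a point `t₀` with `a' t₀ ≠ 0`, injectivity means
that the divided difference of `a` has no zeros; its inverse is an entire function with the limit
`g' 0` at infinity, hence a constant. -/
theorem eq_id_of_injective_of_pole {a g : ℂ → ℂ} (ha : Differentiable ℂ a)
    (hinj : Function.Injective a) (h0 : a 0 = 0) (h1 : a 1 = 1) (hg : DifferentiableAt ℂ g 0)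
    (hg0 : g 0 = 0) (hag : ∀ᶠ s in 𝓝[≠] (0 : ℂ), g s * a s⁻¹ = 1) (t : ℂ) : a t = t := by
  obtain ⟨t₀, ht₀⟩ : ∃ t₀, deriv a t₀ ≠ 0 := by
    by_contra! h
    have := is_const_of_deriv_eq_zero ha h 0 1
    simp [h0, h1] at this
  have hq : ∀ z, dslope a t₀ z ≠ 0 := by
    intro z
    rcases eq_or_ne z t₀ with rfl | hz
    · simpa using ht₀
    · rw [dslope_of_ne _ hz, slope_def_field]
      exact div_ne_zero (sub_ne_zero.2 (hinj.ne hz)) (sub_ne_zero.2 hz)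
  have hqd : Differentiable ℂ (dslope a t₀) := by
    rw [← differentiableOn_univ]
    exact (Complex.differentiableOn_dslope univ_mem).2 ha.differentiableOn
  have hid : Differentiable ℂ fun z ↦ (dslope a t₀ z)⁻¹ := fun z ↦ (hqd z).inv (hq z)
  have hlim : Tendsto (fun s ↦ (dslope a t₀ s⁻¹)⁻¹) (𝓝[≠] (0 : ℂ)) (𝓝 (deriv g 0)) := by
    have h2 : Tendsto (fun s ↦ slope g 0 s * (1 - s * t₀) / (1 - a t₀ * g s)) (𝓝[≠] (0 : ℂ))
        (𝓝 (deriv g 0 * (1 - 0 * t₀) / (1 - a t₀ * 0))) := by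
      have hgc : Tendsto g (𝓝[≠] (0 : ℂ)) (𝓝 0) := by
        simpa [hg0] using hg.continuousAt.tendsto.mono_left (nhdsWithin_le_nhds (s := {0}ᶜ))
      have hs : Tendsto (fun s : ℂ ↦ s) (𝓝[≠] (0 : ℂ)) (𝓝 0) :=
        tendsto_id.mono_left nhdsWithin_le_nhds
      refine ((hasDerivAt_iff_tendsto_slope.1 hg.hasDerivAt).mul
        (tendsto_const_nhds.sub (hs.mul_const t₀))).div
        (tendsto_const_nhds.sub (hgc.const_mul _)) (by simp)
    simp only [zero_mul, sub_zero, mul_one, mul_zero, div_one] at h2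
    refine h2.congr' ?_
    have hne : ∀ᶠ s in 𝓝[≠] (0 : ℂ), s⁻¹ ≠ t₀ :=
      Filter.tendsto_inv₀_nhdsNE_zero.eventually_ne_cobounded t₀
    filter_upwards [hag, hne, self_mem_nhdsWithin] with s hs hst (hs0 : s ≠ 0)
    have hgs : g s ≠ 0 := left_ne_zero_of_mul (hs ▸ one_ne_zero)
    have has : a s⁻¹ = (g s)⁻¹ := eq_inv_of_mul_eq_one_right hs
    have hsub : a s⁻¹ - a t₀ ≠ 0 := sub_ne_zero.2 (hinj.ne hst)
    have hsub' : 1 - a t₀ * g s ≠ 0 := by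
      rw [has] at hsub
      intro h
      apply hsub
      field_simp
      linear_combination h
    rw [dslope_of_ne _ hst, slope_def_field, slope_def_field, inv_div, hg0, has]
    rw [has] at hsub
    field_simp
    ring
  have hlim' : Tendsto (fun z ↦ (dslope a t₀ z)⁻¹) (cocompact ℂ) (𝓝 (deriv g 0)) := by
    have := hlim.comp (tendsto_inv₀_cobounded' : Tendsto (Inv.inv : ℂ → ℂ) _ _)
    rw [← Metric.cobounded_eq_cocompact]
    refine this.congr fun z ↦ by simp
  have hconst : ∀ z, dslope a t₀ z = (deriv g 0)⁻¹ := fun z ↦ by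
    rw [← hid.apply_eq_of_tendsto_cocompact z hlim', inv_inv]
  have haff : ∀ z, a z = a t₀ + (z - t₀) * (deriv g 0)⁻¹ := fun z ↦ by
    rw [← hconst z, ← smul_eq_mul, sub_smul_dslope]
    ring
  have e0 := haff 0
  have e1 := haff 1
  rw [h0] at e0
  rw [h1] at e1
  have hg1 : (deriv g 0)⁻¹ = 1 := by linear_combination e0 - e1
  rw [hg1] at e0
  rw [haff, hg1]
  linear_combination -e0

end Entire

/-! ### Vector fields and connections in coordinates -/

section Coordinates

open Topology

variable {E : Type*} [NormedAddCommGroup E] [NormedSpace ℂ E]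
  {M : Type*} [TopologicalSpace M] [ChartedSpace E M] [IsManifold 𝓘(ℂ, E) ω M]

/-- The vector field `X` is differentiable at `x`. -/
abbrev IsDiffAt (X : ∀ x : M, TangentSpace 𝓘(ℂ, E) x) (x : M) : Prop :=
  MDifferentiableAt 𝓘(ℂ, E) (𝓘(ℂ, E).prod 𝓘(ℂ, E))
    (fun y ↦ (⟨y, X y⟩ : TangentBundle 𝓘(ℂ, E) M)) x

/-- The vector field `X` is holomorphic near `x`. -/
abbrev IsHolAt (X : ∀ x : M, TangentSpace 𝓘(ℂ, E) x) (x : M) : Prop :=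
  ContMDiffAt 𝓘(ℂ, E) (𝓘(ℂ, E).prod 𝓘(ℂ, E)) ω
    (fun y ↦ (⟨y, X y⟩ : TangentBundle 𝓘(ℂ, E) M)) x

theorem IsHolAt.isDiffAt {X : ∀ x : M, TangentSpace 𝓘(ℂ, E) x} {x : M} (h : IsHolAt X x) :
    IsDiffAt X x :=
  h.mdifferentiableAt (by simp)

/-- The isomorphism `T_y M → E` given by the chart at `x₀`, for `y` in the domain of this chart. -/
def toCoord (x₀ y : M) : TangentSpace 𝓘(ℂ, E) y →L[ℂ] E :=
  (trivializationAt E (TangentSpace 𝓘(ℂ, E)) x₀).continuousLinearMapAt ℂ y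

/-- The isomorphism `E → T_y M` given by the chart at `x₀`, for `y` in the domain of this chart. -/
def ofCoord (x₀ y : M) : E →L[ℂ] TangentSpace 𝓘(ℂ, E) y :=
  (trivializationAt E (TangentSpace 𝓘(ℂ, E)) x₀).symmL ℂ y

theorem toCoord_ofCoord {x₀ y : M} (hy : y ∈ (chartAt E x₀).source) (v : E) :
    toCoord x₀ y (ofCoord x₀ y v) = v :=
  (trivializationAt E (TangentSpace 𝓘(ℂ, E)) x₀).continuousLinearMapAt_symmL hy v

theorem ofCoord_toCoord {x₀ y : M} (hy : y ∈ (chartAt E x₀).source)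
    (v : TangentSpace 𝓘(ℂ, E) y) : ofCoord x₀ y (toCoord x₀ y v) = v :=
  (trivializationAt E (TangentSpace 𝓘(ℂ, E)) x₀).symmL_continuousLinearMapAt hy v

theorem toCoord_injective {x₀ y : M} (hy : y ∈ (chartAt E x₀).source) :
    Function.Injective (toCoord (E := E) x₀ y) :=
  Function.LeftInverse.injective (g := ofCoord x₀ y) (ofCoord_toCoord hy)

theorem trivializationAt_snd_eq_toCoord {x₀ y : M} (hy : y ∈ (chartAt E x₀).source)
    (v : TangentSpace 𝓘(ℂ, E) y) :
    (trivializationAt E (TangentSpace 𝓘(ℂ, E)) x₀ ⟨y, v⟩).2 = toCoord x₀ y v := by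
  rw [toCoord, Bundle.Trivialization.continuousLinearMapAt_apply,
    Bundle.Trivialization.coe_linearMapAt_of_mem _ hy]

theorem toCoord_self (x : M) (v : TangentSpace 𝓘(ℂ, E) x) : toCoord x x v = v := by
  rw [← trivializationAt_snd_eq_toCoord (mem_chart_source E x)]
  exact tangentCoordChange_self (I := 𝓘(ℂ, E)) (mem_extChartAt_source x)

theorem ofCoord_self (x : M) (v : E) : ofCoord x x v = (v : TangentSpace 𝓘(ℂ, E) x) := by
  have := ofCoord_toCoord (mem_chart_source E x) (v : TangentSpace 𝓘(ℂ, E) x)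
  erw [toCoord_self] at this
  exact this

theorem extend_eq_ofCoord {x y : M} (hy : y ∈ (chartAt E x).source)
    (v : TangentSpace 𝓘(ℂ, E) x) :
    FiberBundle.extend E v y = ofCoord x y (toCoord x x v) := by
  simp only [FiberBundle.extend, trivializationAt_snd_eq_toCoord (mem_chart_source E x)]
  exact ((trivializationAt E (TangentSpace 𝓘(ℂ, E)) x).symmL_apply hy _).symm

theorem toCoord_eq_mfderiv {x₀ y : M} (hy : y ∈ (chartAt E x₀).source) :
    toCoord x₀ y = mfderiv 𝓘(ℂ, E) 𝓘(ℂ, E) (extChartAt 𝓘(ℂ, E) x₀) y :=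
  TangentBundle.continuousLinearMapAt_trivializationAt hy

theorem isDiffAt_iff {x₀ y : M} (hy : y ∈ (chartAt E x₀).source)
    {X : ∀ x : M, TangentSpace 𝓘(ℂ, E) x} :
    IsDiffAt X y ↔ MDifferentiableAt 𝓘(ℂ, E) 𝓘(ℂ, E) (fun y ↦ toCoord x₀ y (X y)) y := by
  rw [IsDiffAt, (trivializationAt E (TangentSpace 𝓘(ℂ, E)) x₀).mdifferentiableAt_section_iff
    𝓘(ℂ, E) X hy]
  refine Filter.EventuallyEq.mdifferentiableAt_iff ?_
  filter_upwards [(chartAt E x₀).open_source.mem_nhds hy] with z hz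
  exact trivializationAt_snd_eq_toCoord hz _

theorem isHolAt_iff {x₀ y : M} (hy : y ∈ (chartAt E x₀).source)
    {X : ∀ x : M, TangentSpace 𝓘(ℂ, E) x} :
    IsHolAt X y ↔ ContMDiffAt 𝓘(ℂ, E) 𝓘(ℂ, E) ω (fun y ↦ toCoord x₀ y (X y)) y := by
  rw [IsHolAt, (trivializationAt E (TangentSpace 𝓘(ℂ, E)) x₀).contMDiffAt_section_iff hy]
  refine Filter.EventuallyEq.contMDiffAt_iff ?_
  filter_upwards [(chartAt E x₀).open_source.mem_nhds hy] with z hz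
  exact trivializationAt_snd_eq_toCoord hz _

theorem isHolAt_ofCoord {x₀ y : M} (hy : y ∈ (chartAt E x₀).source) (v : E) :
    IsHolAt (fun y ↦ ofCoord x₀ y v) y := by
  rw [isHolAt_iff hy]
  refine contMDiffAt_const (c := v) |>.congr_of_eventuallyEq ?_
  filter_upwards [(chartAt E x₀).open_source.mem_nhds hy] with z hz
  exact toCoord_ofCoord hz v

theorem mdifferentiableAt_iff_extChartAt_symm {G : Type*} [NormedAddCommGroup G] [NormedSpace ℂ G]
    {x₀ y : M} (hy : y ∈ (chartAt E x₀).source) {f : M → G} :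
    MDifferentiableAt 𝓘(ℂ, E) 𝓘(ℂ, G) f y ↔
      DifferentiableAt ℂ (fun z ↦ f ((extChartAt 𝓘(ℂ, E) x₀).symm z))
        (extChartAt 𝓘(ℂ, E) x₀ y) := by
  have hy' : y ∈ (extChartAt 𝓘(ℂ, E) x₀).source := by rwa [extChartAt_source]
  rw [← mdifferentiableAt_iff_differentiableAt]
  constructor
  · intro h
    have h2 : MDifferentiableAt 𝓘(ℂ, E) 𝓘(ℂ, E) (extChartAt 𝓘(ℂ, E) x₀).symm
        (extChartAt 𝓘(ℂ, E) x₀ y) :=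
      ((contMDiffOn_extChartAt_symm (n := 1) x₀).contMDiffAt
        (extChartAt_target_mem_nhds' (PartialEquiv.map_source _ hy'))).mdifferentiableAt (by simp)
    refine MDifferentiableAt.comp (I' := 𝓘(ℂ, E)) _ ?_ h2
    rwa [PartialEquiv.left_inv _ hy']
  · intro h
    have h2 : MDifferentiableAt 𝓘(ℂ, E) 𝓘(ℂ, E) (extChartAt 𝓘(ℂ, E) x₀) y :=
      (contMDiffAt_extChartAt' (n := 1) hy).mdifferentiableAt (by simp)
    refine (MDifferentiableAt.comp y h h2).congr_of_eventuallyEq ?_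
    filter_upwards [extChartAt_source_mem_nhds' (I := 𝓘(ℂ, E)) hy'] with z hz
    simp only [Function.comp_apply, PartialEquiv.left_inv _ hz]

theorem mfderiv_eq_fderiv_extChartAt {G : Type*} [NormedAddCommGroup G] [NormedSpace ℂ G]
    {x₀ y : M} (hy : y ∈ (chartAt E x₀).source) {f : M → G}
    (hf : MDifferentiableAt 𝓘(ℂ, E) 𝓘(ℂ, G) f y) (v : TangentSpace 𝓘(ℂ, E) y) :
    mvfderiv 𝓘(ℂ, E) f y v =
      fderiv ℂ (fun z ↦ f ((extChartAt 𝓘(ℂ, E) x₀).symm z)) (extChartAt 𝓘(ℂ, E) x₀ y)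
        (toCoord x₀ y v) := by
  have hy' : y ∈ (extChartAt 𝓘(ℂ, E) x₀).source := by rwa [extChartAt_source]
  have h1 := (mdifferentiableAt_iff_extChartAt_symm hy).1 hf
  have h2 : MDifferentiableAt 𝓘(ℂ, E) 𝓘(ℂ, E) (extChartAt 𝓘(ℂ, E) x₀) y :=
    (contMDiffAt_extChartAt' (n := 1) hy).mdifferentiableAt (by simp)
  have h3 : HasMFDerivAt 𝓘(ℂ, E) 𝓘(ℂ, G) f y
      ((fderiv ℂ (fun z ↦ f ((extChartAt 𝓘(ℂ, E) x₀).symm z)) (extChartAt 𝓘(ℂ, E) x₀ y)).comp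
        (mfderiv 𝓘(ℂ, E) 𝓘(ℂ, E) (extChartAt 𝓘(ℂ, E) x₀) y)) := by
    refine (HasMFDerivAt.comp y h1.hasFDerivAt.hasMFDerivAt h2.hasMFDerivAt).congr_of_eventuallyEq ?_
    filter_upwards [extChartAt_source_mem_nhds' (I := 𝓘(ℂ, E)) hy'] with z hz
    simp only [Function.comp_apply, PartialEquiv.left_inv _ hz]
  rw [mvfderiv, h3.mfderiv, toCoord_eq_mfderiv hy]
  rfl

theorem isDiffAt_extend {x : M} (v : TangentSpace 𝓘(ℂ, E) x) :
    IsDiffAt (FiberBundle.extend E v) x :=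
  FiberBundle.mdifferentiableAt_extend ..

/-- The formula `(∇_h X)^ = dX^(h) + Γ(h, X^)` in the chart at `x₀`, where `X^` is the coordinate
expression of `X`, and `Γ(h, v)` is the value at `h` of the covariant derivative of the vector
field with constant coordinates `v`. -/
theorem toCoord_connection_apply [FiniteDimensional ℂ E] (D : AffineConnection E M) {x₀ y : M}
    (hy : y ∈ (chartAt E x₀).source) {X : ∀ x : M, TangentSpace 𝓘(ℂ, E) x} (hX : IsDiffAt X y)
    (v : TangentSpace 𝓘(ℂ, E) y) :
    toCoord x₀ y (D X y v) =
      fderiv ℂ (fun z ↦ toCoord x₀ ((extChartAt 𝓘(ℂ, E) x₀).symm z)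
        (X ((extChartAt 𝓘(ℂ, E) x₀).symm z))) (extChartAt 𝓘(ℂ, E) x₀ y) (toCoord x₀ y v) +
      toCoord x₀ y (D (fun p ↦ ofCoord x₀ p (toCoord x₀ y (X y))) y v) := by
  set b := Module.finBasis ℂ E
  set ℓ : Fin (Module.finrank ℂ E) → E →L[ℂ] ℂ := fun i ↦ LinearMap.toContinuousLinearMap (b.coord i)
  set s : Fin (Module.finrank ℂ E) → ∀ x : M, TangentSpace 𝓘(ℂ, E) x :=
    fun i p ↦ ofCoord x₀ p (b i)
  have hs : ∀ i, IsDiffAt (s i) y := fun i ↦ (isHolAt_ofCoord hy (b i)).isDiffAt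
  have hsum : ∀ u : E, ∑ i, ℓ i u • b i = u := fun u ↦ b.sum_repr u
  have hDsum : ∀ (f : Fin (Module.finrank ℂ E) → M → ℂ),
      (∀ i, MDifferentiableAt 𝓘(ℂ, E) 𝓘(ℂ, ℂ) (f i) y) →
      D (fun p ↦ ∑ i, f i p • s i p) y v =
        ∑ i, (f i y • D (s i) y v + mvfderiv 𝓘(ℂ, E) (f i) y v • s i y) := by
    intro f hf
    have key : ∀ t : Finset (Fin (Module.finrank ℂ E)),
        IsDiffAt (fun p ↦ ∑ i ∈ t, f i p • s i p) y ∧ D (fun p ↦ ∑ i ∈ t, f i p • s i p) y v =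
          ∑ i ∈ t, (f i y • D (s i) y v + mvfderiv 𝓘(ℂ, E) (f i) y v • s i y) := by
      intro t
      induction t using Finset.induction_on with
      | empty =>
        have : (fun p : M ↦ ∑ i ∈ (∅ : Finset (Fin (Module.finrank ℂ E))), f i p • s i p) = 0 := by
          ext p; simp
        rw [this, CovariantDerivative.zero]
        exact ⟨Bundle.mdifferentiable_zeroSection ℂ (TangentSpace 𝓘(ℂ, E) : M → Type _) y,
          by simp⟩
      | insert a t ha ih =>
        have hfs : IsDiffAt (f a • s a) y := (hf a).smul_section (hs a)
        have e : (fun p : M ↦ ∑ i ∈ insert a t, f i p • s i p) =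
            f a • s a + fun p ↦ ∑ i ∈ t, f i p • s i p := by
          ext p; simp [Finset.sum_insert ha]
        rw [e]
        refine ⟨mdifferentiableAt_add_section hfs ih.1, ?_⟩
        rw [D.isCovariantDerivativeOnUniv.add hfs ih.1,
          D.isCovariantDerivativeOnUniv.leibniz (hs a) (hf a), Finset.sum_insert ha,
          add_apply, ih.2]
        rfl
    exact (key Finset.univ).2
  -- The coordinates of `X` are its coefficients in the frame `s` of fields with constant coordinates.
  have hXc := (isDiffAt_iff hy).1 hX
  set f : Fin (Module.finrank ℂ E) → M → ℂ := fun i p ↦ ℓ i (toCoord x₀ p (X p)) with hf_def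
  have hf : ∀ i, MDifferentiableAt 𝓘(ℂ, E) 𝓘(ℂ, ℂ) (f i) y := fun i ↦
    (ℓ i).differentiableAt.comp_mdifferentiableAt hXc
  have hXs : ∀ p ∈ (chartAt E x₀).source, X p = ∑ i, f i p • s i p := fun p hp ↦ by
    apply toCoord_injective hp
    simp only [map_sum, map_smul, f, s, toCoord_ofCoord hp]
    exact (hsum _).symm
  have hev : ∀ᶠ p in 𝓝 y, X p = ∑ i, f i p • s i p :=
    Filter.mem_of_superset ((chartAt E x₀).open_source.mem_nhds hy) hXs
  have hX' : IsDiffAt (fun p ↦ ∑ i, f i p • s i p) y := by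
    refine hX.congr_of_eventuallyEq ?_
    filter_upwards [hev] with p hp
    rw [hp]
  have h1 : D X y v = ∑ i, (f i y • D (s i) y v + mvfderiv 𝓘(ℂ, E) (f i) y v • s i y) := by
    rw [← hDsum f hf, D.isCovariantDerivativeOnUniv.congr_of_eventuallyEq hX hX' Filter.univ_mem hev]
  have h2 : D (fun p ↦ ofCoord x₀ p (toCoord x₀ y (X y))) y v = ∑ i, f i y • D (s i) y v := by
    have h3 := hDsum (fun i _ ↦ f i y) (fun i ↦ mdifferentiableAt_const)
    have e : (fun p ↦ ∑ i, f i y • s i p) = fun p ↦ ofCoord x₀ p (toCoord x₀ y (X y)) := by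
      ext p
      conv_rhs => rw [← hsum (toCoord x₀ y (X y))]
      simp only [map_sum, map_smul, f, s]
    rw [← e, h3]
    refine Finset.sum_congr rfl fun i _ ↦ ?_
    simp [mvfderiv]
  have hXd : DifferentiableAt ℂ (fun z ↦ toCoord x₀ ((extChartAt 𝓘(ℂ, E) x₀).symm z)
      (X ((extChartAt 𝓘(ℂ, E) x₀).symm z))) (extChartAt 𝓘(ℂ, E) x₀ y) :=
    (mdifferentiableAt_iff_extChartAt_symm hy).1 hXc
  have h4 : ∀ i, mvfderiv 𝓘(ℂ, E) (f i) y v =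
      ℓ i (fderiv ℂ (fun z ↦ toCoord x₀ ((extChartAt 𝓘(ℂ, E) x₀).symm z)
        (X ((extChartAt 𝓘(ℂ, E) x₀).symm z))) (extChartAt 𝓘(ℂ, E) x₀ y) (toCoord x₀ y v)) := by
    intro i
    rw [mfderiv_eq_fderiv_extChartAt hy (hf i)]
    exact congrArg (fun A ↦ A (toCoord x₀ y v)) ((ℓ i).hasFDerivAt.comp _ hXd.hasFDerivAt).fderiv
  rw [h1, h2, Finset.sum_add_distrib, map_add, add_comm]
  congr 1
  simp only [map_sum, map_smul, s, h4, toCoord_ofCoord hy]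
  exact hsum _

/-- The covariant derivative of a vector field with constant coordinates `v` is linear in `v`. -/
theorem connection_ofCoord_sum [FiniteDimensional ℂ E] (D : AffineConnection E M) {x₀ y : M}
    (hy : y ∈ (chartAt E x₀).source) {ι : Type*} (t : Finset ι) (a : ι → ℂ) (w : ι → E) :
    D (fun p ↦ ofCoord x₀ p (∑ i ∈ t, a i • w i)) y =
      ∑ i ∈ t, a i • D (fun p ↦ ofCoord x₀ p (w i)) y := by
  induction t using Finset.cons_induction with
  | empty =>
    have : (fun p : M ↦ ofCoord x₀ p (∑ i ∈ (∅ : Finset ι), a i • w i)) = 0 := by ext p; simp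
    rw [this, CovariantDerivative.zero]
    simp
  | cons j t hj ih =>
    have e : (fun p : M ↦ ofCoord x₀ p (∑ i ∈ Finset.cons j t hj, a i • w i)) =
        (a j • fun p ↦ ofCoord x₀ p (w j)) + fun p ↦ ofCoord x₀ p (∑ i ∈ t, a i • w i) := by
      ext p; simp
    have h1 := (isHolAt_ofCoord hy (w j)).isDiffAt
    rw [e, D.isCovariantDerivativeOnUniv.add (by simpa using (mdifferentiableAt_const
      (I := 𝓘(ℂ, E)) (I' := 𝓘(ℂ, ℂ)) (c := a j)).smul_section h1)
      (isHolAt_ofCoord hy _).isDiffAt, D.isCovariantDerivativeOnUniv.smul_const _ h1, ih,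
      Finset.sum_cons]

/-- The covariant derivative of the vector field with constant coordinates `v` in the chart at
`x₀`, at the point with coordinates `z` and in coordinates. -/
def constDeriv (D : AffineConnection E M) (x₀ : M) (v : E) (z : E) : E →L[ℂ] E :=
  (toCoord x₀ ((extChartAt 𝓘(ℂ, E) x₀).symm z)).comp
    ((D (fun p ↦ ofCoord x₀ p v) ((extChartAt 𝓘(ℂ, E) x₀).symm z)).comp
      (ofCoord x₀ ((extChartAt 𝓘(ℂ, E) x₀).symm z)))

/-- The Christoffel symbols of a connection in the chart at `x₀`, as a function of the
coordinates: `christoffel D x₀ z h v` is `∇_h Y` where `Y` has constant coordinates `v`. It is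
assembled from the values at a basis, which makes it visibly linear in `v`. -/
def christoffel [FiniteDimensional ℂ E] (D : AffineConnection E M) (x₀ : M) (z : E) :
    E →L[ℂ] E →L[ℂ] E :=
  ∑ i, (ContinuousLinearMap.smulRightL ℂ E E
    (LinearMap.toContinuousLinearMap ((Module.finBasis ℂ E).coord i))).comp
      (constDeriv D x₀ (Module.finBasis ℂ E i) z)

theorem christoffel_apply [FiniteDimensional ℂ E] (D : AffineConnection E M) {x₀ y : M}
    (hy : y ∈ (chartAt E x₀).source) (h v : E) :
    christoffel D x₀ (extChartAt 𝓘(ℂ, E) x₀ y) h v =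
      toCoord x₀ y (D (fun p ↦ ofCoord x₀ p v) y (ofCoord x₀ y h)) := by
  have hy' : (extChartAt 𝓘(ℂ, E) x₀).symm (extChartAt 𝓘(ℂ, E) x₀ y) = y :=
    PartialEquiv.left_inv _ (by rwa [extChartAt_source])
  conv_rhs => rw [← (Module.finBasis ℂ E).sum_repr v]
  rw [connection_ofCoord_sum D hy]
  simp only [christoffel, constDeriv]
  rw [hy']
  simp

end Coordinates

/-! ### Parallel transport in coordinates -/

section Parallel

open Topology

variable {E : Type*} [NormedAddCommGroup E] [NormedSpace ℂ E] [FiniteDimensional ℂ E]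
  {M : Type*} [TopologicalSpace M] [ChartedSpace E M] [IsManifold 𝓘(ℂ, E) ω M]

omit [FiniteDimensional ℂ E] in
/-- A family of linear maps is assembled from its values at a basis by fixed linear operations, so
that it is as smooth as these values. -/
theorem clm_eq_sum_smulRightL {V F G : Type*} [NormedAddCommGroup F] [NormedSpace ℂ F]
    [FiniteDimensional ℂ F] [NormedAddCommGroup G] [NormedSpace ℂ G] (A : V → F →L[ℂ] G) :
    A = fun z ↦ ∑ i, (ContinuousLinearMap.smulRightL ℂ F G
      (LinearMap.toContinuousLinearMap ((Module.finBasis ℂ F).coord i)))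
      (A z (Module.finBasis ℂ F i)) := by
  ext z v
  have : A z v = ∑ i, (Module.finBasis ℂ F).repr v i • A z (Module.finBasis ℂ F i) := by
    conv_lhs => rw [← (Module.finBasis ℂ F).sum_repr v, map_sum]
    simp only [map_smul]
  rw [this]
  simp

omit [FiniteDimensional ℂ E] in
theorem differentiableAt_clm_of_forall_apply {V F G : Type*} [NormedAddCommGroup V] [NormedSpace ℂ V]
    [NormedAddCommGroup F] [NormedSpace ℂ F] [FiniteDimensional ℂ F] [NormedAddCommGroup G]
    [NormedSpace ℂ G] {A : V → F →L[ℂ] G} {z : V}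
    (h : ∀ v, DifferentiableAt ℂ (fun z ↦ A z v) z) : DifferentiableAt ℂ A z := by
  rw [clm_eq_sum_smulRightL A]
  exact DifferentiableAt.fun_sum fun i _ ↦
    (ContinuousLinearMap.differentiableAt _).comp _ (h _)

omit [FiniteDimensional ℂ E] in
theorem contDiffAt_clm_of_forall_apply {V F G : Type*} [NormedAddCommGroup V] [NormedSpace ℂ V]
    [NormedAddCommGroup F] [NormedSpace ℂ F] [FiniteDimensional ℂ F] [NormedAddCommGroup G]
    [NormedSpace ℂ G] {n : ℕ∞ω} {A : V → F →L[ℂ] G} {z : V}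
    (h : ∀ v, ContDiffAt ℂ n (fun z ↦ A z v) z) : ContDiffAt ℂ n A z := by
  rw [clm_eq_sum_smulRightL A]
  exact ContDiffAt.sum fun i _ ↦ (ContinuousLinearMap.contDiff _).contDiffAt.comp z (h _)

omit [FiniteDimensional ℂ E] in
/-- The product rule for complex linear maps depending on a real parameter. -/
theorem hasDerivWithinAt_clm_apply_real {F G : Type*} [NormedAddCommGroup F] [NormedSpace ℂ F]
    [NormedAddCommGroup G] [NormedSpace ℂ G] {B : ℝ → F →L[ℂ] G} {u : ℝ → F} {B' : F →L[ℂ] G}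
    {u' : F} {s : Set ℝ} {t : ℝ} (hB : HasDerivWithinAt B B' s t)
    (hu : HasDerivWithinAt u u' s t) :
    HasDerivWithinAt (fun t ↦ B t (u t)) (B' (u t) + B t u') s t := by
  have hb : IsBoundedBilinearMap ℝ fun p : (F →L[ℂ] G) × F ↦ p.1 p.2 :=
    { add_left := fun _ _ _ ↦ rfl
      smul_left := fun _ _ _ ↦ rfl
      add_right := fun f _ _ ↦ map_add f _ _
      smul_right := fun r f x ↦ by
        change f (r • x) = r • f x
        exact f.map_smul_of_tower r x
      bound := ⟨1, one_pos, fun f x ↦ by simpa using f.le_opNorm x⟩ }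
  have := (hb.hasFDerivAt (B t, u t)).comp_hasDerivWithinAt t (hB.prodMk hu)
  refine this.congr_deriv ?_
  simp [IsBoundedBilinearMap.deriv, add_comm]

omit [FiniteDimensional ℂ E] in
theorem contMDiffAt_iff_extChartAt_symm {G : Type*} [NormedAddCommGroup G] [NormedSpace ℂ G]
    {x₀ y : M} (hy : y ∈ (chartAt E x₀).source) {f : M → G} :
    ContMDiffAt 𝓘(ℂ, E) 𝓘(ℂ, G) ω f y ↔
      ContDiffAt ℂ ω (fun z ↦ f ((extChartAt 𝓘(ℂ, E) x₀).symm z))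
        (extChartAt 𝓘(ℂ, E) x₀ y) := by
  have hy' : y ∈ (extChartAt 𝓘(ℂ, E) x₀).source := by rwa [extChartAt_source]
  rw [← contMDiffAt_iff_contDiffAt]
  constructor
  · intro h
    have h2 : ContMDiffAt 𝓘(ℂ, E) 𝓘(ℂ, E) ω (extChartAt 𝓘(ℂ, E) x₀).symm
        (extChartAt 𝓘(ℂ, E) x₀ y) :=
      ((contMDiffOn_extChartAt_symm (n := ω) x₀).contMDiffAt
        (extChartAt_target_mem_nhds' (PartialEquiv.map_source _ hy')))
    refine ContMDiffAt.comp (I' := 𝓘(ℂ, E)) _ ?_ h2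
    rwa [PartialEquiv.left_inv _ hy']
  · intro h
    have h2 : ContMDiffAt 𝓘(ℂ, E) 𝓘(ℂ, E) ω (extChartAt 𝓘(ℂ, E) x₀) y :=
      contMDiffAt_extChartAt' hy
    refine (ContMDiffAt.comp y h h2).congr_of_eventuallyEq ?_
    filter_upwards [extChartAt_source_mem_nhds' (I := 𝓘(ℂ, E)) hy'] with z hz
    simp only [Function.comp_apply, PartialEquiv.left_inv _ hz]

/-- The Christoffel symbols of a holomorphic connection are holomorphic. -/
theorem IsHolomorphicConnection.contDiffAt_christoffel {D : AffineConnection E M}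
    (hD : IsHolomorphicConnection D) (x₀ : M) :
    ContDiffAt ℂ ω (christoffel D x₀) (extChartAt 𝓘(ℂ, E) x₀ x₀) := by
  have hN : ∀ v : E, ContDiffAt ℂ ω (constDeriv D x₀ v) (extChartAt 𝓘(ℂ, E) x₀ x₀) := by
    intro v
    have h1 := (hD (chartAt E x₀).source (chartAt E x₀).open_source).contMDiff
      (σ := fun p ↦ ofCoord x₀ p v)
      (fun p hp ↦ (isHolAt_ofCoord hp v).contMDiffWithinAt)
    have h2 := (contMDiffAt_hom_bundle _).1
      (h1.contMDiffAt ((chartAt E x₀).open_source.mem_nhds (mem_chart_source E x₀)))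
    exact (contMDiffAt_iff_extChartAt_symm (mem_chart_source E x₀)).1 h2.2
  unfold christoffel
  exact ContDiffAt.sum fun i _ ↦ contDiffAt_const.clm_comp (hN _)

/-- The moving vector `c` is parallel at the time `t`, in the chart at `x₀`. -/
def IsParallelAt (D : AffineConnection E M) (x₀ : M) (c : ℝ → TangentBundle 𝓘(ℂ, E) M) (t : ℝ) :
    Prop :=
  ∃ w : E, HasDerivWithinAt (fun u ↦ extChartAt 𝓘(ℂ, E) x₀ (c u).proj) w (Set.Icc 0 1) t ∧
    HasDerivWithinAt (fun u ↦ toCoord x₀ (c u).proj (c u).2)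
      (-(christoffel D x₀ (extChartAt 𝓘(ℂ, E) x₀ (c t).proj) w (toCoord x₀ (c t).proj (c t).2)))
      (Set.Icc 0 1) t

theorem christoffel_self (D : AffineConnection E M) (x : M) (w : E)
    (v : TangentSpace 𝓘(ℂ, E) x) :
    christoffel D x (extChartAt 𝓘(ℂ, E) x x) w (toCoord x x v) =
      D (FiberBundle.extend E v) x w := by
  rw [christoffel_apply D (mem_chart_source E x), toCoord_self, ofCoord_self]
  congr 1
  refine D.isCovariantDerivativeOnUniv.congr_of_eventuallyEq
    (isHolAt_ofCoord (mem_chart_source E x) _).isDiffAt (isDiffAt_extend v) Filter.univ_mem ?_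
  filter_upwards [(chartAt E x).open_source.mem_nhds (mem_chart_source E x)] with p hp
  exact (extend_eq_ofCoord hp v).symm

theorem isParallel_iff (D : AffineConnection E M) {c : ℝ → TangentBundle 𝓘(ℂ, E) M}
    (hc : ContinuousOn (fun t ↦ (c t).proj) (Set.Icc 0 1)) :
    IsParallel D c ↔ ∀ t ∈ Set.Icc (0 : ℝ) 1, IsParallelAt D (c t).proj c t := by
  refine forall₂_congr fun t ht ↦ exists_congr fun w ↦ and_congr_right fun _ ↦ ?_
  have hev : (fun u ↦ (trivializationAt E (TangentSpace 𝓘(ℂ, E)) (c t).proj (c u)).2)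
      =ᶠ[𝓝[Set.Icc 0 1] t] fun u ↦ toCoord (c t).proj (c u).proj (c u).2 := by
    filter_upwards [(hc t ht).preimage_mem_nhdsWithin
      ((chartAt E (c t).proj).open_source.mem_nhds (mem_chart_source E (c t).proj))] with u hu
    exact trivializationAt_snd_eq_toCoord hu (c u).2
  rw [christoffel_self]
  exact hev.hasDerivWithinAt_iff_of_mem ht

omit [FiniteDimensional ℂ E] in
theorem toCoord_ofCoord_eq {x₀ x₁ y : M} (h0 : y ∈ (chartAt E x₀).source)
    (h1 : y ∈ (chartAt E x₁).source) (v : E) :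
    toCoord x₁ y (ofCoord x₀ y v) = tangentCoordChange 𝓘(ℂ, E) x₀ x₁ y v := by
  rw [toCoord, ofCoord, TangentBundle.continuousLinearMapAt_trivializationAt_eq_core h1,
    TangentBundle.symmL_trivializationAt_eq_core h0]
  exact tangentCoordChange_comp (I := 𝓘(ℂ, E)) (by
    simp only [extChartAt_source]; exact ⟨⟨h0, mem_chart_source E y⟩, h1⟩)

/-- Parallelism does not depend on the chart. -/
theorem IsParallelAt.change {D : AffineConnection E M} {c : ℝ → TangentBundle 𝓘(ℂ, E) M}
    {t : ℝ} (ht : t ∈ Set.Icc (0 : ℝ) 1)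
    (hc : ContinuousWithinAt (fun t ↦ (c t).proj) (Set.Icc 0 1) t) {x₀ x₁ : M}
    (h0 : (c t).proj ∈ (chartAt E x₀).source) (h1 : (c t).proj ∈ (chartAt E x₁).source)
    (h : IsParallelAt D x₀ c t) : IsParallelAt D x₁ c t := by
  obtain ⟨w, hw, hv⟩ := h
  set y := (c t).proj with hy
  set φ₀ := extChartAt 𝓘(ℂ, E) x₀
  set φ₁ := extChartAt 𝓘(ℂ, E) x₁
  have h0' : y ∈ φ₀.source := by rwa [extChartAt_source]
  have h1' : y ∈ φ₁.source := by rwa [extChartAt_source]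
  -- The derivative of the change of coordinates, as a function of the coordinates.
  set A : E → E →L[ℂ] E := fun z ↦ tangentCoordChange 𝓘(ℂ, E) x₀ x₁ (φ₀.symm z) with hA
  have hz0 : φ₀.symm (φ₀ y) = y := PartialEquiv.left_inv _ h0'
  have hAy : A (φ₀ y) = tangentCoordChange 𝓘(ℂ, E) x₀ x₁ y := by simp only [hA, hz0]
  have hθ : HasFDerivAt (φ₁ ∘ φ₀.symm) (A (φ₀ y)) (φ₀ y) := by
    rw [hAy]
    have := hasFDerivWithinAt_tangentCoordChange (I := 𝓘(ℂ, E)) (x := x₀) (y := x₁) ⟨h0', h1'⟩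
    rwa [ModelWithCorners.range_eq_univ, hasFDerivWithinAt_univ] at this
  have hsrc : ∀ᶠ p in 𝓝 y, p ∈ (chartAt E x₀).source ∧ p ∈ (chartAt E x₁).source :=
    Filter.Eventually.and ((chartAt E x₀).open_source.mem_nhds h0)
      ((chartAt E x₁).open_source.mem_nhds h1)
  have hφ₀c : Filter.Tendsto φ₀.symm (𝓝 (φ₀ y)) (𝓝 y) := by
    have := continuousAt_extChartAt_symm' (I := 𝓘(ℂ, E)) h0'
    rwa [ContinuousAt, hz0] at this
  have hAd : DifferentiableAt ℂ A (φ₀ y) := by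
    have h2 : ∀ᶠ p in 𝓝 y, ∀ v, tangentCoordChange 𝓘(ℂ, E) x₀ x₁ p v =
        toCoord x₁ p (ofCoord x₀ p v) := by
      filter_upwards [hsrc] with p hp v
      exact (toCoord_ofCoord_eq hp.1 hp.2 v).symm
    have h3 : ∀ v : E, DifferentiableAt ℂ (fun z ↦ A z v) (φ₀ y) := by
      intro v
      have h4 := (mdifferentiableAt_iff_extChartAt_symm h0).1
        ((isDiffAt_iff h1).1 (isHolAt_ofCoord h0 v).isDiffAt)
      refine h4.congr_of_eventuallyEq ?_
      filter_upwards [hφ₀c.eventually h2] with z hz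
      exact hz v
    exact differentiableAt_clm_of_forall_apply h3
  -- The transformation rule of the Christoffel symbols.
  have hΓ : ∀ v : E, christoffel D x₁ (φ₁ y) (A (φ₀ y) w) (A (φ₀ y) v) =
      A (φ₀ y) (christoffel D x₀ (φ₀ y) w v) - fderiv ℂ A (φ₀ y) w v := by
    intro v
    have e1 := toCoord_connection_apply D h1 (isHolAt_ofCoord h0 v).isDiffAt (ofCoord x₀ y w)
    have e2 : toCoord x₁ y (D (fun p ↦ ofCoord x₀ p v) y (ofCoord x₀ y w)) =
        A (φ₀ y) (christoffel D x₀ (φ₀ y) w v) := by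
      rw [christoffel_apply D h0, hAy, ← toCoord_ofCoord_eq h0 h1, ofCoord_toCoord h0]
    have e3 : christoffel D x₁ (φ₁ y) (A (φ₀ y) w) (A (φ₀ y) v) =
        toCoord x₁ y (D (fun p ↦ ofCoord x₁ p (toCoord x₁ y (ofCoord x₀ y v))) y
          (ofCoord x₀ y w)) := by
      rw [christoffel_apply D h1, hAy, ← toCoord_ofCoord_eq h0 h1, ← toCoord_ofCoord_eq h0 h1,
        ofCoord_toCoord h1]
    have hd : DifferentiableAt ℂ (fun z ↦ toCoord x₁ (φ₁.symm z) (ofCoord x₀ (φ₁.symm z) v))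
        (φ₁ y) := (mdifferentiableAt_iff_extChartAt_symm h1).1
          ((isDiffAt_iff h1).1 (isHolAt_ofCoord h0 v).isDiffAt)
    have e4 : fderiv ℂ (fun z ↦ toCoord x₁ (φ₁.symm z) (ofCoord x₀ (φ₁.symm z) v)) (φ₁ y)
        (toCoord x₁ y (ofCoord x₀ y w)) = fderiv ℂ A (φ₀ y) w v := by
      have hd' : HasFDerivAt (fun z ↦ toCoord x₁ (φ₁.symm z) (ofCoord x₀ (φ₁.symm z) v))
          (fderiv ℂ (fun z ↦ toCoord x₁ (φ₁.symm z) (ofCoord x₀ (φ₁.symm z) v)) (φ₁ y))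
          ((φ₁ ∘ φ₀.symm) (φ₀ y)) := by
        simp only [Function.comp_apply, hz0]
        exact hd.hasFDerivAt
      have h6 := hd'.comp (φ₀ y) hθ
      have h7 : HasFDerivAt (fun z ↦ A z v)
          ((ContinuousLinearMap.apply ℂ E v).comp (fderiv ℂ A (φ₀ y))) (φ₀ y) :=
        (ContinuousLinearMap.apply ℂ E v).hasFDerivAt.comp _ hAd.hasFDerivAt
      have h8 : (fun z ↦ A z v) =ᶠ[𝓝 (φ₀ y)]
          ((fun z ↦ toCoord x₁ (φ₁.symm z) (ofCoord x₀ (φ₁.symm z) v)) ∘ (φ₁ ∘ φ₀.symm)) := by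
        filter_upwards [hφ₀c.eventually hsrc] with z hz
        have : φ₁.symm (φ₁ (φ₀.symm z)) = φ₀.symm z :=
          PartialEquiv.left_inv _ (by rw [extChartAt_source]; exact hz.2)
        change A z v = toCoord x₁ (φ₁.symm (φ₁ (φ₀.symm z))) (ofCoord x₀ (φ₁.symm (φ₁ (φ₀.symm z))) v)
        rw [this]
        exact (toCoord_ofCoord_eq hz.1 hz.2 v).symm
      have h9 := congrArg (fun B ↦ B w) (h7.unique (h6.congr_of_eventuallyEq h8))
      simp only [ContinuousLinearMap.comp_apply, ContinuousLinearMap.apply_apply] at h9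
      rw [toCoord_ofCoord_eq h0 h1, h9, hAy]
    rw [e3, ← e2, e1, e4]
    abel
  have hev : ∀ᶠ u in 𝓝[Set.Icc (0 : ℝ) 1] t, (c u).proj ∈ (chartAt E x₀).source ∧
      (c u).proj ∈ (chartAt E x₁).source := hc.eventually hsrc
  refine ⟨A (φ₀ y) w, ?_, ?_⟩
  · have := (hθ.restrictScalars ℝ).comp_hasDerivWithinAt t hw
    refine this.congr_of_eventuallyEq_of_mem ?_ ht
    filter_upwards [hev] with u hu
    simp only [Function.comp_apply, φ₀]
    rw [PartialEquiv.left_inv _ (by rw [extChartAt_source]; exact hu.1)]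
  · have hA' : HasDerivWithinAt (fun u ↦ A (φ₀ (c u).proj)) (fderiv ℂ A (φ₀ y) w)
        (Set.Icc 0 1) t := by
      have h := hAd.hasFDerivAt.restrictScalars ℝ
      exact HasFDerivAt.comp_hasDerivWithinAt (l := A) t h hw
    have key := hasDerivWithinAt_clm_apply_real hA' hv
    have hfin : ∀ u, (c u).proj ∈ (chartAt E x₀).source ∧ (c u).proj ∈ (chartAt E x₁).source →
        toCoord x₁ (c u).proj (c u).2 =
          A (φ₀ (c u).proj) (toCoord x₀ (c u).proj (c u).2) := by
      intro u hu
      have : φ₀.symm (φ₀ (c u).proj) = (c u).proj :=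
        PartialEquiv.left_inv _ (by rw [extChartAt_source]; exact hu.1)
      simp only [hA, this]
      rw [← toCoord_ofCoord_eq hu.1 hu.2, ofCoord_toCoord hu.1]
    refine (key.congr_of_eventuallyEq_of_mem ?_ ht).congr_deriv ?_
    · filter_upwards [hev] with u hu
      exact hfin u hu
    · rw [hfin t ⟨h0, h1⟩]
      change _ = -(christoffel D x₁ (φ₁ y) (A (φ₀ y) w) (A (φ₀ y) (toCoord x₀ y (c t).2)))
      rw [hΓ, map_neg]
      abel

end Parallel

section Transport

open Topology

variable {E : Type*} [NormedAddCommGroup E] [NormedSpace ℂ E] [FiniteDimensional ℂ E]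
  {M : Type*} [TopologicalSpace M] [ChartedSpace E M] [IsManifold 𝓘(ℂ, E) ω M]

/-- The field of endomorphisms `L` is parallel: `∇ (L X) = L (∇ X)`. -/
def IsParallelEnd (D : AffineConnection E M)
    (L : ∀ x : M, TangentSpace 𝓘(ℂ, E) x →L[ℂ] TangentSpace 𝓘(ℂ, E) x) : Prop :=
  ∀ (X : ∀ x : M, TangentSpace 𝓘(ℂ, E) x) (x : M), IsDiffAt X x →
    IsDiffAt (fun y ↦ L y (X y)) x ∧ ∀ v, D (fun y ↦ L y (X y)) x v = L x (D X x v)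

/-- The endomorphism field `L` in the chart at `x₀`, as a function of the coordinates. -/
def endCoord (L : ∀ x : M, TangentSpace 𝓘(ℂ, E) x →L[ℂ] TangentSpace 𝓘(ℂ, E) x) (x₀ : M) (z : E) :
    E →L[ℂ] E :=
  (toCoord x₀ ((extChartAt 𝓘(ℂ, E) x₀).symm z)).comp
    ((L ((extChartAt 𝓘(ℂ, E) x₀).symm z)).comp (ofCoord x₀ ((extChartAt 𝓘(ℂ, E) x₀).symm z)))

omit [FiniteDimensional ℂ E] in
theorem toCoord_end_apply (L : ∀ x : M, TangentSpace 𝓘(ℂ, E) x →L[ℂ] TangentSpace 𝓘(ℂ, E) x)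
    {x₀ y : M} (hy : y ∈ (chartAt E x₀).source) (v : TangentSpace 𝓘(ℂ, E) y) :
    toCoord x₀ y (L y v) = endCoord L x₀ (extChartAt 𝓘(ℂ, E) x₀ y) (toCoord x₀ y v) := by
  have hy' : (extChartAt 𝓘(ℂ, E) x₀).symm (extChartAt 𝓘(ℂ, E) x₀ y) = y :=
    PartialEquiv.left_inv _ (by rwa [extChartAt_source])
  simp only [endCoord, ContinuousLinearMap.comp_apply]
  rw [hy', ofCoord_toCoord hy]

/-- In coordinates, a parallel endomorphism field `b` satisfies `db(h) = b Γ(h) - Γ(h) b`. -/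
theorem IsParallelEnd.hasFDerivAt {D : AffineConnection E M}
    {L : ∀ x : M, TangentSpace 𝓘(ℂ, E) x →L[ℂ] TangentSpace 𝓘(ℂ, E) x}
    (hL : IsParallelEnd D L) {x₀ y : M} (hy : y ∈ (chartAt E x₀).source) :
    ∃ b' : E →L[ℂ] E →L[ℂ] E, HasFDerivAt (endCoord L x₀) b' (extChartAt 𝓘(ℂ, E) x₀ y) ∧
      ∀ h v, b' h v =
        endCoord L x₀ (extChartAt 𝓘(ℂ, E) x₀ y)
          (christoffel D x₀ (extChartAt 𝓘(ℂ, E) x₀ y) h v) -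
        christoffel D x₀ (extChartAt 𝓘(ℂ, E) x₀ y) h
          (endCoord L x₀ (extChartAt 𝓘(ℂ, E) x₀ y) v) := by
  have hC : ∀ v : E, IsDiffAt (fun p ↦ ofCoord x₀ p v) y := fun v ↦ (isHolAt_ofCoord hy v).isDiffAt
  have hd : DifferentiableAt ℂ (endCoord L x₀) (extChartAt 𝓘(ℂ, E) x₀ y) :=
    differentiableAt_clm_of_forall_apply fun v ↦
      (mdifferentiableAt_iff_extChartAt_symm hy).1 ((isDiffAt_iff hy).1 (hL _ y (hC v)).1)
  refine ⟨_, hd.hasFDerivAt, fun h v ↦ ?_⟩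
  have e1 := toCoord_connection_apply D hy (hL _ y (hC v)).1 (ofCoord x₀ y h)
  rw [(hL _ y (hC v)).2, toCoord_end_apply L hy, ← christoffel_apply D hy, toCoord_end_apply L hy,
    toCoord_ofCoord hy, toCoord_ofCoord hy, ← christoffel_apply D hy] at e1
  have e2 : HasFDerivAt (fun z ↦ endCoord L x₀ z v)
      ((ContinuousLinearMap.apply ℂ E v).comp (fderiv ℂ (endCoord L x₀)
        (extChartAt 𝓘(ℂ, E) x₀ y))) (extChartAt 𝓘(ℂ, E) x₀ y) :=
    (ContinuousLinearMap.apply ℂ E v).hasFDerivAt.comp _ hd.hasFDerivAt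
  rw [e1, eq_sub_iff_add_eq]
  congr 1
  exact (congrArg (fun B ↦ B h) e2.fderiv).symm

/-- A parallel endomorphism field maps parallel moving vectors to parallel moving vectors. -/
theorem IsParallelEnd.isParallel {D : AffineConnection E M}
    {L : ∀ x : M, TangentSpace 𝓘(ℂ, E) x →L[ℂ] TangentSpace 𝓘(ℂ, E) x}
    (hL : IsParallelEnd D L) {c : ℝ → TangentBundle 𝓘(ℂ, E) M}
    (hc : ContinuousOn (fun t ↦ (c t).proj) (Set.Icc 0 1)) (hp : IsParallel D c) :
    IsParallel D fun t ↦ ⟨(c t).proj, L (c t).proj (c t).2⟩ := by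
  rw [isParallel_iff D hc] at hp
  refine (isParallel_iff D (c := fun t ↦ ⟨(c t).proj, L (c t).proj (c t).2⟩) hc).2 fun t ht ↦ ?_
  obtain ⟨w, hw, hv⟩ := hp t ht
  refine ⟨w, hw, ?_⟩
  have hy := mem_chart_source E (c t).proj
  obtain ⟨b', hb', hbΓ⟩ := hL.hasFDerivAt (D := D) hy
  have hB : HasDerivWithinAt (fun u ↦ endCoord L (c t).proj
      (extChartAt 𝓘(ℂ, E) (c t).proj (c u).proj)) (b' w) (Set.Icc 0 1) t := by
    have h := hb'.restrictScalars ℝ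
    exact HasFDerivAt.comp_hasDerivWithinAt (l := endCoord L (c t).proj) t h hw
  have key := hasDerivWithinAt_clm_apply_real hB hv
  refine (key.congr_of_eventuallyEq_of_mem ?_ ht).congr_deriv ?_
  · filter_upwards [(hc t ht).preimage_mem_nhdsWithin
      ((chartAt E (c t).proj).open_source.mem_nhds hy)] with u hu
    exact toCoord_end_apply L hu _
  · rw [hbΓ, map_neg, toCoord_end_apply L hy]
    abel

theorem IsParallelAt.hasDerivWithinAt {D : AffineConnection E M} {γ : ℝ → M}
    {v : ∀ t : ℝ, TangentSpace 𝓘(ℂ, E) (γ t)} {x₀ : M} {t : ℝ} (ht : t ∈ Set.Icc (0 : ℝ) 1)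
    (h : IsParallelAt D x₀ (fun t ↦ ⟨γ t, v t⟩) t) :
    HasDerivWithinAt (fun u ↦ toCoord x₀ (γ u) (v u))
      (-(christoffel D x₀ (extChartAt 𝓘(ℂ, E) x₀ (γ t))
        (derivWithin (fun u ↦ extChartAt 𝓘(ℂ, E) x₀ (γ u)) (Set.Icc 0 1) t)
        (toCoord x₀ (γ t) (v t)))) (Set.Icc 0 1) t := by
  obtain ⟨w, hw, hv⟩ := h
  have e : derivWithin (fun u ↦ extChartAt 𝓘(ℂ, E) x₀ (γ u)) (Set.Icc 0 1) t = w :=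
    hw.derivWithin (uniqueDiffOn_Icc (zero_lt_one' ℝ) t ht)
  rw [e]
  exact hv

/-- Parallel moving vectors along a `C¹` curve are determined by their initial values. The times at
which two of them agree form a closed set, and by the Gronwall inequality in a chart, agreement at
`t` propagates to the right of `t`. -/
theorem IsParallel.unique {D : AffineConnection E M} (hD : IsHolomorphicConnection D) {γ : ℝ → M}
    (hγ : ContMDiffOn 𝓘(ℝ, ℝ) 𝓘(ℝ, E) 1 γ (Set.Icc 0 1))
    {v v' : ∀ t : ℝ, TangentSpace 𝓘(ℂ, E) (γ t)}
    (hp : IsParallel D fun t ↦ ⟨γ t, v t⟩) (hp' : IsParallel D fun t ↦ ⟨γ t, v' t⟩)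
    (h0 : v 0 = v' 0) : v 1 = v' 1 := by
  have hγc : ContinuousOn γ (Set.Icc 0 1) := hγ.continuousOn
  have hp := (isParallel_iff D (c := fun t ↦ ⟨γ t, v t⟩) hγc).1 hp
  have hp' := (isParallel_iff D (c := fun t ↦ ⟨γ t, v' t⟩) hγc).1 hp'
  set s : Set ℝ := {t | v t = v' t}
  have hsrc : ∀ t ∈ Set.Icc (0 : ℝ) 1, ∀ᶠ u in 𝓝[Set.Icc 0 1] t, γ u ∈ (chartAt E (γ t)).source :=
    fun t ht ↦ (hγc t ht).preimage_mem_nhdsWithin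
      ((chartAt E (γ t)).open_source.mem_nhds (mem_chart_source E (γ t)))
  have hclosed : IsClosed (s ∩ Set.Icc 0 1) := by
    refine isClosed_of_closure_subset fun t ht ↦ ?_
    have htI : t ∈ Set.Icc (0 : ℝ) 1 :=
      closure_minimal Set.inter_subset_right isClosed_Icc ht
    refine ⟨?_, htI⟩
    have hv := IsParallelAt.hasDerivWithinAt htI (hp t htI)
    have hv' := IsParallelAt.hasDerivWithinAt htI (hp' t htI)
    have hfr : ∃ᶠ u in 𝓝[Set.Icc 0 1] t,
        toCoord (γ t) (γ u) (v u) - toCoord (γ t) (γ u) (v' u) ∈ ({0} : Set E) := by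
      rw [mem_closure_iff_frequently] at ht
      rw [nhdsWithin, Filter.frequently_inf_principal]
      refine ht.mono fun u hu ↦ ⟨hu.2, ?_⟩
      rw [hu.1, sub_self]
      rfl
    have hlim := isClosed_singleton.mem_of_frequently_of_tendsto hfr
      (hv.continuousWithinAt.sub hv'.continuousWithinAt)
    exact toCoord_injective (mem_chart_source E (γ t)) (sub_eq_zero.1 hlim)
  have h1 : (1 : ℝ) ∈ s := by
    refine hclosed.Icc_subset_of_forall_mem_nhdsWithin h0 ?_ (Set.right_mem_Icc.2 zero_le_one)
    rintro t ⟨hts, ht0, ht1⟩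
    have htI : t ∈ Set.Icc (0 : ℝ) 1 := ⟨ht0, ht1.le⟩
    set φ := extChartAt 𝓘(ℂ, E) (γ t)
    -- The velocity and the Christoffel symbols are bounded near `t`.
    have hγd : ContDiffWithinAt ℝ 1 (fun u ↦ φ (γ u)) (Set.Icc 0 1) t := by
      have := (contMDiffWithinAt_iff_target.1 (hγ t htI)).2
      exact contMDiffWithinAt_iff_contDiffWithinAt.1 this
    have hw1 : ContinuousWithinAt (derivWithin (fun u ↦ φ (γ u)) (Set.Icc 0 1))
        (Set.Icc 0 1) t :=
      ((hγd.fderivWithin_right (m := 0) (uniqueDiffOn_Icc zero_lt_one) (by simp)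
        htI).continuousWithinAt).clm_apply continuousWithinAt_const
    have hΓ1 : ContinuousWithinAt (fun u ↦ christoffel D (γ t) (φ (γ u))) (Set.Icc 0 1) t :=
      ContinuousAt.comp_continuousWithinAt (g := christoffel D (γ t)) (f := fun u ↦ φ (γ u))
        (hD.contDiffAt_christoffel (γ t)).continuousAt hγd.continuousWithinAt
    have hprod := (hΓ1.clm_apply hw1).norm
    obtain ⟨K, hK⟩ : ∃ K : ℝ, ∀ᶠ u in 𝓝[Set.Icc 0 1] t, ‖christoffel D (γ t) (φ (γ u))
        (derivWithin (fun u ↦ φ (γ u)) (Set.Icc 0 1) u)‖ < K :=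
      ⟨_, hprod.eventually_lt tendsto_const_nhds (lt_add_one _)⟩
    have hev := hK.and (hsrc t htI)
    rw [eventually_nhdsWithin_iff] at hev
    obtain ⟨ε, hε, hball⟩ := Metric.eventually_nhds_iff_ball.1 hev
    set b := min (t + ε / 2) 1
    have htb : t < b := lt_min (by linarith) ht1
    have hbI : Set.Icc t b ⊆ Set.Icc 0 1 := Set.Icc_subset_Icc ht0 (min_le_right _ _)
    have hgood : ∀ u ∈ Set.Icc t b, ‖christoffel D (γ t) (φ (γ u))
        (derivWithin (fun u ↦ φ (γ u)) (Set.Icc 0 1) u)‖ < K ∧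
          γ u ∈ (chartAt E (γ t)).source := by
      intro u hu
      refine hball u ?_ (hbI hu)
      have : u ≤ t + ε / 2 := hu.2.trans (min_le_left _ _)
      rw [Metric.mem_ball, Real.dist_eq, abs_lt]
      constructor <;> linarith [hu.1]
    set f : ℝ → E := fun u ↦ toCoord (γ t) (γ u) (v u) - toCoord (γ t) (γ u) (v' u)
    have hder : ∀ u ∈ Set.Icc t b, HasDerivWithinAt f
        (-(christoffel D (γ t) (φ (γ u)) (derivWithin (fun u ↦ φ (γ u)) (Set.Icc 0 1) u) (f u)))
        (Set.Icc 0 1) u := by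
      intro u hu
      have huI := hbI hu
      have hv := IsParallelAt.hasDerivWithinAt huI (IsParallelAt.change (x₁ := γ t)
        (c := fun t ↦ ⟨γ t, v t⟩) huI (hγc u huI) (mem_chart_source E (γ u)) (hgood u hu).2
        (hp u huI))
      have hv' := IsParallelAt.hasDerivWithinAt huI (IsParallelAt.change (x₁ := γ t)
        (c := fun t ↦ ⟨γ t, v' t⟩) huI (hγc u huI) (mem_chart_source E (γ u)) (hgood u hu).2
        (hp' u huI))
      refine (hv.sub hv').congr_deriv ?_
      simp only [f, map_sub]
      abel
    have hzero : ∀ u ∈ Set.Icc t b, f u = 0 := by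
      intro u hu
      have := norm_le_gronwallBound_of_norm_deriv_right_le (f := f) (δ := 0) (K := K) (ε := 0)
        (a := t) (b := b) (fun u hu ↦ (hder u hu).continuousWithinAt.mono hbI)
        (fun u hu ↦ (hder u ⟨hu.1, hu.2.le⟩).mono_of_mem_nhdsWithin ?_) (by
          have : v t = v' t := hts
          simp [f, this]) ?_ u hu
      · rw [gronwallBound_ε0_δ0] at this
        exact norm_le_zero_iff.1 this
      · have hu0 : 0 ≤ u := ht0.trans hu.1
        have hu1 : u < 1 := hu.2.trans_le (min_le_right _ _)
        exact Filter.mem_of_superset (Icc_mem_nhdsGE hu1) (Set.Icc_subset_Icc_left hu0)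
      · intro u hu
        rw [norm_neg, add_zero]
        refine (ContinuousLinearMap.le_opNorm _ _).trans ?_
        exact mul_le_mul_of_nonneg_right (hgood u ⟨hu.1, hu.2.le⟩).1.le (norm_nonneg _)
    refine Filter.mem_of_superset (Ioc_mem_nhdsGT htb) fun u hu ↦ ?_
    have hu' : u ∈ Set.Icc t b := ⟨hu.1.le, hu.2⟩
    exact toCoord_injective (hgood u hu').2 (sub_eq_zero.1 (hzero u hu'))
  exact h1

/-- Parallel transports commute with parallel endomorphism fields. -/
theorem IsParallelTransport.comm {D : AffineConnection E M} (hD : IsHolomorphicConnection D)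
    {L : ∀ x : M, TangentSpace 𝓘(ℂ, E) x →L[ℂ] TangentSpace 𝓘(ℂ, E) x}
    (hL : IsParallelEnd D L) {x y : M} {f : TangentSpace 𝓘(ℂ, E) x ≃ₗ[ℂ] TangentSpace 𝓘(ℂ, E) y}
    (hf : IsParallelTransport D x y f) (v : TangentSpace 𝓘(ℂ, E) x) :
    f (L x v) = L y (f v) := by
  induction hf with
  | curve x y f γ hγ h =>
    obtain ⟨c, hc, hcp, hc0, hc1⟩ := h v
    obtain ⟨c', hc', hcp', hc0', hc1'⟩ := h (L x v)
    have hprojc : (fun t ↦ (c t).proj) = γ := funext hc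
    have h1 := hL.isParallel (c := c) (by rw [hprojc]; exact hγ.continuousOn) hcp
    -- The two moving vectors to be compared have the same base curve.
    have key : ∀ (a a' : ℝ → TangentBundle 𝓘(ℂ, E) M), (∀ t, (a t).proj = γ t) →
        (∀ t, (a' t).proj = γ t) → IsParallel D a → IsParallel D a' → a 0 = a' 0 → a 1 = a' 1 := by
      intro a a' ha ha' hpa hpa' h0
      have e : ∀ a : ℝ → TangentBundle 𝓘(ℂ, E) M, (∀ t, (a t).proj = γ t) →
          ∃ v : ∀ t, TangentSpace 𝓘(ℂ, E) (γ t), a = fun t ↦ ⟨γ t, v t⟩ := fun a ha ↦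
        have : ∀ t, ∃ w : TangentSpace 𝓘(ℂ, E) (γ t), a t = ⟨γ t, w⟩ := fun t ↦ by
          rw [← ha t]
          exact ⟨(a t).2, rfl⟩
        ⟨fun t ↦ (this t).choose, funext fun t ↦ (this t).choose_spec⟩
      obtain ⟨v, rfl⟩ := e a ha
      obtain ⟨v', rfl⟩ := e a' ha'
      have := IsParallel.unique hD hγ hpa hpa' (by simpa using h0)
      simp [this]
    have hmap : ∀ (p : TangentBundle 𝓘(ℂ, E) M) (q : M) (u : TangentSpace 𝓘(ℂ, E) q), p = ⟨q, u⟩ →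
        (⟨p.proj, L p.proj p.2⟩ : TangentBundle 𝓘(ℂ, E) M) = ⟨q, L q u⟩ := by
      rintro _ q u rfl
      rfl
    have h2 := key (fun t ↦ ⟨(c t).proj, L (c t).proj (c t).2⟩) c' hc hc' h1 hcp'
      ((hmap _ _ _ hc0).trans hc0'.symm)
    have h2 := (hmap _ _ _ hc1).symm.trans (h2.trans hc1')
    simpa using h2.symm
  | trans x y z f g _ _ hf hg => simp [hf, hg]

end Transport

/-! ### Endomorphism fields that commute with parallel transport -/

section LinearODE

open Topology

/-- A linear differential equation with a small coefficient has a solution close to `1`. The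
hypothesis on `‖1‖` admits the zero ring. -/
theorem exists_linear_ode {R : Type*} [NormedRing R] [NormedAlgebra ℝ R] [CompleteSpace R]
    (h1 : ‖(1 : R)‖ ≤ 1) {A : ℝ → R} {η : ℝ} (hη : η ≤ 1 / 4)
    (hA : ContinuousOn A (Set.Icc 0 1)) (hb : ∀ s ∈ Set.Icc (0 : ℝ) 1, ‖A s‖ ≤ η) :
    ∃ U : ℝ → R, U 0 = 1 ∧
      (∀ s ∈ Set.Icc (0 : ℝ) 1, HasDerivWithinAt U (A s * U s) (Set.Icc 0 1) s) ∧
      ∀ s ∈ Set.Icc (0 : ℝ) 1, ‖U s - 1‖ ≤ 2 * η := by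
  have h0I : (0 : ℝ) ∈ Set.Icc (0 : ℝ) 1 := ⟨le_rfl, zero_le_one⟩
  have hη0 : 0 ≤ η := (norm_nonneg _).trans (hb 0 h0I)
  -- Picard's theorem on the ball of radius `1 / 2` about `1`: there `‖x‖ ≤ 3 / 2`, and the speed is at
  -- most `3 / 2 * η ≤ 1 / 2`, so that the solution lives up to the time `1`.
  have hP : IsPicardLindelof (fun s x ↦ A s * x) (⟨0, h0I⟩ : Set.Icc (0 : ℝ) 1) (1 : R)
      (1 / 2) 0 (3 / 2 * ⟨η, hη0⟩) ⟨η, hη0⟩ := by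
    refine ⟨fun s hs ↦ ?_, fun x _ ↦ hA.mul continuousOn_const, fun s hs x hx ↦ ?_, ?_⟩
    · refine LipschitzOnWith.of_dist_le_mul fun x _ y _ ↦ ?_
      rw [dist_eq_norm, dist_eq_norm, ← mul_sub]
      exact (norm_mul_le _ _).trans (mul_le_mul_of_nonneg_right (hb s hs) (norm_nonneg _))
    · rw [Metric.mem_closedBall, dist_eq_norm] at hx
      have hx2 : ‖x‖ ≤ 3 / 2 := by
        have := norm_add_le (x - 1) 1
        have h2 : (((1 / 2 : NNReal) : ℝ)) = 1 / 2 := by norm_num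
        rw [h2] at hx
        rw [sub_add_cancel] at this
        linarith
      refine (norm_mul_le _ _).trans ?_
      change _ ≤ 3 / 2 * η
      nlinarith [hb s hs, norm_nonneg (A s), norm_nonneg x]
    · push_cast
      change 3 / 2 * η * max (1 - 0) (0 - 0) ≤ _
      norm_num
      linarith
  obtain ⟨U, hU0, hU⟩ := hP.exists_eq_forall_mem_Icc_hasDerivWithinAt₀
  refine ⟨U, hU0, hU, fun s hs ↦ ?_⟩
  have hV : ∀ s ∈ Set.Icc (0 : ℝ) 1, HasDerivWithinAt (fun s ↦ U s - 1) (A s * U s)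
      (Set.Icc 0 1) s := fun s hs ↦ (hU s hs).sub_const 1
  have := norm_le_gronwallBound_of_norm_deriv_right_le (f := fun s ↦ U s - 1) (δ := 0) (K := 1)
    (ε := η) (a := 0) (b := 1) (fun s hs ↦ (hV s hs).continuousWithinAt)
    (fun s hs ↦ (hV s ⟨hs.1, hs.2.le⟩).mono_of_mem_nhdsWithin
      (Filter.mem_of_superset (Icc_mem_nhdsGE hs.2) (Set.Icc_subset_Icc_left hs.1)))
    (by simp [show U 0 = 1 from hU0]) (fun s hs ↦ ?_) s hs
  · rw [gronwallBound_of_K_ne_0 one_ne_zero] at this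
    have he : Real.exp (1 * (s - 0)) ≤ 2.7182818286 := by
      refine le_trans (Real.exp_le_exp.2 ?_) Real.exp_one_lt_d9.le
      linarith [hs.2]
    refine this.trans ?_
    beta_reduce
    rw [zero_mul, zero_add, div_one]
    nlinarith
  · have e : A s * U s = A s * (U s - 1) + A s := by noncomm_ring
    rw [e]
    have hAs := hb s ⟨hs.1, hs.2.le⟩
    refine (norm_add_le _ _).trans (add_le_add ((norm_mul_le _ _).trans ?_) hAs)
    exact mul_le_mul_of_nonneg_right (by linarith) (norm_nonneg _)

variable {E : Type*} [NormedAddCommGroup E] [NormedSpace ℂ E] [FiniteDimensional ℂ E]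

/-- `U` solves the equation of parallel transport along the segment from `z` to `z + h`, for the
Christoffel symbols `Γ`. -/
def IsSegmentTransport (Γ : E → E →L[ℂ] E →L[ℂ] E) (z h : E) (U : ℝ → E →L[ℂ] E) : Prop :=
  U 0 = 1 ∧ ∀ s ∈ Set.Icc (0 : ℝ) 1,
    HasDerivWithinAt U (-(Γ (z + s • h) h) * U s) (Set.Icc 0 1) s

omit [FiniteDimensional ℂ E] in
theorem add_smul_mem_ball {z₀ z h : E} {r : ℝ} (hz : z ∈ Metric.ball z₀ r)
    (hzh : z + h ∈ Metric.ball z₀ r) {s : ℝ} (hs : s ∈ Set.Icc (0 : ℝ) 1) :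
    z + s • h ∈ Metric.ball z₀ r :=
  (convex_ball z₀ r).add_smul_mem hz hzh hs

theorem exists_isSegmentTransport {Γ : E → E →L[ℂ] E →L[ℂ] E} {z₀ : E} {r K : ℝ}
    (hΓ : ContinuousOn Γ (Metric.ball z₀ r)) (hK : ∀ z ∈ Metric.ball z₀ r, ‖Γ z‖ ≤ K) {z h : E}
    (hz : z ∈ Metric.ball z₀ r) (hzh : z + h ∈ Metric.ball z₀ r) (hh : K * ‖h‖ ≤ 1 / 4) :
    ∃ U, IsSegmentTransport Γ z h U ∧ ∀ s ∈ Set.Icc (0 : ℝ) 1, ‖U s - 1‖ ≤ 2 * (K * ‖h‖) := by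
  have hc : ContinuousOn (fun s : ℝ ↦ -(Γ (z + s • h) h)) (Set.Icc 0 1) :=
    ((hΓ.comp (by fun_prop) fun s hs ↦ add_smul_mem_ball hz hzh hs).clm_apply
      continuousOn_const).neg
  obtain ⟨U, h0, h1, h2⟩ := exists_linear_ode (R := E →L[ℂ] E) ContinuousLinearMap.norm_id_le hh hc
    fun s hs ↦ by
      rw [norm_neg]
      exact ((Γ _).le_opNorm h).trans
        (mul_le_mul_of_nonneg_right (hK _ (add_smul_mem_ball hz hzh hs)) (norm_nonneg _))
  exact ⟨U, ⟨h0, h1⟩, h2⟩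

omit [FiniteDimensional ℂ E] in
/-- To first order in `h`, the parallel transport along the segment from `z` to `z + h` is
`1 - Γ(z)(h)`. -/
theorem hasFDerivAt_segmentTransport {Γ : E → E →L[ℂ] E →L[ℂ] E} {z₀ : E} {r K : ℝ}
    (hΓ : ContinuousOn Γ (Metric.ball z₀ r)) (hK : ∀ z ∈ Metric.ball z₀ r, ‖Γ z‖ ≤ K) {z : E}
    (hz : z ∈ Metric.ball z₀ r) {U : E → ℝ → E →L[ℂ] E}
    (hU : ∀ᶠ h in 𝓝 0, IsSegmentTransport Γ z h (U h) ∧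
      ∀ s ∈ Set.Icc (0 : ℝ) 1, ‖U h s - 1‖ ≤ 2 * (K * ‖h‖)) :
    HasFDerivAt (fun h ↦ U h 1) (-(Γ z)) 0 := by
  have hK0 : 0 ≤ K := (norm_nonneg (Γ z)).trans (hK z hz)
  have hU01 : U 0 1 = 1 := by
    have := hU.self_of_nhds.2 1 (by simp)
    rw [norm_zero, mul_zero, mul_zero, norm_le_zero_iff, sub_eq_zero] at this
    exact this
  rw [hasFDerivAt_iff_isLittleO_nhds_zero, Asymptotics.isLittleO_iff]
  intro c hc
  have hzc : ContinuousAt Γ z := hΓ.continuousAt (Metric.isOpen_ball.mem_nhds hz)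
  have hzn : Filter.Tendsto (fun y ↦ ‖Γ y - Γ z‖) (𝓝 z) (𝓝 0) := by
    have h := hzc.sub (continuousAt_const (y := Γ z))
    have := ContinuousAt.norm (E := E →L[ℂ] E →L[ℂ] E) h
    have e : ‖Γ z - Γ z‖ = 0 := by rw [sub_self]; exact norm_zero (E := E →L[ℂ] E →L[ℂ] E)
    rw [← e]
    exact this
  obtain ⟨δ, hδ, hδΓ⟩ := Metric.eventually_nhds_iff.1
    (hzn.eventually_lt_const (show 0 < c / 2 by positivity))
  obtain ⟨δ', hδ', hball⟩ := Metric.isOpen_iff.1 (Metric.isOpen_ball (x := z₀) (ε := r)) z hz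
  have h1 : ∀ᶠ h : E in 𝓝 0, ‖h‖ < min (min δ δ') (c / (4 * (K + 1) ^ 2)) := by
    have := Metric.ball_mem_nhds (0 : E)
      (lt_min (lt_min hδ hδ') (show 0 < c / (4 * (K + 1) ^ 2) by positivity))
    filter_upwards [this] with h hh
    simpa using hh
  filter_upwards [hU, h1] with h ⟨⟨hU0, hUd⟩, hUb⟩ hh
  have hhδ : ‖h‖ < δ := hh.trans_le ((min_le_left _ _).trans (min_le_left _ _))
  have hhδ' : ‖h‖ < δ' := hh.trans_le ((min_le_left _ _).trans (min_le_right _ _))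
  have hhc : ‖h‖ * (4 * (K + 1) ^ 2) ≤ c :=
    (le_div_iff₀ (by positivity)).1 (hh.le.trans (min_le_right _ _))
  have hsh : ∀ s ∈ Set.Icc (0 : ℝ) 1, ‖s • h‖ ≤ ‖h‖ := fun s hs ↦ by
    rw [norm_smul, Real.norm_eq_abs, abs_of_nonneg hs.1]
    exact mul_le_of_le_one_left (norm_nonneg _) hs.2
  have hsm : ∀ s ∈ Set.Icc (0 : ℝ) 1, z + s • h ∈ Metric.ball z₀ r := fun s hs ↦ hball (by
    rw [Metric.mem_ball, dist_eq_norm, add_sub_cancel_left]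
    exact (hsh s hs).trans_lt hhδ')
  -- The mean value inequality for `U h s + s Γ(z)(h)`, whose derivative is `o(h)` uniformly in `s`,
  -- as `Γ (z + s h)` is close to `Γ z` and `U h s` is close to `1`.
  have key := norm_image_sub_le_of_norm_deriv_le_segment_01' (f := fun s : ℝ ↦ U h s + s • Γ z h)
    (f' := fun s ↦ -(Γ (z + s • h) h) * U h s + Γ z h) (C := c * ‖h‖)
    (fun s hs ↦ (hUd s hs).add
      (((hasDerivWithinAt_id s _).smul_const (Γ z h)).congr_deriv (one_smul ℝ _)))
    (fun s hs ↦ ?_)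
  · rw [zero_add, hU01]
    convert key using 2
    rw [hU0]
    simp only [neg_apply, one_smul, zero_smul]
    abel
  · have hsI : s ∈ Set.Icc (0 : ℝ) 1 := ⟨hs.1, hs.2.le⟩
    have e : -(Γ (z + s • h) h) * U h s + Γ z h =
        -(Γ (z + s • h) h * (U h s - 1)) - (Γ (z + s • h) - Γ z) h := by
      rw [sub_apply]
      noncomm_ring
    rw [e]
    have hΓs : ‖Γ (z + s • h) h‖ ≤ K * ‖h‖ := ((Γ _).le_opNorm h).trans
      (mul_le_mul_of_nonneg_right (hK _ (hsm s hsI)) (norm_nonneg _))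
    have h3 : ‖Γ (z + s • h) h * (U h s - 1)‖ ≤ K * ‖h‖ * (2 * (K * ‖h‖)) :=
      (norm_mul_le _ _).trans (mul_le_mul hΓs (hUb s hsI) (norm_nonneg _) (by positivity))
    have h4 : ‖Γ (z + s • h) - Γ z‖ ≤ c / 2 := by
      refine (hδΓ ?_).le
      rw [dist_eq_norm, add_sub_cancel_left]
      exact (hsh s hsI).trans_lt hhδ
    have h5 : ‖(Γ (z + s • h) - Γ z) h‖ ≤ c / 2 * ‖h‖ :=
      (ContinuousLinearMap.le_opNorm _ h).trans (mul_le_mul_of_nonneg_right h4 (norm_nonneg _))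
    refine (norm_sub_le _ _).trans ?_
    rw [norm_neg]
    have h6 : K * ‖h‖ * (2 * (K * ‖h‖)) ≤ c / 2 * ‖h‖ := by
      have : 2 * K ^ 2 * ‖h‖ ≤ c / 2 := by
        nlinarith [norm_nonneg h, mul_nonneg hK0 (norm_nonneg h)]
      nlinarith [norm_nonneg h, mul_le_mul_of_nonneg_right this (norm_nonneg h)]
    linarith

/-- A field of endomorphisms invariant under parallel transport along short segments is
differentiable, with the derivative that makes it parallel: `b (z + h) = U b(z) U⁻¹`, and the
derivative of `U` in `h` is known. -/
theorem hasFDerivAt_of_forall_segmentTransport {Γ : E → E →L[ℂ] E →L[ℂ] E} {z₀ : E} {r K : ℝ}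
    (hΓ : ContinuousOn Γ (Metric.ball z₀ r)) (hK : ∀ z ∈ Metric.ball z₀ r, ‖Γ z‖ ≤ K)
    {b : E → E →L[ℂ] E}
    (hb : ∀ z h U, z ∈ Metric.ball z₀ r → z + h ∈ Metric.ball z₀ r → IsSegmentTransport Γ z h U →
      IsUnit (U 1) → b (z + h) * U 1 = U 1 * b z) {z : E} (hz : z ∈ Metric.ball z₀ r) :
    HasFDerivAt b ((ContinuousLinearMap.compL ℂ E E E (b z)).comp (Γ z) -
      ((ContinuousLinearMap.compL ℂ E E E).flip (b z)).comp (Γ z)) z := by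
  have hK0 : 0 ≤ K := (norm_nonneg (Γ z)).trans (hK z hz)
  have hball : ∀ᶠ h in 𝓝 (0 : E), z + h ∈ Metric.ball z₀ r := by
    have : Filter.Tendsto (fun h ↦ z + h) (𝓝 0) (𝓝 z) := by
      simpa using (continuous_const_add z).tendsto 0
    exact this (Metric.isOpen_ball.mem_nhds hz)
  have hsmall : ∀ᶠ h in 𝓝 (0 : E), K * ‖h‖ < 1 / 4 := by
    have : Filter.Tendsto (fun h : E ↦ K * ‖h‖) (𝓝 0) (𝓝 0) := by
      have := (tendsto_norm_zero (E := E)).const_mul K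
      rwa [mul_zero] at this
    exact this.eventually_lt_const (by norm_num)
  have hex : ∀ h, ∃ U, z + h ∈ Metric.ball z₀ r → K * ‖h‖ < 1 / 4 →
      IsSegmentTransport Γ z h U ∧ ∀ s ∈ Set.Icc (0 : ℝ) 1, ‖U s - 1‖ ≤ 2 * (K * ‖h‖) := by
    intro h
    by_cases hh : z + h ∈ Metric.ball z₀ r ∧ K * ‖h‖ < 1 / 4
    · obtain ⟨U, hU⟩ := exists_isSegmentTransport hΓ hK hz hh.1 hh.2.le
      exact ⟨U, fun _ _ ↦ hU⟩
    · exact ⟨fun _ ↦ 1, fun h1 h2 ↦ absurd ⟨h1, h2⟩ hh⟩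
  choose U hU using hex
  have hev : ∀ᶠ h in 𝓝 0, IsSegmentTransport Γ z h (U h) ∧
      ∀ s ∈ Set.Icc (0 : ℝ) 1, ‖U h s - 1‖ ≤ 2 * (K * ‖h‖) := by
    filter_upwards [hball, hsmall] with h h1 h2 using hU h h1 h2
  have hd := hasFDerivAt_segmentTransport hΓ hK hz hev
  have hU01 : U 0 1 = 1 := by
    have := hev.self_of_nhds.2 1 (by simp)
    rw [norm_zero, mul_zero, mul_zero, norm_le_zero_iff, sub_eq_zero] at this
    exact this
  have hinv : HasFDerivAt (fun h ↦ Ring.inverse (U h 1)) (Γ z) 0 := by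
    have h1 := hasFDerivAt_ringInverse (𝕜 := ℂ) (R := E →L[ℂ] E) 1
    have h2 : HasFDerivAt Ring.inverse (-ContinuousLinearMap.mulLeftRight ℂ (E →L[ℂ] E)
      ↑(1 : (E →L[ℂ] E)ˣ)⁻¹ ↑(1 : (E →L[ℂ] E)ˣ)⁻¹) (U 0 1) := by rw [hU01]; exact h1
    refine (h2.comp 0 hd).congr_fderiv ?_
    ext h v
    simp
  have hprod : HasFDerivAt (fun h ↦ U h 1 * b z * Ring.inverse (U h 1))
      ((ContinuousLinearMap.compL ℂ E E E (b z)).comp (Γ z) -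
      ((ContinuousLinearMap.compL ℂ E E E).flip (b z)).comp (Γ z)) 0 := by
    refine ((hd.clm_comp (hasFDerivAt_const (b z) 0)).clm_comp hinv).congr_fderiv ?_
    ext h v
    simp [hU01]
    abel
  have hshift : HasFDerivAt (fun h ↦ b (z + h)) ((ContinuousLinearMap.compL ℂ E E E (b z)).comp (Γ z) -
      ((ContinuousLinearMap.compL ℂ E E E).flip (b z)).comp (Γ z)) 0 := by
    refine hprod.congr_of_eventuallyEq ?_
    filter_upwards [hball, hsmall] with h h1 h2
    have hu : IsUnit (U h 1) := by
      have : ‖1 - U h 1‖ < 1 := by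
        rw [norm_sub_rev]
        have := (hU h h1 h2).2 1 (by simp)
        linarith
      have := (Units.oneSub (1 - U h 1) this).isUnit
      simpa using this
    rw [← hb z h (U h) hz h1 (hU h h1 h2).1 hu, Ring.mul_inverse_cancel_right _ _ hu]
  have hsub : HasFDerivAt (fun y : E ↦ y - z) (ContinuousLinearMap.id ℂ E) z :=
    (hasFDerivAt_id z).sub_const z
  have h0' : HasFDerivAt (fun h ↦ b (z + h)) ((ContinuousLinearMap.compL ℂ E E E (b z)).comp (Γ z) -
      ((ContinuousLinearMap.compL ℂ E E E).flip (b z)).comp (Γ z)) (z - z) := by rwa [sub_self]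
  have := HasFDerivAt.comp (f := fun y ↦ y - z) (g := fun h ↦ b (z + h)) z h0' hsub
  rw [ContinuousLinearMap.comp_id] at this
  refine this.congr_of_eventuallyEq (Filter.Eventually.of_forall fun y ↦ ?_)
  change b y = b (z + (y - z))
  rw [add_sub_cancel]

/-- Solutions of `db = b Γ - Γ b` with smooth `Γ` are smooth by induction on the order of
differentiability, hence analytic. -/
theorem analyticAt_of_hasFDerivAt_comm {Γ : E → E →L[ℂ] E →L[ℂ] E} {z₀ : E} {r : ℝ} (hr : 0 < r)
    (hΓ : ContDiffOn ℂ ∞ Γ (Metric.ball z₀ r)) {b : E → E →L[ℂ] E}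
    (hb : ∀ z ∈ Metric.ball z₀ r, HasFDerivAt b ((ContinuousLinearMap.compL ℂ E E E (b z)).comp (Γ z) -
      ((ContinuousLinearMap.compL ℂ E E E).flip (b z)).comp (Γ z)) z) : AnalyticAt ℂ b z₀ := by
  refine analyticAt_of_contDiffOn_infty Metric.isOpen_ball (contDiffOn_infty.2 fun n ↦ ?_)
    (Metric.mem_ball_self hr)
  induction n with
  | zero =>
    exact contDiffOn_zero.2 fun z hz ↦ (hb z hz).continuousAt.continuousWithinAt
  | succ n ih =>
    rw [Nat.cast_succ]
    refine (contDiffOn_succ_iff_fderiv_of_isOpen Metric.isOpen_ball).2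
      ⟨fun z hz ↦ (hb z hz).differentiableAt.differentiableWithinAt,
        fun h ↦ absurd h WithTop.coe_ne_top, ?_⟩
    have hΓn : ContDiffOn ℂ n Γ (Metric.ball z₀ r) := hΓ.of_le (by exact_mod_cast le_top)
    have h1 : ContDiffOn ℂ n (fun z ↦ (ContinuousLinearMap.compL ℂ E E E (b z)).comp (Γ z) -
      ((ContinuousLinearMap.compL ℂ E E E).flip (b z)).comp (Γ z)) (Metric.ball z₀ r) :=
      ((contDiffOn_const.clm_apply ih).clm_comp hΓn).sub
        ((contDiffOn_const.clm_apply ih).clm_comp hΓn)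
    exact h1.congr fun z hz ↦ (hb z hz).fderiv

end LinearODE

section Transport

open Topology

variable {E : Type*} [NormedAddCommGroup E] [NormedSpace ℂ E]
  {M : Type*} [TopologicalSpace M] [ChartedSpace E M] [IsManifold 𝓘(ℂ, E) ω M]

/-- The isomorphism `T_y M ≃ E` given by the chart at `x₀`. -/
def coordEquiv {x₀ y : M} (hy : y ∈ (chartAt E x₀).source) : TangentSpace 𝓘(ℂ, E) y ≃ₗ[ℂ] E :=
  LinearEquiv.ofLinearMap (toCoord x₀ y).toLinearMap (ofCoord x₀ y).toLinearMap
    (LinearMap.ext fun v ↦ toCoord_ofCoord hy v) (LinearMap.ext fun v ↦ ofCoord_toCoord hy v)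

theorem contMDiffOn_real_segment {x₀ : M} {z h : E}
    (hT : ∀ s ∈ Set.Icc (0 : ℝ) 1, z + s • h ∈ (extChartAt 𝓘(ℂ, E) x₀).target) :
    ContMDiffOn 𝓘(ℝ, ℝ) 𝓘(ℝ, E) 1 (fun s : ℝ ↦ (extChartAt 𝓘(ℂ, E) x₀).symm (z + s • h))
      (Set.Icc 0 1) := by
  intro t ht
  set φ := extChartAt 𝓘(ℂ, E) x₀
  set y := φ.symm (z + t • h)
  have hseg : ContDiff ℝ 1 fun s : ℝ ↦ z + s • h := by fun_prop
  have hz : φ.target ∈ 𝓝 (z + t • h) := extChartAt_target_mem_nhds' (hT t ht)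
  have hs : ContMDiffAt 𝓘(ℂ, E) 𝓘(ℂ, E) ω φ.symm (z + t • h) :=
    (contMDiffOn_extChartAt_symm (n := ω) x₀).contMDiffAt hz
  refine contMDiffWithinAt_iff_target.2 ⟨?_, ?_⟩
  · exact ContinuousAt.comp_continuousWithinAt (g := φ.symm) hs.continuousAt
      hseg.continuous.continuousWithinAt
  · have hc : ContMDiffAt 𝓘(ℂ, E) 𝓘(ℂ, E) ω (fun z ↦ extChartAt 𝓘(ℂ, E) y (φ.symm z))
        (z + t • h) :=
      ContMDiffAt.comp (g := extChartAt 𝓘(ℂ, E) y) _ (contMDiffAt_extChartAt (n := ω)) hs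
    have hc' := ((contMDiffAt_iff_contDiffAt.1 hc).restrict_scalars ℝ).of_le
      (show (1 : ℕ∞ω) ≤ ω from le_top)
    exact contMDiffWithinAt_iff_contDiffWithinAt.2
      (ContDiffAt.comp_contDiffWithinAt (f := fun s : ℝ ↦ z + s • h)
        (g := fun z ↦ extChartAt 𝓘(ℂ, E) y (φ.symm z)) t hc' hseg.contDiffAt.contDiffWithinAt)

variable [FiniteDimensional ℂ E]

/-- Parallel transport along a segment in a chart. -/
theorem IsSegmentTransport.exists_isParallelTransport {D : AffineConnection E M} {x₀ : M} {z h : E}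
    {U : ℝ → E →L[ℂ] E} (hU : IsSegmentTransport (christoffel D x₀) z h U) (hU1 : IsUnit (U 1))
    (hT : ∀ s ∈ Set.Icc (0 : ℝ) 1, z + s • h ∈ (extChartAt 𝓘(ℂ, E) x₀).target) :
    ∃ f, IsParallelTransport D ((extChartAt 𝓘(ℂ, E) x₀).symm z)
        ((extChartAt 𝓘(ℂ, E) x₀).symm (z + h)) f ∧
      ∀ v, toCoord x₀ _ (f v) = U 1 (toCoord x₀ _ v) := by
  set φ := extChartAt 𝓘(ℂ, E) x₀
  have hsrc : ∀ s ∈ Set.Icc (0 : ℝ) 1, φ.symm (z + s • h) ∈ (chartAt E x₀).source := fun s hs ↦ by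
    have := φ.map_target (hT s hs)
    rwa [extChartAt_source] at this
  have h0 : φ.symm z ∈ (chartAt E x₀).source := by simpa using hsrc 0 (by simp)
  have h1 : φ.symm (z + h) ∈ (chartAt E x₀).source := by simpa using hsrc 1 (by simp)
  obtain ⟨u, hu⟩ := hU1
  set e : E ≃ₗ[ℂ] E := LinearEquiv.ofLinearMap ((u : E →L[ℂ] E) : E →ₗ[ℂ] E)
    (((u⁻¹ : (E →L[ℂ] E)ˣ) : E →L[ℂ] E) : E →ₗ[ℂ] E)
    (LinearMap.ext fun v ↦ congrArg (fun A : E →L[ℂ] E ↦ A v) u.mul_inv)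
    (LinearMap.ext fun v ↦ congrArg (fun A : E →L[ℂ] E ↦ A v) u.inv_mul)
  have hf : ∀ v, toCoord x₀ _ (((coordEquiv h0).trans (e.trans (coordEquiv h1).symm)) v) =
      U 1 (toCoord x₀ _ v) := by
    intro v
    rw [← hu]
    exact toCoord_ofCoord h1 _
  refine ⟨(coordEquiv h0).trans (e.trans (coordEquiv h1).symm), ?_, hf⟩
  have hγ := contMDiffOn_real_segment hT
  refine .curve _ _ _ _ hγ fun v ↦
    ⟨fun s ↦ ⟨φ.symm (z + s • h), ofCoord x₀ _ (U s (toCoord x₀ _ v))⟩, fun _ ↦ rfl, ?_, ?_, ?_⟩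
  · refine (isParallel_iff D (c := fun s ↦ ⟨φ.symm (z + s • h),
      ofCoord x₀ _ (U s (toCoord x₀ _ v))⟩) hγ.continuousOn).2 fun t ht ↦ ?_
    refine IsParallelAt.change ht (hγ.continuousOn t ht) (hsrc t ht) (mem_chart_source E _)
      ⟨h, ?_, ?_⟩
    · have : HasDerivWithinAt (fun s : ℝ ↦ z + s • h) h (Set.Icc 0 1) t :=
        (((hasDerivWithinAt_id t _).smul_const h).congr_deriv (one_smul ℝ _)).const_add z
      exact this.congr_of_mem (fun s hs ↦ φ.right_inv (hT s hs)) ht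
    · have := hasDerivWithinAt_clm_apply_real (hU.2 t ht)
        (hasDerivWithinAt_const t (Set.Icc (0 : ℝ) 1) (toCoord x₀ (φ.symm z) v))
      refine (this.congr_of_mem (fun s hs ↦ toCoord_ofCoord (hsrc s hs) _) ht).congr_deriv ?_
      simp only [map_zero, add_zero, toCoord_ofCoord (hsrc t ht), φ, φ.right_inv (hT t ht)]
      simp
  all_goals
    have key : ∀ (p q : M) (w : E), p = q →
        (⟨p, ofCoord x₀ p w⟩ : TangentBundle 𝓘(ℂ, E) M) = ⟨q, ofCoord x₀ q w⟩ := by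
      rintro p _ w rfl
      rfl
  · refine (key _ (φ.symm z) _ (by simp)).trans ?_
    simp only [hU.1, one_apply_eq_self, ofCoord_toCoord h0]
  · refine (key _ (φ.symm (z + h)) _ (by simp)).trans ?_
    rw [← hf, ofCoord_toCoord h1]

omit [FiniteDimensional ℂ E] in
/-- The field of endomorphisms `L` is holomorphic: its expression in the chart at `x` is holomorphic
at `x`, for each `x`. -/
def IsHolEnd (L : ∀ x : M, TangentSpace 𝓘(ℂ, E) x →L[ℂ] TangentSpace 𝓘(ℂ, E) x) : Prop :=
  ∀ x, ContDiffAt ℂ ω (endCoord L x) (extChartAt 𝓘(ℂ, E) x x)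

omit [FiniteDimensional ℂ E] in
theorem IsHolEnd.isHolAt {L : ∀ x : M, TangentSpace 𝓘(ℂ, E) x →L[ℂ] TangentSpace 𝓘(ℂ, E) x}
    (hL : IsHolEnd L) {X : ∀ x : M, TangentSpace 𝓘(ℂ, E) x} {x : M} (hX : IsHolAt X x) :
    IsHolAt (fun y ↦ L y (X y)) x := by
  have hx := mem_chart_source E x
  rw [isHolAt_iff hx, contMDiffAt_iff_extChartAt_symm hx] at hX ⊢
  refine ((hL x).clm_apply hX).congr_of_eventuallyEq ?_
  filter_upwards [extChartAt_target_mem_nhds (I := 𝓘(ℂ, E)) x] with z hz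
  have hs := (extChartAt 𝓘(ℂ, E) x).map_target hz
  rw [extChartAt_source] at hs
  rw [toCoord_end_apply L hs, (extChartAt 𝓘(ℂ, E) x).right_inv hz]

omit [FiniteDimensional ℂ E] in
theorem IsHolEnd.isDiffAt {L : ∀ x : M, TangentSpace 𝓘(ℂ, E) x →L[ℂ] TangentSpace 𝓘(ℂ, E) x}
    (hL : IsHolEnd L) {X : ∀ x : M, TangentSpace 𝓘(ℂ, E) x} {x : M} (hX : IsDiffAt X x) :
    IsDiffAt (fun y ↦ L y (X y)) x := by
  have hx := mem_chart_source E x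
  rw [isDiffAt_iff hx, mdifferentiableAt_iff_extChartAt_symm hx] at hX ⊢
  refine (((hL x).differentiableAt (by simp)).clm_apply hX).congr_of_eventuallyEq ?_
  filter_upwards [extChartAt_target_mem_nhds (I := 𝓘(ℂ, E)) x] with z hz
  have hs := (extChartAt 𝓘(ℂ, E) x).map_target hz
  rw [extChartAt_source] at hs
  rw [toCoord_end_apply L hs, (extChartAt 𝓘(ℂ, E) x).right_inv hz]

/-- A field of endomorphisms that commutes with all parallel transports is holomorphic and
parallel. -/
theorem isHolEnd_and_isParallelEnd_of_comm {D : AffineConnection E M}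
    (hD : IsHolomorphicConnection D)
    {L : ∀ x : M, TangentSpace 𝓘(ℂ, E) x →L[ℂ] TangentSpace 𝓘(ℂ, E) x}
    (hL : ∀ x y f, IsParallelTransport D x y f → ∀ v, f (L x v) = L y (f v)) :
    IsHolEnd L ∧ IsParallelEnd D L := by
  have main : ∀ x₀ : M, AnalyticAt ℂ (endCoord L x₀) (extChartAt 𝓘(ℂ, E) x₀ x₀) ∧
      HasFDerivAt (endCoord L x₀) ((ContinuousLinearMap.compL ℂ E E E
        (endCoord L x₀ (extChartAt 𝓘(ℂ, E) x₀ x₀))).comp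
          (christoffel D x₀ (extChartAt 𝓘(ℂ, E) x₀ x₀)) -
        ((ContinuousLinearMap.compL ℂ E E E).flip
          (endCoord L x₀ (extChartAt 𝓘(ℂ, E) x₀ x₀))).comp
          (christoffel D x₀ (extChartAt 𝓘(ℂ, E) x₀ x₀))) (extChartAt 𝓘(ℂ, E) x₀ x₀) := by
    intro x₀
    set φ := extChartAt 𝓘(ℂ, E) x₀
    have hΓ := hD.contDiffAt_christoffel x₀
    have hT : φ.target ∈ 𝓝 (φ x₀) := extChartAt_target_mem_nhds x₀
    have hbd : ∀ᶠ z in 𝓝 (φ x₀), ‖christoffel D x₀ z‖ < ‖christoffel D x₀ (φ x₀)‖ + 1 :=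
      (ContinuousAt.norm (E := E →L[ℂ] E →L[ℂ] E) hΓ.continuousAt).eventually_lt_const
        (lt_add_one _)
    obtain ⟨r, hr, hball⟩ := Metric.eventually_nhds_iff_ball.1
      ((hΓ.eventually (by simp)).and ((Filter.eventually_mem_set.2 hT).and hbd))
    have hΓω : ContDiffOn ℂ ω (christoffel D x₀) (Metric.ball (φ x₀) r) :=
      fun z hz ↦ (hball z hz).1.contDiffWithinAt
    have hder : ∀ z ∈ Metric.ball (φ x₀) r, HasFDerivAt (endCoord L x₀) _ z := fun z hz ↦
      hasFDerivAt_of_forall_segmentTransport hΓω.continuousOn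
        (fun z hz ↦ (hball z hz).2.2.le) (b := endCoord L x₀) (fun z h U hz hzh hU hu ↦ ?_) hz
    · exact ⟨analyticAt_of_hasFDerivAt_comm hr (hΓω.of_le le_top) hder,
        hder _ (Metric.mem_ball_self hr)⟩
    · obtain ⟨f, hf, hfU⟩ := hU.exists_isParallelTransport hu
        fun s hs ↦ (hball _ (add_smul_mem_ball hz hzh hs)).2.1
      have hzT := (hball z hz).2.1
      have hzhT := (hball _ hzh).2.1
      have hz0 := φ.map_target hzT
      have hz1 := φ.map_target hzhT
      rw [extChartAt_source] at hz0 hz1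
      ext v
      have key := congrArg (toCoord x₀ _) (hL _ _ f hf (ofCoord x₀ _ v))
      rw [hfU, toCoord_end_apply L hz0, toCoord_end_apply L hz1, hfU, toCoord_ofCoord hz0,
        φ.right_inv hzT, φ.right_inv hzhT] at key
      exact key.symm
  have hol : IsHolEnd L := fun x ↦ (main x).1.contDiffAt
  refine ⟨hol, fun X x hX ↦ ⟨hol.isDiffAt hX, fun v ↦ ?_⟩⟩
  have hx := mem_chart_source E x
  apply toCoord_injective hx
  rw [toCoord_connection_apply D hx (hol.isDiffAt hX), toCoord_end_apply L hx (D X x v),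
    toCoord_connection_apply D hx hX]
  have hX' := (mdifferentiableAt_iff_extChartAt_symm hx).1 ((isDiffAt_iff hx).1 hX)
  have hprod := (main x).2.clm_apply hX'.hasFDerivAt
  have hev : (fun z ↦ toCoord x ((extChartAt 𝓘(ℂ, E) x).symm z)
        (L ((extChartAt 𝓘(ℂ, E) x).symm z) (X ((extChartAt 𝓘(ℂ, E) x).symm z))))
      =ᶠ[𝓝 (extChartAt 𝓘(ℂ, E) x x)] fun z ↦ endCoord L x z
        (toCoord x ((extChartAt 𝓘(ℂ, E) x).symm z) (X ((extChartAt 𝓘(ℂ, E) x).symm z))) := by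
    filter_upwards [extChartAt_target_mem_nhds (I := 𝓘(ℂ, E)) x] with z hz
    have hs := (extChartAt 𝓘(ℂ, E) x).map_target hz
    rw [extChartAt_source] at hs
    rw [toCoord_end_apply L hs, (extChartAt 𝓘(ℂ, E) x).right_inv hz]
  rw [(hprod.congr_of_eventuallyEq hev).fderiv]
  have e1 : ∀ w, toCoord x x (D (fun p ↦ ofCoord x p w) x v) =
      christoffel D x (extChartAt 𝓘(ℂ, E) x x) (toCoord x x v) w := fun w ↦ by
    rw [christoffel_apply D hx, ofCoord_toCoord hx]
  rw [e1, e1, toCoord_end_apply L hx]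
  have e2 : (extChartAt 𝓘(ℂ, E) x).symm (extChartAt 𝓘(ℂ, E) x x) = x :=
    (extChartAt 𝓘(ℂ, E) x).left_inv (mem_extChartAt_source x)
  simp only [add_apply, sub_apply, ContinuousLinearMap.comp_apply, ContinuousLinearMap.flip_apply,
    ContinuousLinearMap.compL_apply]
  rw [e2]
  rw [map_add]
  abel

end Transport

/-! ### Matrix units and representations of weight one -/

section MatrixUnits

variable {V : Type*} [AddCommGroup V] [Module ℂ V]

/-- The `e i j` are the images of the matrix units under a unital representation of the algebra
of `2 × 2` matrices on `V`. -/
structure IsMatrixUnits (e : Fin 2 → Fin 2 → Module.End ℂ V) : Prop where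
  mul : ∀ i j k l v, e i j (e k l v) = if j = k then e i l v else 0
  one : ∀ v, e 0 0 v + e 1 1 v = v

/-- The representation of the algebra of `2 × 2` matrices with the matrix units `e`. -/
def matRep (e : Fin 2 → Fin 2 → Module.End ℂ V) (A : Matrix (Fin 2) (Fin 2) ℂ) :
    Module.End ℂ V :=
  ∑ i, ∑ j, A i j • e i j

/-- The subspace of the `u ⊗ w` in `V ≅ ℂ² ⊗ W`, where the `e i j` are the matrix units acting on
`ℂ²`: it is cut out by the equation `u 0 • e 0 1 v = u 1 • e 0 0 v`. -/
def lineSpace (e : Fin 2 → Fin 2 → Module.End ℂ V) (u : Fin 2 → ℂ) : Submodule ℂ V :=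
  LinearMap.ker (u 0 • e 0 1 - u 1 • e 0 0)

theorem mem_lineSpace {e : Fin 2 → Fin 2 → Module.End ℂ V} {u : Fin 2 → ℂ} {v : V} :
    v ∈ lineSpace e u ↔ u 0 • e 0 1 v = u 1 • e 0 0 v := by
  rw [lineSpace, LinearMap.mem_ker, LinearMap.sub_apply, sub_eq_zero]
  rfl

theorem lineSpace_smul (e : Fin 2 → Fin 2 → Module.End ℂ V) {a : ℂ} (ha : a ≠ 0)
    (u : Fin 2 → ℂ) : lineSpace e (a • u) = lineSpace e u := by
  ext v
  simp only [mem_lineSpace, Pi.smul_apply, smul_eq_mul, mul_smul]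
  exact (smul_right_injective V ha).eq_iff

theorem lineSpace_rep (e : Fin 2 → Fin 2 → Module.End ℂ V) {u : Fin 2 → ℂ} (hu : u ≠ 0) :
    lineSpace e (Projectivization.mk ℂ u hu).rep = lineSpace e u := by
  obtain ⟨a, ha⟩ := Projectivization.exists_smul_eq_mk_rep ℂ u hu
  rw [← ha]
  exact lineSpace_smul e a.ne_zero u

theorem det_ne_zero_of_mk_ne {u u' : Fin 2 → ℂ} {hu : u ≠ 0} {hu' : u' ≠ 0}
    (h : Projectivization.mk ℂ u hu ≠ Projectivization.mk ℂ u' hu') :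
    u 0 * u' 1 - u 1 * u' 0 ≠ 0 := by
  contrapose! h
  rw [Projectivization.mk_eq_mk_iff']
  by_cases h0 : u' 0 = 0
  · have h1 : u' 1 ≠ 0 := fun h1 ↦ hu' (by ext i; fin_cases i <;> simpa)
    have hu0 : u 0 = 0 := by
      rw [h0, mul_zero, sub_zero] at h
      exact (mul_eq_zero.1 h).resolve_right h1
    refine ⟨u 1 / u' 1, ?_⟩
    ext i
    fin_cases i
    · simp [h0, hu0]
    · simp [h1]
  · refine ⟨u 0 / u' 0, ?_⟩
    ext i
    fin_cases i
    · simp [h0]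
    · simp only [Fin.mk_one, Pi.smul_apply, smul_eq_mul]
      field_simp
      linear_combination h

namespace IsMatrixUnits

variable {e : Fin 2 → Fin 2 → Module.End ℂ V} (he : IsMatrixUnits e)
include he

theorem mul_same (i j l : Fin 2) (v : V) : e i j (e j l v) = e i l v := by
  rw [he.mul, if_pos rfl]

theorem mul_of_ne {j k : Fin 2} (h : j ≠ k) (i l : Fin 2) (v : V) : e i j (e k l v) = 0 := by
  rw [he.mul, if_neg h]

theorem mul01 (i l : Fin 2) (v : V) : e i 0 (e 1 l v) = 0 := he.mul_of_ne (by simp) _ _ _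

theorem mul10 (i l : Fin 2) (v : V) : e i 1 (e 0 l v) = 0 := he.mul_of_ne (by simp) _ _ _

theorem eq_zero {v : V} (h0 : e 0 0 v = 0) (h1 : e 0 1 v = 0) : v = 0 := by
  rw [← he.one v, h0, ← he.mul_same 1 0 1, h1, map_zero, add_zero]

theorem matRep_one : matRep e 1 = 1 := by
  ext v
  simpa [matRep, Fin.sum_univ_two] using he.one v

theorem matRep_mul (A B : Matrix (Fin 2) (Fin 2) ℂ) :
    matRep e (A * B) = matRep e A * matRep e B := by
  ext v
  simp only [matRep, Fin.sum_univ_two, Matrix.mul_apply, LinearMap.add_apply, LinearMap.smul_apply,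
    Module.End.mul_apply, map_add, map_smul, he.mul_same, he.mul01, he.mul10]
  module

/-- The representation of `SL(2, ℂ)` defined by matrix units. -/
def rep : Matrix.SpecialLinearGroup (Fin 2) ℂ →* (V ≃ₗ[ℂ] V) :=
  (LinearMap.GeneralLinearGroup.generalLinearEquiv ℂ V).toMonoidHom.comp
    (MonoidHom.toHomUnits
      { toFun := fun A ↦ matRep e (A : Matrix (Fin 2) (Fin 2) ℂ)
        map_one' := by rw [Matrix.SpecialLinearGroup.coe_one, he.matRep_one]
        map_mul' := fun A B ↦ by rw [Matrix.SpecialLinearGroup.coe_mul, he.matRep_mul] })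

theorem rep_apply (A : Matrix.SpecialLinearGroup (Fin 2) ℂ) (v : V) :
    he.rep A v = matRep e (A : Matrix (Fin 2) (Fin 2) ℂ) v :=
  rfl

theorem mem_range_iff {v : V} : v ∈ LinearMap.range (e 0 0) ↔ e 0 0 v = v := by
  constructor
  · rintro ⟨w, rfl⟩
    exact he.mul_same _ _ _ _
  · exact fun h ↦ ⟨v, h⟩

/-- `V` is the sum of two copies of the image of `e 0 0`. -/
def equivProd : V ≃ₗ[ℂ] LinearMap.range (e 0 0) × LinearMap.range (e 0 0) where
  toFun v := (⟨e 0 0 v, v, rfl⟩, ⟨e 0 1 v, e 0 1 v, he.mul_same _ _ _ _⟩)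
  invFun w := w.1 + e 1 0 w.2
  map_add' v w := by ext <;> simp
  map_smul' a v := by ext <;> simp
  left_inv v := by simpa [he.mul_same] using he.one v
  right_inv w := by
    obtain ⟨⟨_, v, rfl⟩, ⟨_, w, rfl⟩⟩ := w
    ext <;> simp [he.mul_same, he.mul01, he.mul10]

theorem finrank_range [FiniteDimensional ℂ V] {n : ℕ} (hn : Module.finrank ℂ V = 2 * n) :
    Module.finrank ℂ (LinearMap.range (e 0 0)) = n := by
  have := he.equivProd.finrank_eq
  rw [Module.finrank_prod, hn] at this
  omega

/-- The representation of `SL(2, ℂ)` defined by matrix units is a sum of standard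
representations. -/
theorem isSumOfWeightOne_rep [FiniteDimensional ℂ V] {n : ℕ} (hn : Module.finrank ℂ V = 2 * n) :
    IsSumOfWeightOne n he.rep := by
  set b : Module.Basis (Fin n) ℂ (LinearMap.range (e 0 0)) :=
    Module.finBasisOfFinrankEq ℂ _ (he.finrank_range hn)
  set ψ : (LinearMap.range (e 0 0) × LinearMap.range (e 0 0)) ≃ₗ[ℂ] (Fin n → Fin 2 → ℂ) :=
    { toFun := fun p i ↦ ![b.equivFun p.1 i, b.equivFun p.2 i]
      invFun := fun w ↦ (b.equivFun.symm fun i ↦ w i 0, b.equivFun.symm fun i ↦ w i 1)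
      map_add' := fun p q ↦ by ext i k; fin_cases k <;> simp
      map_smul' := fun a p ↦ by ext i k; fin_cases k <;> simp
      left_inv := fun p ↦ by ext <;> simp
      right_inv := fun w ↦ by
        ext i k
        fin_cases k
        · exact congrFun (b.equivFun.apply_symm_apply fun i ↦ w i 0) i
        · exact congrFun (b.equivFun.apply_symm_apply fun i ↦ w i 1) i }
  refine ⟨he.equivProd.trans ψ, fun A v i ↦ ?_⟩
  have h0 : (he.equivProd (he.rep A v)).1 =
      A 0 0 • (he.equivProd v).1 + A 0 1 • (he.equivProd v).2 := by
    ext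
    simp [equivProd, rep_apply, matRep, Fin.sum_univ_two, he.mul_same, he.mul01]
  have h1 : (he.equivProd (he.rep A v)).2 =
      A 1 0 • (he.equivProd v).1 + A 1 1 • (he.equivProd v).2 := by
    ext
    simp [equivProd, rep_apply, matRep, Fin.sum_univ_two, he.mul_same, he.mul10]
  change ![b.equivFun (he.equivProd (he.rep A v)).1 i, b.equivFun (he.equivProd (he.rep A v)).2 i] =
    (A : Matrix (Fin 2) (Fin 2) ℂ) *ᵥ ![b.equivFun (he.equivProd v).1 i,
      b.equivFun (he.equivProd v).2 i]
  rw [h0, h1]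
  ext k
  fin_cases k <;> simp [Matrix.mulVec, dotProduct, Fin.sum_univ_two]

theorem sum_smul_mem_lineSpace (u : Fin 2 → ℂ) (a b : ℂ) (v : V) :
    ∑ k, u k • (a • e k 0 v + b • e k 1 v) ∈ lineSpace e u := by
  rw [mem_lineSpace]
  simp only [Fin.sum_univ_two, map_add, map_smul, he.mul_same, he.mul01, he.mul10]
  module

/-- The decomposition of `v` along `u ⊗ W` and `u' ⊗ W`. -/
theorem eq_add_of_det_ne_zero {u u' : Fin 2 → ℂ} (h : u 0 * u' 1 - u 1 * u' 0 ≠ 0) (v : V) :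
    v = (u 0 * u' 1 - u 1 * u' 0)⁻¹ • ∑ k, u k • (u' 1 • e k 0 v + -u' 0 • e k 1 v) +
      (u 0 * u' 1 - u 1 * u' 0)⁻¹ • ∑ k, u' k • (-u 1 • e k 0 v + u 0 • e k 1 v) := by
  rw [← smul_add, eq_inv_smul_iff₀ h]
  conv_lhs => rw [← he.one v]
  simp only [Fin.sum_univ_two]
  module

theorem isCompl_lineSpace {u u' : Fin 2 → ℂ} (h : u 0 * u' 1 - u 1 * u' 0 ≠ 0) :
    IsCompl (lineSpace e u) (lineSpace e u') := by
  constructor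
  · rw [Submodule.disjoint_def]
    intro v hv hv'
    rw [mem_lineSpace] at hv hv'
    refine he.eq_zero ?_ ?_
    · have : (u 0 * u' 1 - u 1 * u' 0) • e 0 0 v = 0 := by
        linear_combination (norm := module) (u' 0) • hv - (u 0) • hv'
      exact (smul_eq_zero.1 this).resolve_left h
    · have : (u 0 * u' 1 - u 1 * u' 0) • e 0 1 v = 0 := by
        linear_combination (norm := module) (u' 1) • hv - (u 1) • hv'
      exact (smul_eq_zero.1 this).resolve_left h
  · rw [codisjoint_iff, eq_top_iff]
    intro v _
    rw [he.eq_add_of_det_ne_zero h v]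
    exact Submodule.add_mem_sup (Submodule.smul_mem _ _ (he.sum_smul_mem_lineSpace _ _ _ _))
      (Submodule.smul_mem _ _ (he.sum_smul_mem_lineSpace _ _ _ _))

theorem projection_lineSpace {u u' : Fin 2 → ℂ} (h : u 0 * u' 1 - u 1 * u' 0 ≠ 0)
    (hc : IsCompl (lineSpace e u) (lineSpace e u')) :
    Submodule.projection (lineSpace e u) (lineSpace e u') hc = (u 0 * u' 1 - u 1 * u' 0)⁻¹ •
      matRep e !![u 0 * u' 1, -(u 0 * u' 0); u 1 * u' 1, -(u 1 * u' 0)] := by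
  ext v
  conv_lhs => rw [he.eq_add_of_det_ne_zero h v]
  rw [map_add, Submodule.projection_apply_of_mem_left hc
      (Submodule.smul_mem _ _ (he.sum_smul_mem_lineSpace _ _ _ _)),
    Submodule.projection_apply_of_mem_right hc
      (Submodule.smul_mem _ _ (he.sum_smul_mem_lineSpace _ _ _ _))]
  simp [matRep, Fin.sum_univ_two]
  module

/-- The frames of `u ⊗ W` given by the bases of `W`, the image of `e 0 0`. -/
theorem span_eq_lineSpace [FiniteDimensional ℂ V] {n : ℕ} (hn : Module.finrank ℂ V = 2 * n)
    {w : Fin n → V} (hw : LinearIndependent ℂ fun i ↦ e 0 0 (w i)) {u : Fin 2 → ℂ} (hu : u ≠ 0) :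
    LinearIndependent ℂ (fun i ↦ ∑ k, u k • e k 0 (w i)) ∧
      lineSpace e u = Submodule.span ℂ (Set.range fun i ↦ ∑ k, u k • e k 0 (w i)) := by
  set T : V →ₗ[ℂ] V := ∑ k, u k • e k 0 with hT
  have hTv : ∀ v, T v = ∑ k, u k • e k 0 v := fun v ↦ by simp [T]
  have hT0 : ∀ v, T (e 0 0 v) = T v := fun v ↦ by simp only [hTv, he.mul_same]
  have hk : ∃ k, u k ≠ 0 := by
    by_contra! h
    exact hu (funext h)
  obtain ⟨k, hk⟩ := hk
  have hkT : ∀ v, e 0 k (T v) = u k • e 0 0 v := fun v ↦ by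
    rw [hTv]
    fin_cases k <;> simp [Fin.sum_univ_two, he.mul_same, he.mul01, he.mul10]
  have hspan : Submodule.span ℂ (Set.range fun i ↦ e 0 0 (w i)) = LinearMap.range (e 0 0) := by
    refine Submodule.eq_of_le_of_finrank_eq ?_ ?_
    · rw [Submodule.span_le]
      rintro _ ⟨i, rfl⟩
      exact ⟨w i, rfl⟩
    · rw [finrank_span_eq_card hw, he.finrank_range hn, Fintype.card_fin]
  have hrange : LinearMap.range T = lineSpace e u := by
    refine le_antisymm ?_ fun v hv ↦ ⟨(u k)⁻¹ • e 0 k v, ?_⟩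
    · rintro _ ⟨v, rfl⟩
      rw [hTv]
      simpa using he.sum_smul_mem_lineSpace u 1 0 v
    · rw [mem_lineSpace] at hv
      rw [map_smul, inv_smul_eq_iff₀ hk, hTv]
      conv_rhs => rw [← he.one v]
      have h1 := congrArg (e 1 0) hv
      simp only [map_smul, he.mul_same] at h1
      fin_cases k <;> simp only [Fin.sum_univ_two, he.mul_same, Fin.zero_eta, Fin.mk_one,
        smul_add, ← h1, ← hv]
  constructor
  · have h2 : LinearIndependent ℂ fun i ↦ u k • e 0 0 (w i) := hw.units_smul fun _ ↦ Units.mk0 _ hk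
    have h3 : (fun i ↦ u k • e 0 0 (w i)) = (e 0 k) ∘ fun i ↦ ∑ k, u k • e k 0 (w i) := by
      funext i
      rw [Function.comp_apply, ← hTv, hkT]
    rw [h3] at h2
    exact h2.of_comp _
  · have h4 : (fun i ↦ ∑ k, u k • e k 0 (w i)) = T ∘ fun i ↦ e 0 0 (w i) := by
      funext i
      rw [Function.comp_apply, hT0, hTv]
    rw [h4, Set.range_comp, ← Submodule.map_span, hspan, ← hrange]
    ext v
    constructor
    · rintro ⟨v, rfl⟩
      exact ⟨e 0 0 v, ⟨v, rfl⟩, hT0 v⟩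
    · rintro ⟨_, _, rfl⟩
      exact ⟨_, rfl⟩

theorem linearIndependent [Nontrivial V] : LinearIndependent ℂ fun p : Fin 2 × Fin 2 ↦ e p.1 p.2 := by
  rw [Fintype.linearIndependent_iff]
  intro g hg
  obtain ⟨v, hv⟩ : ∃ v, e 0 0 v ≠ 0 := by
    by_contra! h
    obtain ⟨v, hv⟩ := exists_ne (0 : V)
    refine hv (he.eq_zero (h v) ?_)
    rw [← he.mul_same 0 0 1, h]
  rintro ⟨i, j⟩
  -- Composing with `e 0 i` and `e j 0` isolates the coefficient of `e i j`.
  have h := congrArg (fun f : Module.End ℂ V ↦ e 0 i (f (e j 0 v))) hg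
  fin_cases i <;> fin_cases j <;>
    simpa [Fintype.sum_prod_type, Fin.sum_univ_two, he.mul_same, he.mul01, he.mul10, hv] using h

theorem finrank_span [Nontrivial V] :
    Module.finrank ℂ (Submodule.span ℂ (Set.range fun p : Fin 2 × Fin 2 ↦ e p.1 p.2)) = 4 := by
  rw [finrank_span_eq_card he.linearIndependent]
  rfl

end IsMatrixUnits

end MatrixUnits

/-! ### Families of subspaces parametrized by the projective line -/

section MatrixUnits

variable {V : Type*} [AddCommGroup V] [Module ℂ V]

/-- The point `[1 : z]` of the projective line. -/
def affinePoint (z : ℂ) : CP1 :=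
  Projectivization.mk ℂ ![1, z] fun h ↦ one_ne_zero (congrFun h 0)

/-- The point `[0 : 1]` of the projective line. -/
def infPoint : CP1 :=
  Projectivization.mk ℂ ![0, 1] fun h ↦ one_ne_zero (congrFun h 1)

theorem affinePoint_ne_infPoint (z : ℂ) : affinePoint z ≠ infPoint := by
  rw [affinePoint, infPoint, Ne, Projectivization.mk_eq_mk_iff']
  rintro ⟨a, ha⟩
  simpa using congrFun ha 0

theorem affinePoint_injective : Function.Injective affinePoint := by
  intro z w h
  rw [affinePoint, affinePoint, Projectivization.mk_eq_mk_iff'] at h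
  obtain ⟨a, ha⟩ := h
  have h0 := congrFun ha 0
  have h1 := congrFun ha 1
  simp only [Pi.smul_apply, Matrix.cons_val_zero, Matrix.cons_val_one, smul_eq_mul, mul_one] at h0 h1
  rw [h0, one_mul] at h1
  exact h1.symm

theorem mk_eq_affinePoint {u : Fin 2 → ℂ} (hu : u ≠ 0) (h0 : u 0 ≠ 0) :
    Projectivization.mk ℂ u hu = affinePoint (u 1 / u 0) := by
  rw [affinePoint, Projectivization.mk_eq_mk_iff']
  refine ⟨u 0, ?_⟩
  ext i
  fin_cases i
  · simp
  · simp [mul_div_cancel₀ _ h0]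

theorem mk_eq_infPoint {u : Fin 2 → ℂ} (hu : u ≠ 0) (h0 : u 0 = 0) :
    Projectivization.mk ℂ u hu = infPoint := by
  rw [infPoint, Projectivization.mk_eq_mk_iff']
  refine ⟨u 1, ?_⟩
  ext i
  fin_cases i
  · simp [h0]
  · simp

open Classical in
/-- The projection to `p` along `q`, or zero if these are not complementary. -/
def projOrZero (p q : Submodule ℂ V) : Module.End ℂ V :=
  if h : IsCompl p q then Submodule.projection p q h else 0

theorem projOrZero_of_isCompl {p q : Submodule ℂ V} (h : IsCompl p q) :
    projOrZero p q = Submodule.projection p q h :=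
  dif_pos h

/-- The matrix units defined by the members `0`, `1` and `∞` of a web. On `ℂ² ⊗ W`, with
`S [u] = u ⊗ W`, these are the usual matrix units acting on `ℂ²`. -/
def webUnits (S : CP1 → Submodule ℂ V) : Fin 2 → Fin 2 → Module.End ℂ V :=
  ![![projOrZero (S (affinePoint 0)) (S infPoint),
      projOrZero (S (affinePoint 1)) (S (affinePoint 0)) -
        projOrZero (S infPoint) (S (affinePoint 0))],
    ![projOrZero (S (affinePoint 1)) (S infPoint) - projOrZero (S (affinePoint 0)) (S infPoint),
      projOrZero (S infPoint) (S (affinePoint 0))]]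

section Projections

variable {p q r : Submodule ℂ V}

theorem projOrZero_mem (h : IsCompl p q) (v : V) : projOrZero p q v ∈ p := by
  rw [projOrZero_of_isCompl h]
  exact Submodule.projection_apply_mem h v

theorem projOrZero_left (h : IsCompl p q) {v : V} (hv : v ∈ p) : projOrZero p q v = v := by
  rw [projOrZero_of_isCompl h]
  exact Submodule.projection_apply_of_mem_left h hv

theorem projOrZero_eq_zero_iff (h : IsCompl p q) {v : V} : projOrZero p q v = 0 ↔ v ∈ q := by
  rw [projOrZero_of_isCompl h]
  exact Submodule.projection_apply_eq_zero_iff h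

theorem projOrZero_sub_mem (h : IsCompl p q) (v : V) : projOrZero p q v - v ∈ q := by
  rw [← projOrZero_eq_zero_iff h, map_sub, projOrZero_left h (projOrZero_mem h v), sub_self]

theorem projOrZero_comp (h : IsCompl p q) (h' : IsCompl r q) (v : V) :
    projOrZero p q (projOrZero r q v) = projOrZero p q v := by
  rw [← sub_eq_zero, ← map_sub, projOrZero_eq_zero_iff h]
  exact projOrZero_sub_mem h' v

theorem projOrZero_add (h : IsCompl p q) (v : V) : projOrZero p q v + projOrZero q p v = v := by
  have h1 : projOrZero q p v = v - projOrZero p q v := by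
    have h2 : v - projOrZero p q v ∈ q := by
      rw [← neg_sub]
      exact q.neg_mem (projOrZero_sub_mem h v)
    rw [← projOrZero_left h.symm h2, map_sub, (projOrZero_eq_zero_iff h.symm).2
      (projOrZero_mem h v), sub_zero]
  rw [h1, add_sub_cancel]

end Projections

theorem isMatrixUnits_webUnits {S : CP1 → Submodule ℂ V}
    (hS : ∀ t t', t ≠ t' → IsCompl (S t) (S t')) : IsMatrixUnits (webUnits S) := by
  have h0i := hS _ _ (affinePoint_ne_infPoint 0)
  have h1i := hS _ _ (affinePoint_ne_infPoint 1)
  have h10 := hS _ _ (affinePoint_injective.ne (one_ne_zero (α := ℂ)))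
  -- `A`, `B`, `C` and `F` are the projections to `S 0`, `S ∞`, `S 1` and `S 1`, along `S ∞`,
  -- `S 0`, `S ∞` and `S 0`.
  set A := projOrZero (S (affinePoint 0)) (S infPoint) with hA
  set B := projOrZero (S infPoint) (S (affinePoint 0)) with hB
  set C := projOrZero (S (affinePoint 1)) (S infPoint) with hC
  set F := projOrZero (S (affinePoint 1)) (S (affinePoint 0)) with hF
  have hAB : ∀ v, A v + B v = v := projOrZero_add h0i
  have AA : ∀ v, A (A v) = A v := projOrZero_comp h0i h0i
  have BB : ∀ v, B (B v) = B v := projOrZero_comp h0i.symm h0i.symm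
  have AC : ∀ v, A (C v) = A v := projOrZero_comp h0i h1i
  have CA : ∀ v, C (A v) = C v := projOrZero_comp h1i h0i
  have CC : ∀ v, C (C v) = C v := projOrZero_comp h1i h1i
  have BF : ∀ v, B (F v) = B v := projOrZero_comp h0i.symm h10
  have FB : ∀ v, F (B v) = F v := projOrZero_comp h10 h0i.symm
  have FF : ∀ v, F (F v) = F v := projOrZero_comp h10 h10
  have CF : ∀ v, C (F v) = F v := fun v ↦ projOrZero_left h1i (projOrZero_mem h10 v)
  have FC : ∀ v, F (C v) = C v := fun v ↦ projOrZero_left h10 (projOrZero_mem h1i v)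
  have AB : ∀ v, A (B v) = 0 := fun v ↦
    (projOrZero_eq_zero_iff h0i).2 (projOrZero_mem h0i.symm v)
  have hB' : ∀ v, B v = v - A v := fun v ↦ eq_sub_of_add_eq' (hAB v)
  have AF : ∀ v, A (F v) = F v - B v := fun v ↦ by rw [← BF v, hB' (F v)]; abel
  have BC : ∀ v, B (C v) = C v - A v := fun v ↦ by rw [hB', AC]
  have CB : ∀ v, C (B v) = 0 := fun v ↦ by rw [hB', map_sub, CA, sub_self]
  have BA : ∀ v, B (A v) = 0 := fun v ↦ by rw [hB', AA, sub_self]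
  have FA : ∀ v, F (A v) = 0 := fun v ↦ by rw [← FB, BA, map_zero]
  refine ⟨fun i j k l v ↦ ?_, hAB⟩
  have e00 : webUnits S 0 0 = A := rfl
  have e01 : webUnits S 0 1 = F - B := rfl
  have e10 : webUnits S 1 0 = C - A := rfl
  have e11 : webUnits S 1 1 = B := rfl
  fin_cases i <;> fin_cases j <;> fin_cases k <;> fin_cases l <;>
    simp [e00, e01, e10, e11, AA, BB, AC, CA, CC, BF, FB, FF, CF, FC, AB, AF, BC, CB, BA, FA]

theorem span_webUnits_le {S : CP1 → Submodule ℂ V}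
    (hS : ∀ t t', t ≠ t' → IsCompl (S t) (S t')) :
    Submodule.span ℂ (Set.range fun p : Fin 2 × Fin 2 ↦ webUnits S p.1 p.2) ≤
      Submodule.span ℂ {P : Module.End ℂ V | ∃ (t t' : CP1)
        (h : IsCompl (S t) (S t')), t ≠ t' ∧ P = Submodule.projection (S t) (S t') h} := by
  set Q := Submodule.span ℂ {P : Module.End ℂ V | ∃ (t t' : CP1)
    (h : IsCompl (S t) (S t')), t ≠ t' ∧ P = Submodule.projection (S t) (S t') h}
  have hmem : ∀ t t', t ≠ t' → projOrZero (S t) (S t') ∈ Q := fun t t' h ↦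
    Submodule.subset_span ⟨t, t', hS t t' h, h, projOrZero_of_isCompl _⟩
  have h0i := affinePoint_ne_infPoint 0
  have h1i := affinePoint_ne_infPoint 1
  have h10 := affinePoint_injective.ne (one_ne_zero (α := ℂ))
  rw [Submodule.span_le]
  rintro _ ⟨⟨i, j⟩, rfl⟩
  fin_cases i <;> fin_cases j
  · exact hmem _ _ h0i
  · exact Q.sub_mem (hmem _ _ h10) (hmem _ _ h0i.symm)
  · exact Q.sub_mem (hmem _ _ h1i) (hmem _ _ h0i)
  · exact hmem _ _ h0i.symm

/-- If the projections of a web span a space of dimension 4, then they are linear combinations of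
the matrix units, and the members of the web are of the form `u ⊗ W`, with `u` still to be
determined. -/
theorem exists_eq_lineSpace {S : CP1 → Submodule ℂ V}
    (hS : ∀ t t', t ≠ t' → IsCompl (S t) (S t')) [Nontrivial V]
    (h4 : Module.finrank ℂ (Submodule.span ℂ {P : Module.End ℂ V | ∃ (t t' : CP1)
      (h : IsCompl (S t) (S t')), t ≠ t' ∧ P = Submodule.projection (S t) (S t') h}) = 4) (z : ℂ) :
    ∃ a, S (affinePoint z) = lineSpace (webUnits S) ![1, a] := by
  have he := isMatrixUnits_webUnits hS
  set e := webUnits S with he_def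
  set Q := Submodule.span ℂ {P : Module.End ℂ V | ∃ (t t' : CP1)
    (h : IsCompl (S t) (S t')), t ≠ t' ∧ P = Submodule.projection (S t) (S t') h} with hQ
  have hmem : ∀ t t', t ≠ t' → projOrZero (S t) (S t') ∈ Q := fun t t' h ↦
    Submodule.subset_span ⟨t, t', hS t t' h, h, projOrZero_of_isCompl _⟩
  have : FiniteDimensional ℂ Q := FiniteDimensional.of_finrank_pos (by rw [h4]; norm_num)
  have hspan : Submodule.span ℂ (Set.range fun p : Fin 2 × Fin 2 ↦ e p.1 p.2) = Q :=
    Submodule.eq_of_le_of_finrank_eq (span_webUnits_le hS) (by rw [he.finrank_span, h4])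
  have hzi := hS _ _ (affinePoint_ne_infPoint z)
  have h0i' := hS _ _ (affinePoint_ne_infPoint 0)
  set P := projOrZero (S (affinePoint z)) (S infPoint)
  have hP : P ∈ Q := hmem _ _ (affinePoint_ne_infPoint z)
  rw [← hspan, Submodule.mem_span_range_iff_exists_fun] at hP
  obtain ⟨c, hc⟩ := hP
  have hPe : ∀ v, P v = ∑ p : Fin 2 × Fin 2, c p • e p.1 p.2 v := fun v ↦ by
    rw [← hc]
    simp
  simp only [Fintype.sum_prod_type, Fin.sum_univ_two] at hPe
  have hAP : ∀ v, e 0 0 (P v) = e 0 0 v := projOrZero_comp h0i' hzi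
  have hPA : ∀ v, P (e 0 0 v) = P v := projOrZero_comp hzi h0i'
  -- The projection `P` has the same kernel as `e 0 0`, so that only `e 0 0` and `e 1 0` occur.
  have hP' : ∀ v, P v = e 0 0 v + c (1, 0) • e 1 0 v := by
    intro v
    have h1 : e 0 0 (P (e 0 0 v)) = e 0 0 v := by rw [hPA, hAP]
    rw [hPe] at h1
    simp only [map_add, map_smul, he.mul_same, he.mul01, he.mul10, smul_zero, add_zero] at h1
    rw [← hPA, hPe]
    simp only [he.mul_same, he.mul10, smul_zero, add_zero, h1]
  refine ⟨c (1, 0), le_antisymm (fun v hv ↦ ?_) fun v hv ↦ ?_⟩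
  · rw [← projOrZero_left hzi hv, mem_lineSpace]
    change (1 : ℂ) • e 0 1 (P v) = c (1, 0) • e 0 0 (P v)
    rw [hP']
    simp [he.mul_same, he.mul01, he.mul10]
  · have hv' : (1 : ℂ) • e 0 1 v = c (1, 0) • e 0 0 v := mem_lineSpace.1 hv
    have : P v = v := by
      rw [hP']
      have h1 := congrArg (e 1 0) hv'
      rw [one_smul, map_smul, he.mul_same, he.mul_same] at h1
      rw [← h1, he.one]
    rw [← this]
    exact projOrZero_mem hzi v

/-- The members of a web at a point are the `lineSpace`s of its matrix units. By
`exists_eq_lineSpace`, the member at `[1 : z]` belongs to the vector `(1, a z)`; the function `a` is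
holomorphic and injective, it has a pole at infinity, and it fixes `0` and `1`, so it is the
identity. -/
theorem web_eq_lineSpace {S : CP1 → Submodule ℂ V}
    (hS : ∀ t t', t ≠ t' → IsCompl (S t) (S t')) [Nontrivial V]
    (h4 : Module.finrank ℂ (Submodule.span ℂ {P : Module.End ℂ V | ∃ (t t' : CP1)
      (h : IsCompl (S t) (S t')), t ≠ t' ∧ P = Submodule.projection (S t) (S t') h}) = 4)
    (hol : ∀ u₀ : Fin 2 → ℂ, u₀ ≠ 0 → ∃ s : (Fin 2 → ℂ) → V,
      (∀ ℓ : V →ₗ[ℂ] ℂ, DifferentiableAt ℂ (fun u ↦ ℓ (s u)) u₀) ∧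
      ∀ᶠ u in nhds u₀, ∀ hu : u ≠ 0, s u ≠ 0 ∧ s u ∈ S (Projectivization.mk ℂ u hu))
    {u : Fin 2 → ℂ} (hu : u ≠ 0) :
    S (Projectivization.mk ℂ u hu) = lineSpace (webUnits S) u := by
  have he := isMatrixUnits_webUnits hS
  choose a ha using exists_eq_lineSpace hS h4
  set e := webUnits S with he_def
  have hinf : S infPoint = lineSpace e ![0, 1] := by
    ext v
    rw [mem_lineSpace, ← projOrZero_eq_zero_iff (hS _ _ (affinePoint_ne_infPoint 0))]
    change e 0 0 v = 0 ↔ (0 : ℂ) • e 0 1 v = (1 : ℂ) • e 0 0 v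
    simp [eq_comm]
  have hmema : ∀ z v, v ∈ S (affinePoint z) ↔ e 0 1 v = a z • e 0 0 v := fun z v ↦ by
    rw [ha z, mem_lineSpace]
    simp
  have hzero : ∃ v ∈ S (affinePoint 0), v ≠ 0 := by
    have h0 : (![1, 0] : Fin 2 → ℂ) ≠ 0 := fun h ↦ one_ne_zero (congrFun h 0)
    obtain ⟨s, -, hs⟩ := hol ![1, 0] h0
    exact ⟨_, (hs.self_of_nhds h0).2, (hs.self_of_nhds h0).1⟩
  -- A nonzero element of `S 0` is `w ⊗ (1, 0)` and gives the element `w ⊗ (1, z)` of `S z`.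
  obtain ⟨w₀, hw₀, hw₀0⟩ := hzero
  have hinj : Function.Injective a := by
    intro z z' h
    by_contra hne
    have hd := (hS _ _ (affinePoint_injective.ne hne)).disjoint
    rw [ha z, ha z', h, disjoint_self, ← ha z'] at hd
    have hc := (hS _ _ (affinePoint_ne_infPoint z')).codisjoint
    rw [hd, codisjoint_iff, bot_sup_eq] at hc
    have hc' := (hS _ _ (affinePoint_ne_infPoint 0)).disjoint
    rw [hc, disjoint_top] at hc'
    rw [hc'] at hw₀
    exact hw₀0 hw₀
  have ha0 : a 0 = 0 := by
    have h1 := (hmema 0 w₀).1 hw₀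
    have h2 : e 0 0 w₀ = w₀ := projOrZero_left (hS _ _ (affinePoint_ne_infPoint 0)) hw₀
    rw [← h2, he.mul10, he.mul_same] at h1
    exact (smul_eq_zero.1 h1.symm).resolve_right (by rwa [h2])
  have ha1 : a 1 = 1 := by
    have h1i := hS _ _ (affinePoint_ne_infPoint 1)
    have h2 : e 0 0 w₀ = w₀ := projOrZero_left (hS _ _ (affinePoint_ne_infPoint 0)) hw₀
    have h3 := (hmema 1 _).1 (projOrZero_mem h1i w₀)
    have h4 : projOrZero (S (affinePoint 1)) (S infPoint) w₀ = e 0 0 w₀ + e 1 0 w₀ := by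
      change _ = e 0 0 w₀ + (projOrZero (S (affinePoint 1)) (S infPoint) w₀ - e 0 0 w₀)
      abel
    rw [h4, map_add, map_add, he.mul10, he.mul_same, he.mul_same, he.mul01, zero_add, add_zero,
      h2] at h3
    have h5 : (1 - a 1) • w₀ = 0 := by rw [sub_smul, one_smul, ← h3, sub_self]
    exact (sub_eq_zero.1 ((smul_eq_zero.1 h5).resolve_right hw₀0)).symm
  have hne : ∀ z v, v ∈ S (affinePoint z) → v ≠ 0 → e 0 0 v ≠ 0 := by
    intro z v hv hv0 h
    have h1 := (hmema z v).1 hv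
    rw [h, smul_zero] at h1
    exact hv0 (he.eq_zero h h1)
  have hdiff : Differentiable ℂ a := by
    intro z
    have hz0 : ![1, z] ≠ 0 := fun h ↦ one_ne_zero (congrFun h 0)
    obtain ⟨s, hs, hsS⟩ := hol ![1, z] hz0
    have hs0 := hsS.self_of_nhds hz0
    obtain ⟨ℓ, hℓ⟩ := Module.Projective.exists_dual_eq_one ℂ (hne z _ hs0.2 hs0.1)
    have hι : DifferentiableAt ℂ (fun z : ℂ ↦ ![1, z]) z := by
      rw [differentiableAt_pi]
      intro i
      fin_cases i <;> simp
    have h1 : DifferentiableAt ℂ (fun z ↦ ℓ (e 0 1 (s ![1, z]))) z :=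
      DifferentiableAt.comp (f := fun z : ℂ ↦ ![1, z]) z (hs (ℓ.comp (e 0 1))) hι
    have h2 : DifferentiableAt ℂ (fun z ↦ ℓ (e 0 0 (s ![1, z]))) z :=
      DifferentiableAt.comp (f := fun z : ℂ ↦ ![1, z]) z (hs (ℓ.comp (e 0 0))) hι
    refine (h1.div h2 (by rw [hℓ]; exact one_ne_zero)).congr_of_eventuallyEq ?_
    filter_upwards [hι.continuousAt.eventually hsS,
      h2.continuousAt.eventually_ne (by rw [hℓ]; exact one_ne_zero)] with w hw hw'
    have := (hmema w _).1 (hw fun h ↦ one_ne_zero (congrFun h 0)).2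
    simp only [Pi.div_apply]
    rw [eq_div_iff hw', this, map_smul, smul_eq_mul]
  have hid : ∀ z, a z = z := by
    have hz0 : ![(0 : ℂ), 1] ≠ 0 := fun h ↦ one_ne_zero (congrFun h 1)
    obtain ⟨s, hs, hsS⟩ := hol ![0, 1] hz0
    have hs0 := hsS.self_of_nhds hz0
    have h00 : e 0 0 (s ![0, 1]) = 0 := by
      have : s ![0, 1] ∈ S infPoint := hs0.2
      rw [hinf, mem_lineSpace] at this
      simpa using this.symm
    have h01 : e 0 1 (s ![0, 1]) ≠ 0 := fun h ↦ hs0.1 (he.eq_zero h00 h)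
    obtain ⟨ℓ, hℓ⟩ := Module.Projective.exists_dual_eq_one ℂ h01
    have hι : DifferentiableAt ℂ (fun z : ℂ ↦ ![z, 1]) 0 := by
      rw [differentiableAt_pi]
      intro i
      fin_cases i <;> simp
    have h1 : DifferentiableAt ℂ (fun z ↦ ℓ (e 0 1 (s ![z, 1]))) 0 :=
      DifferentiableAt.comp (f := fun z : ℂ ↦ ![z, 1]) 0 (hs (ℓ.comp (e 0 1))) hι
    have h2 : DifferentiableAt ℂ (fun z ↦ ℓ (e 0 0 (s ![z, 1]))) 0 :=
      DifferentiableAt.comp (f := fun z : ℂ ↦ ![z, 1]) 0 (hs (ℓ.comp (e 0 0))) hι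
    refine eq_id_of_injective_of_pole hdiff hinj ha0 ha1
      (h2.div h1 (by rw [hℓ]; exact one_ne_zero)) (by simp [h00]) ?_
    rw [eventually_nhdsWithin_iff]
    filter_upwards [hι.continuousAt.eventually hsS,
      h1.continuousAt.eventually_ne (by rw [hℓ]; exact one_ne_zero)] with w hw hw' hw0
    have hu : ![w, 1] ≠ 0 := fun h ↦ one_ne_zero (congrFun h 1)
    have h3 := (hw hu).2
    rw [mk_eq_affinePoint hu (by simpa using hw0)] at h3
    have h4 := congrArg ℓ ((hmema _ _).1 h3)
    simp only [Matrix.cons_val_zero, Matrix.cons_val_one, one_div, map_smul, smul_eq_mul] at h4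
    simp only [Pi.div_apply]
    rw [div_mul_eq_mul_div, div_eq_one_iff_eq hw', h4, mul_comm]
  by_cases h0 : u 0 = 0
  · rw [mk_eq_infPoint hu h0, hinf]
    have : u = u 1 • ![0, 1] := by
      ext i
      fin_cases i
      · simp [h0]
      · simp
    have h1 : u 1 ≠ 0 := fun h ↦ hu (by rw [this, h, zero_smul])
    conv_rhs => rw [this, lineSpace_smul e h1]
  · rw [mk_eq_affinePoint hu h0, ha, hid]
    have : u = u 0 • ![1, u 1 / u 0] := by
      ext i
      fin_cases i
      · simp
      · simp [mul_div_cancel₀ _ h0]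
    conv_rhs => rw [this, lineSpace_smul e h0]

end MatrixUnits

section MatrixUnits

variable {V : Type*} [AddCommGroup V] [Module ℂ V]

theorem webUnits_lineSpace {e : Fin 2 → Fin 2 → Module.End ℂ V} (he : IsMatrixUnits e) :
    webUnits (fun t : CP1 ↦ lineSpace e t.rep) = e := by
  have key : ∀ (u u' : Fin 2 → ℂ) (hu : u ≠ 0) (hu' : u' ≠ 0),
      u 0 * u' 1 - u 1 * u' 0 ≠ 0 →
      projOrZero (lineSpace e (Projectivization.mk ℂ u hu).rep)
        (lineSpace e (Projectivization.mk ℂ u' hu').rep) = (u 0 * u' 1 - u 1 * u' 0)⁻¹ •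
      matRep e !![u 0 * u' 1, -(u 0 * u' 0); u 1 * u' 1, -(u 1 * u' 0)] := by
    intro u u' hu hu' h
    rw [lineSpace_rep, lineSpace_rep, projOrZero_of_isCompl (he.isCompl_lineSpace h),
      he.projection_lineSpace h]
  ext i j v
  fin_cases i <;> fin_cases j <;>
    simp [webUnits, affinePoint, infPoint, key, matRep, Fin.sum_univ_two]

theorem isCompl_lineSpace_rep {e : Fin 2 → Fin 2 → Module.End ℂ V} (he : IsMatrixUnits e)
    {t t' : CP1} (h : t ≠ t') : IsCompl (lineSpace e t.rep) (lineSpace e t'.rep) :=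
  he.isCompl_lineSpace (det_ne_zero_of_mk_ne (hu := t.rep_nonzero) (hu' := t'.rep_nonzero)
    (by rwa [t.mk_rep, t'.mk_rep]))

theorem finrank_span_projections [Nontrivial V] {e : Fin 2 → Fin 2 → Module.End ℂ V}
    (he : IsMatrixUnits e) :
    Module.finrank ℂ (Submodule.span ℂ {P : Module.End ℂ V | ∃ (t t' : CP1)
      (h : IsCompl (lineSpace e t.rep) (lineSpace e t'.rep)), t ≠ t' ∧
        P = Submodule.projection (lineSpace e t.rep) (lineSpace e t'.rep) h}) = 4 := by
  rw [← he.finrank_span]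
  refine congrArg (fun Q : Submodule ℂ (Module.End ℂ V) ↦ Module.finrank ℂ Q)
    (le_antisymm ?_ ?_)
  · rw [Submodule.span_le]
    rintro _ ⟨t, t', h, hne, rfl⟩
    have hd : t.rep 0 * t'.rep 1 - t.rep 1 * t'.rep 0 ≠ 0 :=
      det_ne_zero_of_mk_ne (hu := t.rep_nonzero) (hu' := t'.rep_nonzero)
        (by rwa [t.mk_rep, t'.mk_rep])
    rw [he.projection_lineSpace hd]
    refine Submodule.smul_mem _ _ (Submodule.sum_mem _ fun i _ ↦ Submodule.sum_mem _ fun j _ ↦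
      Submodule.smul_mem _ _ (Submodule.subset_span ⟨(i, j), rfl⟩))
  · have := span_webUnits_le fun t t' h ↦ isCompl_lineSpace_rep he (t := t) (t' := t') h
    rwa [webUnits_lineSpace he] at this

/-! ### The centralizer of a sum of standard representations -/

/-- A sum of `n` standard representations of `SL(2, ℂ)` extends to the algebra of `2 × 2`
matrices. The operators that commute with `SL(2, ℂ)` commute with this algebra. -/
theorem IsSumOfWeightOne.exists_matrixUnits {n : ℕ}
    {ρ : Matrix.SpecialLinearGroup (Fin 2) ℂ →* (V ≃ₗ[ℂ] V)} {φ : V ≃ₗ[ℂ] (Fin n → Fin 2 → ℂ)}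
    (hφ : ∀ (A : Matrix.SpecialLinearGroup (Fin 2) ℂ) (v : V) (i : Fin n),
      φ (ρ A v) i = (A : Matrix (Fin 2) (Fin 2) ℂ) *ᵥ φ v i) :
    ∃ e : Fin 2 → Fin 2 → Module.End ℂ V, IsMatrixUnits e ∧
      (∀ i j v m k, φ (e i j v) m k = if k = i then φ v m j else 0) ∧
      ∀ f ∈ actionCentralizer ρ, ∀ i j v, f (e i j v) = e i j (f v) := by
  let e : Fin 2 → Fin 2 → Module.End ℂ V := fun i j ↦
    { toFun := fun v ↦ φ.symm fun m k ↦ if k = i then φ v m j else 0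
      map_add' := fun v w ↦ by
        rw [← map_add]
        congr 1
        ext m k
        by_cases hk : k = i <;> simp [hk]
      map_smul' := fun a v ↦ by
        rw [RingHom.id_apply, ← map_smul]
        congr 1
        ext m k
        by_cases hk : k = i <;> simp [hk] }
  have he : ∀ i j v m k, φ (e i j v) m k = if k = i then φ v m j else 0 := fun i j v m k ↦
    congrFun (congrFun (φ.apply_symm_apply _) m) k
  have hmul : ∀ i j k l v, e i j (e k l v) = if j = k then e i l v else 0 := by
    intro i j k l v
    apply φ.injective
    ext m p
    by_cases h1 : p = i <;> by_cases h2 : j = k <;> simp [he, h1, h2]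
  refine ⟨e, ⟨hmul, fun v ↦ ?_⟩, he, fun f hf ↦ ?_⟩
  · apply φ.injective
    ext m p
    rw [map_add]
    simp only [Pi.add_apply, he]
    fin_cases p <;> simp
  · have hcomm : ∀ A v, f (ρ A v) = ρ A (f v) := fun A v ↦
      (LinearEquiv.congr_fun (Subgroup.mem_centralizer_iff.1 hf (ρ A) ⟨A, rfl⟩) v).symm
    -- The unit `e 0 1` is `ρ A - 1` for a unipotent `A`, and so is `e 1 0`; the other units are their
    -- products.
    have h01 : ∀ v, f (e 0 1 v) = e 0 1 (f v) := by
      obtain ⟨A, hA⟩ : ∃ A : Matrix.SpecialLinearGroup (Fin 2) ℂ,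
          (A : Matrix (Fin 2) (Fin 2) ℂ) = !![1, 1; 0, 1] := ⟨⟨!![1, 1; 0, 1], by simp⟩, rfl⟩
      have hA : ∀ v, e 0 1 v = ρ A v - v := by
        intro v
        apply φ.injective
        ext m p
        rw [map_sub]
        simp only [Pi.sub_apply, he, hφ]
        fin_cases p <;> simp [hA, Matrix.mulVec, dotProduct, Fin.sum_univ_two]
      intro v
      rw [hA, hA, map_sub, hcomm]
    have h10 : ∀ v, f (e 1 0 v) = e 1 0 (f v) := by
      obtain ⟨A, hA⟩ : ∃ A : Matrix.SpecialLinearGroup (Fin 2) ℂ,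
          (A : Matrix (Fin 2) (Fin 2) ℂ) = !![1, 0; 1, 1] := ⟨⟨!![1, 0; 1, 1], by simp⟩, rfl⟩
      have hA : ∀ v, e 1 0 v = ρ A v - v := by
        intro v
        apply φ.injective
        ext m p
        rw [map_sub]
        simp only [Pi.sub_apply, he, hφ]
        fin_cases p <;> simp [hA, Matrix.mulVec, dotProduct, Fin.sum_univ_two]
      intro v
      rw [hA, hA, map_sub, hcomm]
    have h00 : ∀ v, e 0 0 v = e 0 1 (e 1 0 v) := fun v ↦ by simp [hmul]
    have h11 : ∀ v, e 1 1 v = e 1 0 (e 0 1 v) := fun v ↦ by simp [hmul]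
    intro i j v
    fin_cases i <;> fin_cases j
    · change f (e 0 0 v) = e 0 0 (f v)
      rw [h00, h00, h01, h10]
    · exact h01 v
    · exact h10 v
    · change f (e 1 1 v) = e 1 1 (f v)
      rw [h11, h11, h10, h01]

/-- The action of `n × n` matrices on `V ≅ ℂⁿ ⊗ ℂ²`. -/
def leftMul {n : ℕ} (φ : V ≃ₗ[ℂ] (Fin n → Fin 2 → ℂ)) :
    Matrix (Fin n) (Fin n) ℂ →* Module.End ℂ V where
  toFun G :=
    { toFun := fun v ↦ φ.symm fun i k ↦ (G *ᵥ fun j ↦ φ v j k) i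
      map_add' := fun v w ↦ by
        rw [← map_add]
        congr 1
        ext i k
        rw [map_add]
        exact congrFun (Matrix.mulVec_add G (fun j ↦ φ v j k) fun j ↦ φ w j k) i
      map_smul' := fun a v ↦ by
        rw [RingHom.id_apply, ← map_smul]
        congr 1
        ext i k
        rw [map_smul]
        exact congrFun (Matrix.mulVec_smul G a fun j ↦ φ v j k) i }
  map_one' := by
    ext v
    simp
  map_mul' G G' := by
    ext v
    simp

theorem leftMul_apply {n : ℕ} (φ : V ≃ₗ[ℂ] (Fin n → Fin 2 → ℂ)) (G : Matrix (Fin n) (Fin n) ℂ)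
    (v : V) (i : Fin n) (k : Fin 2) : φ (leftMul φ G v) i k = ∑ j, G i j * φ v j k :=
  congrFun (congrFun (φ.apply_symm_apply _) i) k

theorem leftMul_injective {n : ℕ} (φ : V ≃ₗ[ℂ] (Fin n → Fin 2 → ℂ)) :
    Function.Injective (leftMul φ) := by
  intro G G' h
  ext i j
  have h1 := leftMul_apply φ G (φ.symm (Pi.single j fun _ ↦ 1)) i 0
  rw [h, leftMul_apply] at h1
  simpa [Pi.single_apply, ite_apply] using h1.symm

/-- The centralizer of a sum of `n` standard representations of `SL(2, ℂ)` is `GL(n, ℂ)`. -/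
theorem IsSumOfWeightOne.nonempty_actionCentralizer_mulEquiv {n : ℕ}
    {ρ : Matrix.SpecialLinearGroup (Fin 2) ℂ →* (V ≃ₗ[ℂ] V)} (hρ : IsSumOfWeightOne n ρ) :
    Nonempty (actionCentralizer ρ ≃* GL (Fin n) ℂ) := by
  obtain ⟨φ, hφ⟩ := hρ
  obtain ⟨e, -, heφ, hce⟩ := IsSumOfWeightOne.exists_matrixUnits hφ
  let F : GL (Fin n) ℂ →* (V ≃ₗ[ℂ] V) :=
    (LinearMap.GeneralLinearGroup.generalLinearEquiv ℂ V).toMonoidHom.comp (Units.map (leftMul φ))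
  have hF : ∀ G v, F G v = leftMul φ (G : Matrix (Fin n) (Fin n) ℂ) v := fun _ _ ↦ rfl
  have hmem : ∀ G, F G ∈ actionCentralizer ρ := by
    intro G
    rw [actionCentralizer, Subgroup.mem_centralizer_iff]
    rintro _ ⟨A, rfl⟩
    ext v
    apply φ.injective
    ext i k
    simp only [LinearEquiv.mul_apply, hF, hφ, leftMul_apply, Matrix.mulVec, dotProduct,
      Finset.mul_sum]
    rw [Finset.sum_comm]
    exact Finset.sum_congr rfl fun _ _ ↦ Finset.sum_congr rfl fun _ _ ↦ by ring
  have hsurj : ∀ f ∈ actionCentralizer ρ, ∃ G, leftMul φ G = (f : V →ₗ[ℂ] V) := by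
    intro f hf
    obtain ⟨q, hq⟩ : ∃ q : Fin n → V, ∀ j, q j = φ.symm (Pi.single j (Pi.single 0 1)) :=
      ⟨_, fun _ ↦ rfl⟩
    have hs : ∀ (j : Fin n) (l : Fin 2), φ.symm (Pi.single j (Pi.single l 1)) =
        e l 0 (q j) := by
      intro j l
      apply φ.injective
      ext m k
      rw [hq, heφ, φ.apply_symm_apply, φ.apply_symm_apply]
      by_cases hm : m = j
      · subst hm
        by_cases hk : k = l <;> simp [hk]
      · simp [hm]
    -- As `f` commutes with `e l 0`, it is determined by the coordinates of the `f (q j)` in the first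
    -- column.
    refine ⟨Matrix.of fun i j ↦ φ (f (q j)) i 0, LinearMap.ext fun v ↦ ?_⟩
    have hv : v = ∑ j, ∑ l, φ v j l • φ.symm (Pi.single j (Pi.single l 1)) := by
      apply φ.injective
      simp only [map_sum, map_smul, φ.apply_symm_apply]
      ext m k
      fin_cases k <;> simp [Finset.sum_apply, Pi.single_apply, ite_apply]
    apply φ.injective
    ext i k
    rw [leftMul_apply]
    conv_rhs => rw [hv]
    simp only [hs, map_sum, map_smul, LinearEquiv.coe_coe, hce f hf, Finset.sum_apply,
      Pi.smul_apply, heφ, smul_eq_mul]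
    refine Finset.sum_congr rfl fun j _ ↦ ?_
    simp [mul_comm]
  refine ⟨(MulEquiv.ofBijective (F.codRestrict _ hmem) ⟨fun G G' h ↦ ?_, fun f ↦ ?_⟩).symm⟩
  · have h1 : F G = F G' := congrArg Subtype.val h
    refine Units.ext (leftMul_injective φ (LinearMap.ext fun v ↦ ?_))
    rw [← hF, ← hF, h1]
  · obtain ⟨G, hG⟩ := hsurj f f.2
    obtain ⟨G', hG'⟩ := hsurj _ (inv_mem f.2)
    have h1 : G * G' = 1 := by
      apply leftMul_injective φ
      rw [map_mul, hG, hG', map_one]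
      ext v
      exact (f : V ≃ₗ[ℂ] V).apply_symm_apply v
    have h2 : G' * G = 1 := by
      apply leftMul_injective φ
      rw [map_mul, hG, hG', map_one]
      ext v
      exact (f : V ≃ₗ[ℂ] V).symm_apply_apply v
    refine ⟨⟨G, G', h1, h2⟩, Subtype.ext (LinearEquiv.ext fun v ↦ ?_)⟩
    exact LinearMap.congr_fun hG v

end MatrixUnits

/-! ### The web of a field of parallel matrix units -/

section UnitsWeb

open Topology

variable {E : Type*} [NormedAddCommGroup E] [NormedSpace ℂ E]
  {M : Type*} [TopologicalSpace M] [ChartedSpace E M] [IsManifold 𝓘(ℂ, E) ω M]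

/-- The fields of operators `e i j` are matrix units in each tangent space. -/
def IsUnitsField (e : Fin 2 → Fin 2 → ∀ x : M, TangentSpace 𝓘(ℂ, E) x →L[ℂ] TangentSpace 𝓘(ℂ, E) x) :
    Prop :=
  ∀ x, IsMatrixUnits fun i j ↦ (e i j x).toLinearMap

/-- The family of subbundles defined by a field of matrix units: if these act on the first factor of
`TM = ℂ² ⊗ W`, then the member at `[u]` is `u ⊗ W`. -/
def unitsWeb (e : Fin 2 → Fin 2 → ∀ x : M, TangentSpace 𝓘(ℂ, E) x →L[ℂ] TangentSpace 𝓘(ℂ, E) x)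
    (t : CP1) (x : M) : Submodule ℂ (TangentSpace 𝓘(ℂ, E) x) :=
  lineSpace (fun i j ↦ (e i j x).toLinearMap) t.rep

variable {e : Fin 2 → Fin 2 → ∀ x : M, TangentSpace 𝓘(ℂ, E) x →L[ℂ] TangentSpace 𝓘(ℂ, E) x}

omit [IsManifold 𝓘(ℂ, E) ω M] in
theorem mem_unitsWeb {t : CP1} {x : M} {v : TangentSpace 𝓘(ℂ, E) x} :
    v ∈ unitsWeb e t x ↔ t.rep 0 • e 0 1 x v = t.rep 1 • e 0 0 x v :=
  mem_lineSpace

theorem isHolomorphicFamily_unitsWeb [FiniteDimensional ℂ E] (he : IsUnitsField e)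
    (hol : ∀ i j, IsHolEnd (e i j)) {n : ℕ} (hn : Module.finrank ℂ E = 2 * n) :
    IsHolomorphicFamily n (unitsWeb e) := by
  intro u₀ x₀ _
  have hfin : ∀ x : M, FiniteDimensional ℂ (TangentSpace 𝓘(ℂ, E) x) := fun x ↦
    inferInstanceAs (FiniteDimensional ℂ E)
  have hfr : ∀ x : M, Module.finrank ℂ (TangentSpace 𝓘(ℂ, E) x) = 2 * n := fun x ↦ hn
  set b := Module.finBasisOfFinrankEq ℂ (LinearMap.range (e 0 0 x₀).toLinearMap)
    ((he x₀).finrank_range (hfr x₀))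
  -- The vector fields with constant coordinates that extend a basis of the image of `e 0 0`.
  set X : Fin n → ∀ y : M, TangentSpace 𝓘(ℂ, E) y :=
    fun i y ↦ ofCoord x₀ y (toCoord x₀ x₀ (b i : TangentSpace 𝓘(ℂ, E) x₀)) with hX
  have hx₀ := mem_chart_source E x₀
  have hXh : ∀ i, ∀ y ∈ (chartAt E x₀).source, IsHolAt (X i) y := fun i y hy ↦
    isHolAt_ofCoord hy _
  have hX₀ : ∀ i, e 0 0 x₀ (X i x₀) = b i := fun i ↦ by
    rw [hX]
    simp only [ofCoord_toCoord hx₀]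
    exact (he x₀).mem_range_iff.1 (b i).2
  have hli : ∀ᶠ y in 𝓝 x₀, y ∈ (chartAt E x₀).source ∧
      LinearIndependent ℂ fun i ↦ e 0 0 y (X i y) := by
    have hc : ContinuousAt (fun y i ↦ toCoord x₀ y (e 0 0 y (X i y))) x₀ :=
      continuousAt_pi.2 fun i ↦
        ((isHolAt_iff hx₀).1 ((hol 0 0).isHolAt (hXh i x₀ hx₀))).continuousAt
    have h0 : LinearIndependent ℂ fun i ↦ toCoord x₀ x₀ (e 0 0 x₀ (X i x₀)) := by
      have h1 : LinearIndependent ℂ fun i ↦ e 0 0 x₀ (X i x₀) := by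
        have h2 := b.linearIndependent.map' (LinearMap.range (e 0 0 x₀).toLinearMap).subtype
          (Submodule.ker_subtype _)
        have h3 : (fun i ↦ e 0 0 x₀ (X i x₀)) =
            (LinearMap.range (e 0 0 x₀).toLinearMap).subtype ∘ b := funext hX₀
        rwa [h3]
      exact h1.map' (toCoord x₀ x₀).toLinearMap
        (LinearMap.ker_eq_bot.2 (toCoord_injective hx₀))
    filter_upwards [(chartAt E x₀).open_source.mem_nhds hx₀, hc.eventually h0.eventually]
      with y hy hy'
    exact ⟨hy, LinearIndependent.of_comp (toCoord x₀ y).toLinearMap hy'⟩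
  obtain ⟨N, hN, hNo, hxN⟩ := mem_nhds_iff.1 hli
  refine ⟨Set.univ ×ˢ N, fun i u y ↦ ∑ k, u k • e k 0 y (X i y), isOpen_univ.prod hNo,
    ⟨trivial, hxN⟩, fun i ↦ ?_, fun u x hu hux ↦ ?_⟩
  · rintro ⟨u, y⟩ ⟨-, hy⟩
    have hys := (hN hy).1
    refine ContMDiffAt.contMDiffWithinAt (Bundle.contMDiffAt_totalSpace.2 ⟨contMDiffAt_snd, ?_⟩)
    have hk : ∀ k, ContMDiffAt 𝓘(ℂ, E) 𝓘(ℂ, E) ω (fun z ↦ toCoord y z (e k 0 z (X i z))) y :=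
      fun k ↦ (isHolAt_iff (mem_chart_source E y)).1 ((hol k 0).isHolAt (hXh i y hys))
    have hk' : ∀ k, ContMDiffAt (𝓘(ℂ, Fin 2 → ℂ).prod 𝓘(ℂ, E)) 𝓘(ℂ, E) ω
        (fun p : (Fin 2 → ℂ) × M ↦ p.1 k • toCoord y p.2 (e k 0 p.2 (X i p.2))) (u, y) := by
      intro k
      have h1 : ContMDiffAt (𝓘(ℂ, Fin 2 → ℂ).prod 𝓘(ℂ, E)) 𝓘(ℂ, ℂ) ω
          (fun p : (Fin 2 → ℂ) × M ↦ p.1 k) (u, y) :=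
        ContMDiffAt.comp (g := fun u : Fin 2 → ℂ ↦ u k) (u, y)
          ((contDiff_apply ℂ ℂ k).contMDiff.contMDiffAt) contMDiffAt_fst
      have h2 : ContMDiffAt (𝓘(ℂ, Fin 2 → ℂ).prod 𝓘(ℂ, E)) 𝓘(ℂ, E) ω
          (fun p : (Fin 2 → ℂ) × M ↦ toCoord y p.2 (e k 0 p.2 (X i p.2))) (u, y) :=
        ContMDiffAt.comp (g := fun z ↦ toCoord y z (e k 0 z (X i z))) (u, y) (hk k)
          contMDiffAt_snd
      exact h1.smul h2
    have hsum : ContMDiffAt (𝓘(ℂ, Fin 2 → ℂ).prod 𝓘(ℂ, E)) 𝓘(ℂ, E) ω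
        (fun p : (Fin 2 → ℂ) × M ↦ ∑ k, p.1 k • toCoord y p.2 (e k 0 p.2 (X i p.2))) (u, y) :=
      contMDiffAt_finsetSum fun k _ ↦ hk' k
    refine hsum.congr_of_eventuallyEq ?_
    have hev : ∀ᶠ p : (Fin 2 → ℂ) × M in 𝓝 (u, y), p.2 ∈ (chartAt E y).source :=
      continuousAt_snd.eventually ((chartAt E y).open_source.mem_nhds (mem_chart_source E y))
    filter_upwards [hev] with p hp
    rw [trivializationAt_snd_eq_toCoord hp]
    simp only [map_sum, map_smul]
  · have := (he x).span_eq_lineSpace (hfr x) (hN hux.2).2 hu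
    refine ⟨this.1, ?_⟩
    rw [unitsWeb, lineSpace_rep]
    exact this.2

theorem connection_smul_const (D : AffineConnection E M)
    {X : ∀ x : M, TangentSpace 𝓘(ℂ, E) x} {x : M} (hX : IsDiffAt X x) (a : ℂ) :
    D (fun y ↦ a • X y) x = a • D X x :=
  D.isCovariantDerivativeOnUniv.smul_const a hX

theorem preserves_unitsWeb {D : AffineConnection E M} (hpar : ∀ i j, IsParallelEnd D (e i j))
    (t : CP1) : Preserves D (unitsWeb e t) := by
  intro U X hU hX hXF x hx v
  have hXx : IsDiffAt X x := (hX.contMDiffAt (hU.mem_nhds hx)).mdifferentiableAt (by simp)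
  have h1 := hpar 0 1 X x hXx
  have h0 := hpar 0 0 X x hXx
  have hs1 : IsDiffAt (fun y ↦ t.rep 0 • e 0 1 y (X y)) x := by
    simpa using (mdifferentiableAt_const (I := 𝓘(ℂ, E)) (I' := 𝓘(ℂ, ℂ))
      (c := t.rep 0)).smul_section h1.1
  have hs0 : IsDiffAt (fun y ↦ t.rep 1 • e 0 0 y (X y)) x := by
    simpa using (mdifferentiableAt_const (I := 𝓘(ℂ, E)) (I' := 𝓘(ℂ, ℂ))
      (c := t.rep 1)).smul_section h0.1
  have hev : ∀ᶠ y in 𝓝 x, t.rep 0 • e 0 1 y (X y) = t.rep 1 • e 0 0 y (X y) := by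
    filter_upwards [hU.mem_nhds hx] with y hy
    exact mem_unitsWeb.1 (hXF y hy)
  have := congrArg (fun A ↦ A v)
    (D.isCovariantDerivativeOnUniv.congr_of_eventuallyEq hs1 hs0 Filter.univ_mem hev)
  rw [connection_smul_const D h1.1, connection_smul_const D h0.1] at this
  rw [mem_unitsWeb, ← h1.2, ← h0.2]
  exact this

/-- A subbundle that is preserved by a torsion-free connection is involutive. -/
theorem Preserves.isInvolutive [FiniteDimensional ℂ E] [CompleteSpace E] {D : AffineConnection E M}
    (hT : D.torsion = 0) {F : ∀ x : M, Submodule ℂ (TangentSpace 𝓘(ℂ, E) x)}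
    (hF : Preserves D F) : IsInvolutive F := by
  intro U X Y hU hX hY hXF hYF x hx
  have hXx : IsDiffAt X x := (hX.contMDiffAt (hU.mem_nhds hx)).mdifferentiableAt (by simp)
  have hYx : IsDiffAt Y x := (hY.contMDiffAt (hU.mem_nhds hx)).mdifferentiableAt (by simp)
  rw [← CovariantDerivative.torsion_eq_zero_iff D |>.1 hT hXx hYx]
  exact (F x).sub_mem (hF U Y hU hY hYF x hx _) (hF U X hU hX hXF x hx _)

/-- Parallel matrix units for a torsion-free connection define an `SL(2)`-web. -/
theorem isSL2Web_unitsWeb [FiniteDimensional ℂ E] [CompleteSpace E] {D : AffineConnection E M}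
    (hT : D.torsion = 0) (he : IsUnitsField e) (hol : ∀ i j, IsHolEnd (e i j))
    (hpar : ∀ i j, IsParallelEnd D (e i j)) {n : ℕ} (hn0 : 0 < n)
    (hn : Module.finrank ℂ E = 2 * n) : IsSL2Web n (unitsWeb e) where
  holomorphic := isHolomorphicFamily_unitsWeb he hol hn
  involutive t := (preserves_unitsWeb hpar t).isInvolutive hT
  transversal _ _ h x := (isCompl_lineSpace_rep (he x) h).disjoint.eq_bot
  finrank_span x := by
    have : Nontrivial (TangentSpace 𝓘(ℂ, E) x) :=
      Module.nontrivial_of_finrank_pos (R := ℂ) (M := E) (by omega)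
    exact finrank_span_projections (he x)

end UnitsWeb

/-! ### Connections with holonomy in `GL(n, ℂ)` -/

section Holonomy

variable {E : Type*} [NormedAddCommGroup E] [NormedSpace ℂ E] [FiniteDimensional ℂ E]
  {M : Type*} [TopologicalSpace M] [ChartedSpace E M] [IsManifold 𝓘(ℂ, E) ω M]

/-- A linear operator on a tangent space, as a continuous linear operator. -/
def tangentOp {x : M} (f : Module.End ℂ (TangentSpace 𝓘(ℂ, E) x)) :
    TangentSpace 𝓘(ℂ, E) x →L[ℂ] TangentSpace 𝓘(ℂ, E) x :=
  (LinearMap.toContinuousLinearMap (f : E →ₗ[ℂ] E) : E →L[ℂ] E)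

omit [IsManifold 𝓘(ℂ, E) ω M] in
theorem tangentOp_toLinearMap {x : M} (f : Module.End ℂ (TangentSpace 𝓘(ℂ, E) x)) :
    (tangentOp f).toLinearMap = f :=
  rfl

omit [FiniteDimensional ℂ E] in
/-- The points that can be joined by parallel transports. -/
def transportSetoid (D : AffineConnection E M) : Setoid M where
  r x y := ∃ f, IsParallelTransport D x y f
  iseqv :=
    { refl := fun x ↦ ⟨_, isParallelTransport_refl D x⟩
      symm := fun ⟨_, hf⟩ ↦ ⟨_, hf.symm⟩
      trans := fun ⟨_, hf⟩ ⟨_, hg⟩ ↦ ⟨_, .trans _ _ _ _ _ hf hg⟩ }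

/-- Matrix units at a base point of each class that commute with the holonomy group spread to a
field of matrix units that commutes with all parallel transports. -/
theorem exists_isUnitsField_of_holonomy {n : ℕ} {D : AffineConnection E M}
    (hD : HasHolonomyInGL n D) :
    ∃ e : Fin 2 → Fin 2 → ∀ x : M, TangentSpace 𝓘(ℂ, E) x →L[ℂ] TangentSpace 𝓘(ℂ, E) x,
      IsUnitsField e ∧
      ∀ i j x y f, IsParallelTransport D x y f → ∀ v, f (e i j x v) = e i j y (f v) := by
  have h0 : ∀ b : M, ∃ ε : Fin 2 → Fin 2 → Module.End ℂ (TangentSpace 𝓘(ℂ, E) b),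
      IsMatrixUnits ε ∧ ∀ f ∈ holonomy D b, ∀ i j v, f (ε i j v) = ε i j (f v) := by
    intro b
    obtain ⟨ρ, ⟨φ, hφ⟩, hρ⟩ := hD b
    obtain ⟨ε, hε, -, hc⟩ := IsSumOfWeightOne.exists_matrixUnits hφ
    exact ⟨ε, hε, fun f hf ↦ hc f (hρ hf)⟩
  choose ε hε hεh using h0
  -- `β x` is a base point of the class of `x`, and `τ x` is a transport from `β x` to `x`.
  set β : M → M := fun x ↦ (Quotient.mk (transportSetoid D) x).out
  have hβ : ∀ x, ∃ f, IsParallelTransport D (β x) x f := fun x ↦ Quotient.mk_out (s := transportSetoid D) x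
  choose τ hτ using hβ
  refine ⟨fun i j x ↦ tangentOp ((τ x).toLinearMap ∘ₗ ε (β x) i j ∘ₗ (τ x).symm.toLinearMap),
    fun x ↦ ⟨fun i j k l v ↦ ?_, fun v ↦ ?_⟩, fun i j x y f hf v ↦ ?_⟩
  · simp only [tangentOp_toLinearMap, LinearMap.comp_apply, LinearEquiv.coe_coe,
      LinearEquiv.symm_apply_apply, (hε (β x)).mul]
    split_ifs <;> simp
  · simp only [tangentOp_toLinearMap, LinearMap.comp_apply, LinearEquiv.coe_coe, ← map_add,
      (hε (β x)).one, LinearEquiv.apply_symm_apply]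
  · -- Two transports from the same base point differ by an element of the holonomy group.
    have key : ∀ (b b' : M) (g : TangentSpace 𝓘(ℂ, E) b ≃ₗ[ℂ] TangentSpace 𝓘(ℂ, E) x)
        (g' : TangentSpace 𝓘(ℂ, E) b' ≃ₗ[ℂ] TangentSpace 𝓘(ℂ, E) y), b = b' →
        IsParallelTransport D b x g → IsParallelTransport D b' y g' →
        f (g (ε b i j (g.symm v))) = g' (ε b' i j (g'.symm (f v))) := by
      rintro b _ g g' rfl hg hg'
      have h1 := hεh b _ (.trans _ _ _ _ _ (.trans _ _ _ _ _ hg hf) hg'.symm) i j (g.symm v)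
      simp only [LinearEquiv.trans_apply, LinearEquiv.apply_symm_apply] at h1
      rw [← h1, LinearEquiv.apply_symm_apply]
    have hxy : β x = β y := congrArg Quotient.out (Quotient.sound (s := transportSetoid D) ⟨f, hf⟩)
    exact key _ _ _ _ hxy (hτ x) (hτ y)

/-- A torsion-free connection with holonomy in `GL(n, ℂ)` preserves an `SL(2)`-web. -/
theorem exists_isSL2Web_of_hasHolonomyInGL [CompleteSpace E] {n : ℕ} (hn0 : 0 < n)
    (hn : Module.finrank ℂ E = 2 * n) {D : AffineConnection E M} (hD : IsHolomorphicConnection D)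
    (hT : D.torsion = 0) (hH : HasHolonomyInGL n D) :
    ∃ S : CP1 → ∀ x : M, Submodule ℂ (TangentSpace 𝓘(ℂ, E) x),
      IsSL2Web n S ∧ ∀ t, Preserves D (S t) := by
  obtain ⟨e, he, hc⟩ := exists_isUnitsField_of_holonomy hH
  have h := fun i j ↦ isHolEnd_and_isParallelEnd_of_comm hD (hc i j)
  exact ⟨unitsWeb e, isSL2Web_unitsWeb hT he (fun i j ↦ (h i j).1) (fun i j ↦ (h i j).2) hn0 hn,
    preserves_unitsWeb fun i j ↦ (h i j).2⟩

/-- Parallel matrix units define an action of `SL(2, ℂ)` which commutes with the holonomy. -/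
theorem hasHolonomyInGL_of_isParallelEnd {n : ℕ} (hn : Module.finrank ℂ E = 2 * n)
    {D : AffineConnection E M} (hD : IsHolomorphicConnection D)
    {e : Fin 2 → Fin 2 → ∀ x : M, TangentSpace 𝓘(ℂ, E) x →L[ℂ] TangentSpace 𝓘(ℂ, E) x}
    (he : IsUnitsField e) (hpar : ∀ i j, IsParallelEnd D (e i j)) : HasHolonomyInGL n D := by
  intro x
  have : FiniteDimensional ℂ (TangentSpace 𝓘(ℂ, E) x) := inferInstanceAs (FiniteDimensional ℂ E)
  refine ⟨(he x).rep, (he x).isSumOfWeightOne_rep hn, fun f hf ↦ ?_⟩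
  rw [actionCentralizer, Subgroup.mem_centralizer_iff]
  rintro _ ⟨A, rfl⟩
  ext v
  have hc : ∀ i j v, f (e i j x v) = e i j x (f v) := fun i j v ↦
    IsParallelTransport.comm hD (hpar i j) hf v
  simp only [LinearEquiv.mul_apply, IsMatrixUnits.rep_apply, matRep, LinearMap.sum_apply,
    LinearMap.smul_apply, ContinuousLinearMap.coe_coe, map_sum, map_smul, hc]

end Holonomy

/-! ### The matrix units of a web -/

section WebUnits

open Topology

variable {E : Type*} [NormedAddCommGroup E] [NormedSpace ℂ E]
  {M : Type*} [TopologicalSpace M] [ChartedSpace E M] [IsManifold 𝓘(ℂ, E) ω M]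

theorem IsHolAt.exists_isHolomorphicOn {X : ∀ x : M, TangentSpace 𝓘(ℂ, E) x} {x : M}
    (hX : IsHolAt X x) {p : M → Prop} (hp : ∀ᶠ y in 𝓝 x, p y) :
    ∃ U : Set M, IsOpen U ∧ x ∈ U ∧ IsHolomorphicOn X U ∧ ∀ y ∈ U, p y := by
  obtain ⟨u, hu, hXu⟩ := (contMDiffAt_iff_contMDiffOn_nhds (by simp)).1 hX
  obtain ⟨U, hU, hUo, hxU⟩ := mem_nhds_iff.1 (Filter.inter_mem hu hp)
  exact ⟨U, hUo, hxU, hXu.mono fun y hy ↦ (hU hy).1, fun y hy ↦ (hU hy).2⟩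

theorem IsHolAt.congr {X Y : ∀ x : M, TangentSpace 𝓘(ℂ, E) x} {x : M}
    (hX : IsHolAt X x) (h : ∀ᶠ y in 𝓝 x, Y y = X y) : IsHolAt Y x := by
  refine ContMDiffAt.congr_of_eventuallyEq hX ?_
  filter_upwards [h] with y hy
  rw [hy]

theorem isHolAt_zero (x : M) : IsHolAt (fun y ↦ (0 : TangentSpace 𝓘(ℂ, E) y)) x :=
  (Bundle.contMDiff_zeroSection ℂ (TangentSpace 𝓘(ℂ, E) : M → Type _)).contMDiffAt

theorem IsHolAt.add {X Y : ∀ x : M, TangentSpace 𝓘(ℂ, E) x} {x : M}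
    (hX : IsHolAt X x) (hY : IsHolAt Y x) : IsHolAt (fun y ↦ X y + Y y) x :=
  ContMDiffAt.add_section hX hY

theorem IsHolAt.const_smul {X : ∀ x : M, TangentSpace 𝓘(ℂ, E) x} {x : M}
    (hX : IsHolAt X x) (a : ℂ) : IsHolAt (fun y ↦ a • X y) x :=
  ContMDiffAt.const_smul_section hX

theorem IsHolAt.sum {ι : Type*} {t : Finset ι} {X : ι → ∀ x : M, TangentSpace 𝓘(ℂ, E) x} {x : M}
    (hX : ∀ i ∈ t, IsHolAt (X i) x) : IsHolAt (fun y ↦ ∑ i ∈ t, X i y) x :=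
  ContMDiffAt.sum_section hX

theorem IsHolomorphicFamily.exists_frame {n : ℕ}
    {S : CP1 → ∀ x : M, Submodule ℂ (TangentSpace 𝓘(ℂ, E) x)} (h : IsHolomorphicFamily n S)
    (t : CP1) (x₀ : M) : ∃ s : Fin n → ∀ x : M, TangentSpace 𝓘(ℂ, E) x,
      (∀ i, IsHolAt (s i) x₀) ∧ ∀ᶠ x in 𝓝 x₀, LinearIndependent ℂ (fun i ↦ s i x) ∧
        S t x = Submodule.span ℂ (Set.range fun i ↦ s i x) := by
  obtain ⟨W, s, hW, hmem, hs, hS⟩ := h t.rep x₀ t.rep_nonzero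
  refine ⟨fun i ↦ s i t.rep, fun i ↦ ?_, ?_⟩
  · exact ContMDiffAt.comp (I' := 𝓘(ℂ, Fin 2 → ℂ).prod 𝓘(ℂ, E))
      (g := fun p : (Fin 2 → ℂ) × M ↦ (⟨p.2, s i p.1 p.2⟩ : TangentBundle 𝓘(ℂ, E) M)) x₀
      ((hs i).contMDiffAt (hW.mem_nhds hmem)) (contMDiffAt_const.prodMk contMDiffAt_id)
  · have : ∀ᶠ x in 𝓝 x₀, (t.rep, x) ∈ W :=
      (Continuous.prodMk_right t.rep).continuousAt.eventually (hW.mem_nhds hmem)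
    filter_upwards [this] with x hx
    have := hS t.rep x t.rep_nonzero hx
    rwa [t.mk_rep] at this

/-- Vectors of a holomorphic subbundle extend to holomorphic sections. -/
theorem IsHolomorphicFamily.exists_section {n : ℕ}
    {S : CP1 → ∀ x : M, Submodule ℂ (TangentSpace 𝓘(ℂ, E) x)} (h : IsHolomorphicFamily n S)
    (t : CP1) {x₀ : M} {v : TangentSpace 𝓘(ℂ, E) x₀} (hv : v ∈ S t x₀) :
    ∃ X : ∀ x : M, TangentSpace 𝓘(ℂ, E) x, IsHolAt X x₀ ∧ X x₀ = v ∧ ∀ᶠ x in 𝓝 x₀, X x ∈ S t x := by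
  obtain ⟨s, hs, hS⟩ := h.exists_frame t x₀
  rw [hS.self_of_nhds.2, Submodule.mem_span_range_iff_exists_fun] at hv
  obtain ⟨c, rfl⟩ := hv
  refine ⟨fun x ↦ ∑ i, c i • s i x, IsHolAt.sum fun i _ ↦ (hs i).const_smul (c i), rfl, ?_⟩
  filter_upwards [hS] with x hx
  rw [hx.2]
  exact Submodule.sum_mem _ fun i _ ↦ Submodule.smul_mem _ _ (Submodule.subset_span ⟨i, rfl⟩)

variable [FiniteDimensional ℂ E]

/-- An endomorphism field is holomorphic if it maps a holomorphic frame to holomorphic vector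
fields: in coordinates, it is `C B⁻¹`, where the columns of `B` are the frame, and those of `C` are
its image. -/
theorem contDiffAt_endCoord_of_frame [CompleteSpace E] {ι : Type*} [Fintype ι]
    {L : ∀ x : M, TangentSpace 𝓘(ℂ, E) x →L[ℂ] TangentSpace 𝓘(ℂ, E) x} {x : M}
    {v : ι → ∀ y : M, TangentSpace 𝓘(ℂ, E) y} (hv : ∀ i, IsHolAt (v i) x)
    (hLv : ∀ i, IsHolAt (fun y ↦ L y (v i y)) x) (hli : LinearIndependent ℂ fun i ↦ v i x)
    (hcard : Fintype.card ι = Module.finrank ℂ E) :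
    ContDiffAt ℂ ω (endCoord L x) (extChartAt 𝓘(ℂ, E) x x) := by
  have hx := mem_chart_source E x
  set φ := extChartAt 𝓘(ℂ, E) x with hφ
  have hφx : φ.symm (φ x) = x := φ.left_inv (mem_extChartAt_source x)
  -- The linear maps `ℂ^ι → E` defined by the frame and by its image, in coordinates.
  set mk : (ι → E) → (ι → ℂ) →L[ℂ] E := fun w ↦
    ∑ i, ContinuousLinearMap.smulRightL ℂ (ι → ℂ) E (ContinuousLinearMap.proj i) (w i) with hmk
  have hmk_apply : ∀ w a, mk w a = ∑ i, a i • w i := fun w a ↦ by simp [mk]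
  set B : E → (ι → ℂ) →L[ℂ] E := fun z ↦ mk fun i ↦ toCoord x (φ.symm z) (v i (φ.symm z)) with hB
  set C : E → (ι → ℂ) →L[ℂ] E := fun z ↦
    mk fun i ↦ toCoord x (φ.symm z) (L (φ.symm z) (v i (φ.symm z))) with hC
  have hmkd : ∀ w : ι → E → E, (∀ i, ContDiffAt ℂ ω (w i) (φ x)) →
      ContDiffAt ℂ ω (fun z ↦ mk fun i ↦ w i z) (φ x) := fun w hw ↦
    ContDiffAt.sum fun i _ ↦ contDiffAt_const.clm_apply (hw i)
  have hBd : ContDiffAt ℂ ω B (φ x) := hmkd _ fun i ↦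
    (contMDiffAt_iff_extChartAt_symm hx).1 ((isHolAt_iff hx).1 (hv i))
  have hCd : ContDiffAt ℂ ω C (φ x) := hmkd _ fun i ↦
    (contMDiffAt_iff_extChartAt_symm hx).1 ((isHolAt_iff hx).1 (hLv i))
  have hBinj : Function.Injective (B (φ x)) := by
    have h1 : LinearIndependent ℂ fun i ↦ toCoord x x (v i x) :=
      hli.map' (toCoord x x).toLinearMap (LinearMap.ker_eq_bot.2 (toCoord_injective hx))
    rw [Fintype.linearIndependent_iff] at h1
    refine (injective_iff_map_eq_zero _).2 fun a ha ↦ funext (h1 a ?_)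
    have key : ∀ z y, φ.symm z = y → B z a = ∑ i, a i • toCoord x y (v i y) := by
      rintro z _ rfl
      exact hmk_apply _ _
    rw [← key _ _ hφx]
    exact ha
  set B₀ : (ι → ℂ) ≃L[ℂ] E := (LinearEquiv.ofInjectiveOfFinrankEq (B (φ x)).toLinearMap hBinj
    (by simp [hcard])).toContinuousLinearEquiv
  have hB₀ : (B₀ : (ι → ℂ) →L[ℂ] E) = B (φ x) := by
    ext a
    rfl
  have hinv : ContDiffAt ℂ ω (fun z ↦ (C z).comp (B z).inverse) (φ x) := by
    refine hCd.clm_comp (ContDiffAt.comp (g := ContinuousLinearMap.inverse) _ ?_ hBd)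
    rw [← hB₀]
    exact contDiffAt_map_inverse B₀
  refine hinv.congr_of_eventuallyEq ?_
  have hBev : ∀ᶠ z in 𝓝 (φ x), B z ∈ Set.range ((↑) : ((ι → ℂ) ≃L[ℂ] E) → (ι → ℂ) →L[ℂ] E) := by
    refine hBd.continuousAt.eventually ?_
    rw [← hB₀]
    exact ContinuousLinearEquiv.nhds B₀
  filter_upwards [hBev, extChartAt_target_mem_nhds (I := 𝓘(ℂ, E)) x] with z ⟨T, hT⟩ hz
  have hzs := φ.map_target hz
  rw [hφ, extChartAt_source] at hzs
  have hLB : (endCoord L x z).comp (B z) = C z := by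
    ext a
    rw [ContinuousLinearMap.comp_apply, hB, hC, hmk_apply, hmk_apply, map_sum]
    refine Finset.sum_congr rfl fun i _ ↦ ?_
    rw [map_smul, toCoord_end_apply L hzs, φ.right_inv hz]
  rw [← hLB, ← hT, ContinuousLinearMap.inverse_equiv]
  ext w
  simp

omit [FiniteDimensional ℂ E] in
theorem IsHolEnd.sub {L L' : ∀ x : M, TangentSpace 𝓘(ℂ, E) x →L[ℂ] TangentSpace 𝓘(ℂ, E) x}
    (hL : IsHolEnd L) (hL' : IsHolEnd L') : IsHolEnd fun x ↦ L x - L' x := by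
  intro x
  have : endCoord (fun x ↦ L x - L' x) x = endCoord L x - endCoord L' x := by
    ext z v
    exact map_sub (toCoord x _) _ _
  rw [this]
  exact (hL x).sub (hL' x)

end WebUnits

section WebUnits

open Topology

variable {E : Type*} [NormedAddCommGroup E] [NormedSpace ℂ E] [FiniteDimensional ℂ E]
  {M : Type*} [TopologicalSpace M] [ChartedSpace E M] [IsManifold 𝓘(ℂ, E) ω M]
  {n : ℕ} {S : CP1 → ∀ x : M, Submodule ℂ (TangentSpace 𝓘(ℂ, E) x)}

theorem IsSL2Web.isCompl (hS : IsSL2Web n S) (hn : Module.finrank ℂ E = 2 * n) {t t' : CP1}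
    (h : t ≠ t') (x : M) : IsCompl (S t x) (S t' x) := by
  have : FiniteDimensional ℂ (TangentSpace 𝓘(ℂ, E) x) := inferInstanceAs (FiniteDimensional ℂ E)
  have hfr : ∀ t, Module.finrank ℂ (S t x) = n := fun t ↦ by
    obtain ⟨s, -, hs⟩ := hS.holomorphic.exists_frame t x
    rw [hs.self_of_nhds.2, finrank_span_eq_card hs.self_of_nhds.1, Fintype.card_fin]
  have hd : Disjoint (S t x) (S t' x) := disjoint_iff.2 (hS.transversal t t' h x)
  refine ⟨hd, codisjoint_iff.2 (Submodule.eq_top_of_disjoint _ _ ?_ hd)⟩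
  rw [hfr, hfr]
  exact (hn.trans (two_mul n)).le

theorem IsSL2Web.isHolEnd_projection [CompleteSpace E] (hS : IsSL2Web n S)
    (hn : Module.finrank ℂ E = 2 * n) {t t' : CP1} (h : t ≠ t') :
    IsHolEnd fun x ↦ tangentOp (projOrZero (S t x) (S t' x)) := by
  intro x
  obtain ⟨s, hs, hsS⟩ := hS.holomorphic.exists_frame t x
  obtain ⟨s', hs', hsS'⟩ := hS.holomorphic.exists_frame t' x
  refine contDiffAt_endCoord_of_frame (v := Sum.elim s s') ?_ ?_ ?_ ?_
  · rintro (i | i)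
    exacts [hs i, hs' i]
  · rintro (i | i)
    · refine (hs i).congr ?_
      filter_upwards [hsS] with y hy
      refine projOrZero_left (hS.isCompl hn h y) ?_
      rw [hy.2]
      exact Submodule.subset_span ⟨i, rfl⟩
    · refine (isHolAt_zero x).congr ?_
      filter_upwards [hsS'] with y hy
      refine (projOrZero_eq_zero_iff (hS.isCompl hn h y)).2 ?_
      rw [hy.2]
      exact Submodule.subset_span ⟨i, rfl⟩
  · have := LinearIndependent.sum_type hsS.self_of_nhds.1 hsS'.self_of_nhds.1 (by
      rw [← hsS.self_of_nhds.2, ← hsS'.self_of_nhds.2]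
      exact (hS.isCompl hn h x).disjoint)
    have e : (fun i ↦ (Sum.elim s s' : Fin n ⊕ Fin n → ∀ y : M, TangentSpace 𝓘(ℂ, E) y) i x) =
        Sum.elim (fun i ↦ s i x) fun i ↦ s' i x := by
      funext i
      cases i <;> rfl
    rw [e]
    exact this
  · rw [Fintype.card_sum, Fintype.card_fin, hn, two_mul]

/-- At a fixed point, the members of a web contain nonzero vectors that depend holomorphically on
the homogeneous coordinates. -/
theorem IsSL2Web.exists_vector (hS : IsSL2Web n S) (hn0 : 0 < n) (x : M) {u₀ : Fin 2 → ℂ}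
    (hu₀ : u₀ ≠ 0) : ∃ s : (Fin 2 → ℂ) → TangentSpace 𝓘(ℂ, E) x,
      (∀ ℓ : TangentSpace 𝓘(ℂ, E) x →ₗ[ℂ] ℂ, DifferentiableAt ℂ (fun u ↦ ℓ (s u)) u₀) ∧
      ∀ᶠ u in 𝓝 u₀, ∀ hu : u ≠ 0, s u ≠ 0 ∧ s u ∈ S (Projectivization.mk ℂ u hu) x := by
  obtain ⟨W, s, hW, hmem, hs, hsS⟩ := hS.holomorphic u₀ x hu₀
  refine ⟨fun u ↦ s ⟨0, hn0⟩ u x, fun ℓ ↦ ?_, ?_⟩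
  · have h1 : ContMDiffAt 𝓘(ℂ, Fin 2 → ℂ) (𝓘(ℂ, E).prod 𝓘(ℂ, E)) ω
        (fun u ↦ (⟨x, s ⟨0, hn0⟩ u x⟩ : TangentBundle 𝓘(ℂ, E) M)) u₀ :=
      ContMDiffAt.comp (I' := 𝓘(ℂ, Fin 2 → ℂ).prod 𝓘(ℂ, E))
        (g := fun p : (Fin 2 → ℂ) × M ↦ (⟨p.2, s ⟨0, hn0⟩ p.1 p.2⟩ : TangentBundle 𝓘(ℂ, E) M)) u₀
        ((hs ⟨0, hn0⟩).contMDiffAt (hW.mem_nhds hmem)) (contMDiffAt_id.prodMk contMDiffAt_const)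
    have h2 := (Bundle.contMDiffAt_totalSpace.1 h1).2
    simp only [trivializationAt_snd_eq_toCoord (mem_chart_source E x)] at h2
    have h3 : DifferentiableAt ℂ (fun u ↦ toCoord x x (s ⟨0, hn0⟩ u x)) u₀ :=
      (contMDiffAt_iff_contDiffAt.1 h2).differentiableAt (by simp)
    have h4 := (LinearMap.toContinuousLinearMap (ℓ.comp (ofCoord x x).toLinearMap :
      E →ₗ[ℂ] ℂ)).differentiableAt.comp u₀ h3
    refine h4.congr_of_eventuallyEq (Filter.Eventually.of_forall fun u ↦ ?_)
    change ℓ _ = ℓ (ofCoord x x (toCoord x x _))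
    rw [ofCoord_toCoord (mem_chart_source E x)]
  · have : ∀ᶠ u in 𝓝 u₀, (u, x) ∈ W :=
      (Continuous.prodMk_left x).continuousAt.eventually (hW.mem_nhds hmem)
    filter_upwards [this] with u huW hu
    have := hsS u x hu huW
    refine ⟨this.1.ne_zero _, ?_⟩
    rw [this.2]
    exact Submodule.subset_span ⟨_, rfl⟩

/-- Every `SL(2)`-web is defined by a holomorphic field of matrix units. -/
theorem IsSL2Web.exists_isUnitsField [CompleteSpace E] (hS : IsSL2Web n S) (hn0 : 0 < n)
    (hn : Module.finrank ℂ E = 2 * n) :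
    ∃ e : Fin 2 → Fin 2 → ∀ x : M, TangentSpace 𝓘(ℂ, E) x →L[ℂ] TangentSpace 𝓘(ℂ, E) x,
      IsUnitsField e ∧ (∀ i j, IsHolEnd (e i j)) ∧ S = unitsWeb e := by
  have hc : ∀ x t t', t ≠ t' → IsCompl (S t x) (S t' x) := fun x t t' h ↦ hS.isCompl hn h x
  refine ⟨fun i j x ↦ tangentOp (webUnits (fun t ↦ S t x) i j),
    fun x ↦ isMatrixUnits_webUnits (hc x), fun i j ↦ ?_, ?_⟩
  · have h0i := affinePoint_ne_infPoint 0
    have h1i := affinePoint_ne_infPoint 1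
    have h10 := affinePoint_injective.ne (one_ne_zero (α := ℂ))
    fin_cases i <;> fin_cases j
    · exact hS.isHolEnd_projection hn h0i
    · exact (hS.isHolEnd_projection hn h10).sub (hS.isHolEnd_projection hn h0i.symm)
    · exact (hS.isHolEnd_projection hn h1i).sub (hS.isHolEnd_projection hn h0i)
    · exact hS.isHolEnd_projection hn h0i.symm
  · funext t x
    have : Nontrivial (TangentSpace 𝓘(ℂ, E) x) :=
      Module.nontrivial_of_finrank_pos (R := ℂ) (M := E) (by omega)
    have := web_eq_lineSpace (S := fun t ↦ S t x) (hc x) (hS.finrank_span x)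
      (fun u hu ↦ hS.exists_vector hn0 x hu) t.rep_nonzero
    rw [t.mk_rep] at this
    exact this

end WebUnits

/-! ### The connection of a field of matrix units -/

section UnitsConnection

open Topology VectorField

variable {E : Type*} [NormedAddCommGroup E] [NormedSpace ℂ E] [FiniteDimensional ℂ E]
  {M : Type*} [TopologicalSpace M] [ChartedSpace E M] [IsManifold 𝓘(ℂ, E) ω M]
  {e : Fin 2 → Fin 2 → ∀ x : M, TangentSpace 𝓘(ℂ, E) x →L[ℂ] TangentSpace 𝓘(ℂ, E) x}

/-- The expression `∑ i j, e_{j i'} [e_{ii} X, e_{i' j} Y]` at `x`, where `i'` is the index other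
than `i`. -/
def unitsBracket
    (e : Fin 2 → Fin 2 → ∀ x : M, TangentSpace 𝓘(ℂ, E) x →L[ℂ] TangentSpace 𝓘(ℂ, E) x)
    (X Y : ∀ x : M, TangentSpace 𝓘(ℂ, E) x) (x : M) : TangentSpace 𝓘(ℂ, E) x :=
  ∑ i, ∑ j, e j i.rev x
    (mlieBracket 𝓘(ℂ, E) (fun y ↦ e i i y (X y)) (fun y ↦ e i.rev j y (Y y)) x)

omit [FiniteDimensional ℂ E] [IsManifold 𝓘(ℂ, E) ω M] in
theorem IsUnitsField.mul (he : IsUnitsField e) (i j k l : Fin 2) (x : M)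
    (v : TangentSpace 𝓘(ℂ, E) x) : e i j x (e k l x v) = if j = k then e i l x v else 0 :=
  (he x).mul i j k l v

omit [FiniteDimensional ℂ E] [IsManifold 𝓘(ℂ, E) ω M] in
theorem IsUnitsField.sum_diag (he : IsUnitsField e) (x : M) (v : TangentSpace 𝓘(ℂ, E) x) :
    ∑ i, e i i x v = v := by
  rw [Fin.sum_univ_two]
  exact (he x).one v

omit [FiniteDimensional ℂ E] [IsManifold 𝓘(ℂ, E) ω M] in
theorem rev_ne_self (i : Fin 2) : i.rev ≠ i := by
  fin_cases i <;> decide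

theorem tensorialAt_unitsBracket (he : IsUnitsField e) (hol : ∀ i j, IsHolEnd (e i j))
    (Y : ∀ x : M, TangentSpace 𝓘(ℂ, E) x) (x : M) :
    TensorialAt 𝓘(ℂ, E) E (fun X ↦ unitsBracket e X Y x) x where
  smul {f X} hf hX := by
    simp only [unitsBracket, Finset.smul_sum]
    refine Finset.sum_congr rfl fun i _ ↦ Finset.sum_congr rfl fun j _ ↦ ?_
    have h1 : (fun y ↦ e i i y ((f • X) y)) = f • fun y ↦ e i i y (X y) := by
      funext y
      exact (e i i y).map_smul _ _
    -- The derivative of `f` is multiplied by `e_{j i'} e_{ii} X = 0`.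
    rw [h1, mlieBracket_smul_left hf ((hol i i).isDiffAt hX), map_add, map_smul, map_smul,
      he.mul, if_neg (rev_ne_self i), smul_zero, zero_add]
  add {X X'} hX hX' := by
    simp only [unitsBracket, ← Finset.sum_add_distrib]
    refine Finset.sum_congr rfl fun i _ ↦ Finset.sum_congr rfl fun j _ ↦ ?_
    have h1 : (fun y ↦ e i i y ((X + X') y)) =
        (fun y ↦ e i i y (X y)) + fun y ↦ e i i y (X' y) := by
      funext y
      exact (e i i y).map_add _ _
    rw [h1, mlieBracket_add_left ((hol i i).isDiffAt hX) ((hol i i).isDiffAt hX'), map_add]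

theorem unitsBracket_add (hol : ∀ i j, IsHolEnd (e i j))
    (X : ∀ x : M, TangentSpace 𝓘(ℂ, E) x) {Y Y' : ∀ x : M, TangentSpace 𝓘(ℂ, E) x} {x : M}
    (hY : IsDiffAt Y x) (hY' : IsDiffAt Y' x) :
    unitsBracket e X (Y + Y') x = unitsBracket e X Y x + unitsBracket e X Y' x := by
  simp only [unitsBracket, ← Finset.sum_add_distrib]
  refine Finset.sum_congr rfl fun i _ ↦ Finset.sum_congr rfl fun j _ ↦ ?_
  have h1 : (fun y ↦ e i.rev j y ((Y + Y') y)) =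
      (fun y ↦ e i.rev j y (Y y)) + fun y ↦ e i.rev j y (Y' y) := by
    funext y
    exact (e i.rev j y).map_add _ _
  rw [h1, mlieBracket_add_right ((hol i.rev j).isDiffAt hY) ((hol i.rev j).isDiffAt hY'), map_add]

/-- The Leibniz rule, as the sum of the `e_{j i'} e_{i' j} = e_{jj}` and the sum of the `e_{ii}` are
the identity. -/
theorem unitsBracket_smul (he : IsUnitsField e) (hol : ∀ i j, IsHolEnd (e i j))
    (X : ∀ x : M, TangentSpace 𝓘(ℂ, E) x) {Y : ∀ x : M, TangentSpace 𝓘(ℂ, E) x} {f : M → ℂ}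
    {x : M} (hY : IsDiffAt Y x) (hf : MDifferentiableAt 𝓘(ℂ, E) 𝓘(ℂ, ℂ) f x) :
    unitsBracket e X (f • Y) x =
      f x • unitsBracket e X Y x + mvfderiv 𝓘(ℂ, E) f x (X x) • Y x := by
  have key : ∀ i j : Fin 2, e j i.rev x
      (mlieBracket 𝓘(ℂ, E) (fun y ↦ e i i y (X y)) (fun y ↦ e i.rev j y ((f • Y) y)) x) =
      f x • e j i.rev x
        (mlieBracket 𝓘(ℂ, E) (fun y ↦ e i i y (X y)) (fun y ↦ e i.rev j y (Y y)) x) +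
      mvfderiv 𝓘(ℂ, E) f x (e i i x (X x)) • e j j x (Y x) := by
    intro i j
    have h1 : (fun y ↦ e i.rev j y ((f • Y) y)) = f • fun y ↦ e i.rev j y (Y y) := by
      funext y
      exact (e i.rev j y).map_smul _ _
    rw [h1, mlieBracket_smul_right hf ((hol i.rev j).isDiffAt hY), map_add, map_smul, map_smul,
      he.mul, if_pos rfl, add_comm]
  simp only [unitsBracket, key, Finset.sum_add_distrib, ← Finset.smul_sum, he.sum_diag]
  rw [← Finset.sum_smul, ← map_sum, he.sum_diag]

open Classical in
/-- The connection defined by a holomorphic field of matrix units, with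
`∇_X Y = ∑ i j, e_{j i'} [e_{ii} X, e_{i' j} Y]` for differentiable vector fields. On vector fields
that are not differentiable, its value is set to `0`. -/
def unitsConnection (he : IsUnitsField e) (hol : ∀ i j, IsHolEnd (e i j)) :
    AffineConnection E M where
  toFun Y x := if IsDiffAt Y x then TensorialAt.mkHom _ x (tensorialAt_unitsBracket he hol Y x)
    else 0
  isCovariantDerivativeOnUniv :=
    { add := by
        intro Y Y' x hY hY' _
        rw [if_pos (mdifferentiableAt_add_section hY hY'), if_pos hY, if_pos hY']
        ext v
        exact unitsBracket_add hol _ hY hY'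
      leibniz := by
        intro Y f x hY hf _
        rw [if_pos (hf.smul_section hY), if_pos hY]
        ext v
        have := unitsBracket_smul he hol (FiberBundle.extend E v) hY hf
        rw [FiberBundle.extend_apply_self] at this
        exact this }

theorem unitsConnection_apply (he : IsUnitsField e) (hol : ∀ i j, IsHolEnd (e i j))
    {X Y : ∀ x : M, TangentSpace 𝓘(ℂ, E) x} {x : M} (hX : IsDiffAt X x) (hY : IsDiffAt Y x) :
    unitsConnection he hol Y x (X x) = unitsBracket e X Y x := by
  have h : unitsConnection he hol Y x =
      TensorialAt.mkHom _ x (tensorialAt_unitsBracket he hol Y x) := if_pos hY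
  rw [h]
  exact TensorialAt.mkHom_apply (tensorialAt_unitsBracket he hol Y x) hX

omit [FiniteDimensional ℂ E] [IsManifold 𝓘(ℂ, E) ω M] in
theorem unitsBracket_unit_right (he : IsUnitsField e)
    (X Y : ∀ x : M, TangentSpace 𝓘(ℂ, E) x) (k l : Fin 2) (x : M) :
    unitsBracket e X (fun y ↦ e k l y (Y y)) x =
      ∑ i, e k i.rev x
        (mlieBracket 𝓘(ℂ, E) (fun y ↦ e i i y (X y)) (fun y ↦ e i.rev l y (Y y)) x) := by
  refine Finset.sum_congr rfl fun i _ ↦ ?_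
  rw [Finset.sum_eq_single k]
  · simp only [he.mul, if_true]
  · intro j _ hj
    have : (fun y ↦ e i.rev j y (e k l y (Y y))) = 0 := by
      funext y
      rw [he.mul, if_neg hj]
      rfl
    rw [this, mlieBracket_zero_right, Pi.zero_apply, map_zero]
  · simp

/-- The matrix units are parallel for the connection that they define. -/
theorem isParallelEnd_unitsConnection (he : IsUnitsField e) (hol : ∀ i j, IsHolEnd (e i j))
    (k l : Fin 2) : IsParallelEnd (unitsConnection he hol) (e k l) := by
  intro Y x hY
  refine ⟨(hol k l).isDiffAt hY, fun v ↦ ?_⟩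
  have hX := isDiffAt_extend (M := M) v
  rw [← FiberBundle.extend_apply_self (F := E) v, unitsConnection_apply he hol hX hY,
    unitsConnection_apply he hol hX ((hol k l).isDiffAt hY), unitsBracket_unit_right he,
    unitsBracket, map_sum]
  refine Finset.sum_congr rfl fun i _ ↦ ?_
  rw [map_sum, Finset.sum_eq_single l]
  · rw [he.mul, if_pos rfl]
  · intro j _ hj
    rw [he.mul, if_neg hj.symm]
  · simp

theorem IsHolAt.mlieBracket {X Y : ∀ x : M, TangentSpace 𝓘(ℂ, E) x} {x : M} (hX : IsHolAt X x)
    (hY : IsHolAt Y x) : IsHolAt (mlieBracket 𝓘(ℂ, E) X Y) x := by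
  have : IsManifold 𝓘(ℂ, E) (ω + 1) M := ‹IsManifold 𝓘(ℂ, E) ω M›
  have := ContMDiffWithinAt.mlieBracketWithin_vectorField (m := ω) (n := ω) (s := Set.univ)
    hX.contMDiffWithinAt hY.contMDiffWithinAt uniqueMDiffOn_univ (Set.mem_univ x) (by simp)
  rw [mlieBracketWithin_univ] at this
  exact contMDiffWithinAt_univ.1 this

theorem isHolAt_unitsBracket (hol : ∀ i j, IsHolEnd (e i j))
    {X Y : ∀ x : M, TangentSpace 𝓘(ℂ, E) x} {x : M} (hX : IsHolAt X x) (hY : IsHolAt Y x) :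
    IsHolAt (unitsBracket e X Y) x :=
  IsHolAt.sum fun i _ ↦ IsHolAt.sum fun j _ ↦
    (hol j i.rev).isHolAt (((hol i i).isHolAt hX).mlieBracket ((hol i.rev j).isHolAt hY))

theorem isHolomorphicConnection_unitsConnection (he : IsUnitsField e)
    (hol : ∀ i j, IsHolEnd (e i j)) : IsHolomorphicConnection (unitsConnection he hol) := by
  refine fun U hU ↦ ⟨fun {Y} hY ↦ fun x hx ↦ ContMDiffAt.contMDiffWithinAt ?_⟩
  refine (contMDiffAt_hom_bundle _).2 ⟨contMDiffAt_id, ?_⟩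
  have hYU : ∀ y ∈ U, IsHolAt Y y := fun y hy ↦ (hY.contMDiffAt (hU.mem_nhds hy)).of_le le_self_add
  have hx' := mem_chart_source E x
  refine (contMDiffAt_iff_extChartAt_symm hx').2 
    (contDiffAt_clm_of_forall_apply (F := E) (G := E) fun v ↦ ?_)
  refine (contMDiffAt_iff_extChartAt_symm (G := E) hx' (f := fun y ↦
    toCoord x y (unitsConnection he hol Y y (ofCoord x y v)))).1 ?_
  have h := (isHolAt_iff hx').1 (isHolAt_unitsBracket hol (isHolAt_ofCoord hx' v) (hYU x hx))
  refine h.congr_of_eventuallyEq ?_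
  filter_upwards [hU.mem_nhds hx, (chartAt E x).open_source.mem_nhds hx'] with y hy hys
  rw [← unitsConnection_apply he hol (isHolAt_ofCoord hys v).isDiffAt (hYU y hy).isDiffAt]

end UnitsConnection

section UnitsTorsion

open Topology VectorField

variable {E : Type*} [NormedAddCommGroup E] [NormedSpace ℂ E] [FiniteDimensional ℂ E]
  {M : Type*} [TopologicalSpace M] [ChartedSpace E M] [IsManifold 𝓘(ℂ, E) ω M]
  {e : Fin 2 → Fin 2 → ∀ x : M, TangentSpace 𝓘(ℂ, E) x →L[ℂ] TangentSpace 𝓘(ℂ, E) x}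

theorem unitsConnection_unit_apply (he : IsUnitsField e) (hol : ∀ i j, IsHolEnd (e i j))
    {X Y : ∀ x : M, TangentSpace 𝓘(ℂ, E) x} {x : M} (hX : IsDiffAt X x) (hY : IsDiffAt Y x)
    (i j : Fin 2) :
    unitsConnection he hol (fun y ↦ e j j y (Y y)) x (e i i x (X x)) =
      e j i.rev x
        (mlieBracket 𝓘(ℂ, E) (fun y ↦ e i i y (X y)) (fun y ↦ e i.rev j y (Y y)) x) := by
  rw [unitsConnection_apply he hol ((hol i i).isDiffAt hX) ((hol j j).isDiffAt hY),
    unitsBracket_unit_right he, Finset.sum_eq_single i]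
  · simp only [he.mul, if_true]
  · intro k _ hk
    have : (fun y ↦ e k k y (e i i y (X y))) = 0 := by
      funext y
      rw [he.mul, if_neg hk]
      rfl
    rw [this, mlieBracket_zero_left, Pi.zero_apply, map_zero]
  · simp

/-- The equation of `lineSpace e u`, in a form where the two indices play the same role: here
`u i = a`, and the other coordinate of `u` is `b`. -/
theorem IsMatrixUnits.mem_lineSpace_iff {V : Type*} [AddCommGroup V] [Module ℂ V]
    {e : Fin 2 → Fin 2 → Module.End ℂ V} (he : IsMatrixUnits e) (i : Fin 2) (a b : ℂ) (v : V) :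
    v ∈ lineSpace e (fun k ↦ if k = i then a else b) ↔ a • e i i.rev v = b • e i i v := by
  rw [mem_lineSpace]
  fin_cases i
  · rfl
  · change b • e 0 1 v = a • e 0 0 v ↔ a • e 1 0 v = b • e 1 1 v
    constructor <;> intro h
    · have := congrArg (e 1 0) h
      simpa only [map_smul, he.mul_same] using this.symm
    · have := congrArg (e 0 1) h
      simpa only [map_smul, he.mul_same] using this.symm

omit [FiniteDimensional ℂ E] in
/-- Involutivity of the members of the web, for holomorphic germs of vector fields. -/
theorem mlieBracket_mem_of_isInvolutive (he : IsUnitsField e)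
    (hinv : ∀ t, IsInvolutive (unitsWeb e t)) {X Y : ∀ x : M, TangentSpace 𝓘(ℂ, E) x} {x : M}
    (hX : IsHolAt X x) (hY : IsHolAt Y x) (i : Fin 2) {a b : ℂ} (hab : a ≠ 0 ∨ b ≠ 0)
    (hXF : ∀ y, a • e i i.rev y (X y) = b • e i i y (X y))
    (hYF : ∀ y, a • e i i.rev y (Y y) = b • e i i y (Y y)) :
    a • e i i.rev x (mlieBracket 𝓘(ℂ, E) X Y x) = b • e i i x (mlieBracket 𝓘(ℂ, E) X Y x) := by
  have hu : (fun k ↦ if k = i then a else b : Fin 2 → ℂ) ≠ 0 := by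
    intro h
    rcases hab with ha | hb
    · exact ha (by simpa using congrFun h i)
    · exact hb (by simpa [rev_ne_self] using congrFun h i.rev)
  have key : ∀ y v, v ∈ unitsWeb e (Projectivization.mk ℂ _ hu) y ↔
      a • e i i.rev y v = b • e i i y v := fun y v ↦ by
    rw [unitsWeb, lineSpace_rep]
    exact (he y).mem_lineSpace_iff i a b v
  obtain ⟨U, hU, hxU, hXU, -⟩ := hX.exists_isHolomorphicOn (p := fun _ ↦ True)
    (Filter.Eventually.of_forall fun _ ↦ trivial)
  obtain ⟨V, hV, hxV, hYV, -⟩ := hY.exists_isHolomorphicOn (p := fun _ ↦ True)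
    (Filter.Eventually.of_forall fun _ ↦ trivial)
  exact (key x _).1 (hinv _ (U ∩ V) X Y (hU.inter hV) (hXU.mono Set.inter_subset_left)
    (hYV.mono Set.inter_subset_right) (fun y _ ↦ (key y _).2 (hXF y))
    (fun y _ ↦ (key y _).2 (hYF y)) x ⟨hxU, hxV⟩)

/-- The torsion of the connection vanishes on the image of `e i i`. This is where the involutivity
of four members of the web is used: those with the parameters `0`, `1`, `-1` and `∞`. -/
theorem mlieBracket_units_eq (he : IsUnitsField e) (hol : ∀ i j, IsHolEnd (e i j))
    (hinv : ∀ t, IsInvolutive (unitsWeb e t)) {X Y : ∀ x : M, TangentSpace 𝓘(ℂ, E) x} {x : M}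
    (hX : IsHolAt X x) (hY : IsHolAt Y x) (i : Fin 2) :
    e i i.rev x
        (mlieBracket 𝓘(ℂ, E) (fun y ↦ e i i y (X y)) (fun y ↦ e i.rev i y (Y y)) x +
          mlieBracket 𝓘(ℂ, E) (fun y ↦ e i.rev i y (X y)) (fun y ↦ e i i y (Y y)) x) =
      mlieBracket 𝓘(ℂ, E) (fun y ↦ e i i y (X y)) (fun y ↦ e i i y (Y y)) x := by
  have hri := rev_ne_self i
  have hXi := (hol i i).isHolAt hX
  have hYi := (hol i i).isHolAt hY
  have hXr := (hol i.rev i).isHolAt hX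
  have hYr := (hol i.rev i).isHolAt hY
  set X₀ : ∀ x : M, TangentSpace 𝓘(ℂ, E) x := fun y ↦ e i i y (X y) with hX₀
  set Y₀ : ∀ x : M, TangentSpace 𝓘(ℂ, E) x := fun y ↦ e i i y (Y y) with hY₀
  set X₁ : ∀ x : M, TangentSpace 𝓘(ℂ, E) x := fun y ↦ e i.rev i y (X y) with hX₁
  set Y₁ : ∀ x : M, TangentSpace 𝓘(ℂ, E) x := fun y ↦ e i.rev i y (Y y) with hY₁
  set A := mlieBracket 𝓘(ℂ, E) X₀ Y₀ x
  set B := mlieBracket 𝓘(ℂ, E) X₀ Y₁ x + mlieBracket 𝓘(ℂ, E) X₁ Y₀ x with hB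
  set C := mlieBracket 𝓘(ℂ, E) X₁ Y₁ x
  have h0 : e i i.rev x A = 0 := by
    have := mlieBracket_mem_of_isInvolutive he hinv hXi hYi i (a := 1) (b := 0)
      (Or.inl one_ne_zero) (fun y ↦ by simp [hX₀, he.mul, hri]) (fun y ↦ by simp [hY₀, he.mul, hri])
    simpa using this
  have hinf : e i i x C = 0 := by
    have := mlieBracket_mem_of_isInvolutive he hinv hXr hYr i (a := 0) (b := 1)
      (Or.inr one_ne_zero) (fun y ↦ by simp [hX₁, he.mul, hri.symm])
      (fun y ↦ by simp [hY₁, he.mul, hri.symm])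
    simpa using this.symm
  -- For a parameter `c` of the web, the bracket of `X₀ + c X₁` and `Y₀ + c Y₁` is polynomial in `c`.
  have hlam : ∀ c : ℂ, e i i.rev x (A + c • B + (c * c) • C) =
      c • e i i x (A + c • B + (c * c) • C) := by
    intro c
    have hc : ∀ {Z : ∀ x : M, TangentSpace 𝓘(ℂ, E) x}, IsHolAt Z x → IsHolAt (c • Z) x :=
      fun hZ ↦ hZ.const_smul c
    have := mlieBracket_mem_of_isInvolutive he hinv (X := X₀ + c • X₁) (Y := Y₀ + c • Y₁)
      (hXi.add (hc hXr)) (hYi.add (hc hYr)) i (a := 1) (b := c) (Or.inl one_ne_zero)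
      (fun y ↦ by simp [hX₀, hX₁, he.mul, hri, hri.symm])
      (fun y ↦ by simp [hY₀, hY₁, he.mul, hri, hri.symm])
    have e1 : mlieBracket 𝓘(ℂ, E) (X₀ + c • X₁) (Y₀ + c • Y₁) x =
        A + c • B + (c * c) • C := by
      rw [mlieBracket_add_left hXi.isDiffAt (hc hXr).isDiffAt,
        mlieBracket_add_right hYi.isDiffAt (hc hYr).isDiffAt,
        mlieBracket_add_right hYi.isDiffAt (hc hYr).isDiffAt,
        mlieBracket_const_smul_left hXr.isDiffAt, mlieBracket_const_smul_left hXr.isDiffAt,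
        mlieBracket_const_smul_right hYr.isDiffAt, mlieBracket_const_smul_right hYr.isDiffAt, hB,
        smul_add, smul_smul]
      abel
    rwa [e1, one_smul] at this
  have h1 := hlam 1
  have h2 := hlam (-1)
  simp only [map_add, map_smul, h0, hinf] at h1 h2
  have h3 : e i i.rev x B = e i i x A := by
    have h4 : (2 : ℂ) • e i i.rev x B = (2 : ℂ) • e i i x A := by
      linear_combination (norm := module) h1 - h2
    exact smul_right_injective _ two_ne_zero h4
  have h5 : e i i x A = A := by
    have h6 := congrArg (e i.rev i x) h0
    rw [he.mul, if_pos rfl, map_zero] at h6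
    have h7 := he.sum_diag x A
    rw [Fin.sum_univ_two] at h7
    revert h6 h7
    fin_cases i
    · intro h6 h7
      change e 1 1 x A = 0 at h6
      rw [h6, add_zero] at h7
      exact h7
    · intro h6 h7
      change e 0 0 x A = 0 at h6
      rw [h6, zero_add] at h7
      exact h7
  rw [h3, h5]

theorem torsion_unitsConnection [CompleteSpace E] (he : IsUnitsField e)
    (hol : ∀ i j, IsHolEnd (e i j)) (hinv : ∀ t, IsInvolutive (unitsWeb e t)) :
    (unitsConnection he hol).torsion = 0 := by
  have key : ∀ (X Y : ∀ x : M, TangentSpace 𝓘(ℂ, E) x) (x : M), IsHolAt X x → IsHolAt Y x →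
      ∀ i j, (unitsConnection he hol).torsion x (e i i x (X x)) (e j j x (Y x)) = 0 := by
    intro X Y x hX hY i j
    have h := CovariantDerivative.torsion_apply (unitsConnection he hol)
      ((hol i i).isDiffAt hX.isDiffAt) ((hol j j).isDiffAt hY.isDiffAt)
    refine h.trans ?_
    rw [unitsConnection_unit_apply he hol hX.isDiffAt hY.isDiffAt,
      unitsConnection_unit_apply he hol hY.isDiffAt hX.isDiffAt]
    rcases eq_or_ne j i with rfl | hij
    · rw [mlieBracket_swap_apply (V := fun y ↦ e j j y (Y y)), map_neg, sub_neg_eq_add, ← map_add,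
        mlieBracket_units_eq he hol hinv hX hY, sub_self]
    · have hj : j = i.rev := by revert hij; fin_cases i <;> fin_cases j <;> simp
      subst hj
      rw [Fin.rev_rev, mlieBracket_swap_apply (V := fun y ↦ e i.rev i.rev y (Y y)), map_neg,
        sub_neg_eq_add]
      have h7 := he.sum_diag x (mlieBracket 𝓘(ℂ, E) (fun y ↦ e i i y (X y))
        (fun y ↦ e i.rev i.rev y (Y y)) x)
      rw [Fin.sum_univ_two] at h7
      rw [sub_eq_zero]
      refine Eq.trans ?_ h7
      fin_cases i
      · exact add_comm _ _
      · rfl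
  funext x
  ext v w
  have hx := mem_chart_source E x
  have h := fun i j ↦ key _ _ x (isHolAt_ofCoord hx (toCoord x x v))
    (isHolAt_ofCoord hx (toCoord x x w)) i j
  simp only [ofCoord_toCoord hx] at h
  rw [← he.sum_diag x v, ← he.sum_diag x w]
  simp only [map_sum, sum_apply, h, Finset.sum_const_zero]
  simp

end UnitsTorsion

/-! ### Uniqueness of the Chern connection -/

section Uniqueness

open Topology

/-- A bilinear map that preserves three pairwise complementary subspaces in its first argument, and
that is symmetric between two of them, vanishes. -/
theorem eq_zero_of_preserves_three {V : Type*} [AddCommGroup V] [Module ℂ V]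
    [TopologicalSpace V] [IsTopologicalAddGroup V] [ContinuousConstSMul ℂ V]
    {F₁ F₂ F₃ : Submodule ℂ V}
    (h₁₂ : IsCompl F₁ F₂) (h₁₃ : IsCompl F₁ F₃) (h₂₃ : IsCompl F₂ F₃)
    {A : V →L[ℂ] V →L[ℂ] V} (hA₁ : ∀ w ∈ F₁, ∀ v, A w v ∈ F₁) (hA₂ : ∀ w ∈ F₂, ∀ v, A w v ∈ F₂)
    (hA₃ : ∀ w ∈ F₃, ∀ v, A w v ∈ F₃) (hs : ∀ v ∈ F₁, ∀ w ∈ F₂, A w v = A v w) : A = 0 := by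
  have h21 : ∀ v ∈ F₁, ∀ w ∈ F₂, A w v = 0 := fun v hv w hw ↦
    Submodule.disjoint_def.1 h₁₂.disjoint _ (hs v hv w hw ▸ hA₁ v hv w) (hA₂ w hw v)
  have h12 : ∀ v ∈ F₂, ∀ w ∈ F₁, A w v = 0 := fun v hv w hw ↦ by
    rw [← hs w hw v hv, h21 w hw v hv]
  -- Modulo the kernel of `A · v`, an element of one subspace lies in the third one.
  have key : ∀ {F G : Submodule ℂ V} (_ : IsCompl G F₃) (_ : IsCompl F F₃) (v : V)
      (_ : ∀ w ∈ G, A w v = 0) (_ : ∀ w ∈ F, ∀ v, A w v ∈ F), ∀ w ∈ F, A w v = 0 := by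
    intro F G hG hF v h0 hAF w hw
    obtain ⟨g, hg, f, hf, rfl⟩ := Submodule.mem_sup.1
      (hG.codisjoint.eq_top ▸ Submodule.mem_top : w ∈ G ⊔ F₃)
    refine Submodule.disjoint_def.1 hF.disjoint _ (hAF _ hw v) ?_
    rw [map_add, add_apply, h0 g hg, zero_add]
    exact hA₃ f hf v
  have h11 : ∀ v ∈ F₁, ∀ w ∈ F₁, A w v = 0 := fun v hv ↦ key h₂₃ h₁₃ v (h21 v hv) hA₁
  have h22 : ∀ v ∈ F₂, ∀ w ∈ F₂, A w v = 0 := fun v hv ↦ key h₁₃ h₂₃ v (h12 v hv) hA₂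
  ext w v
  obtain ⟨w₁, hw₁, w₂, hw₂, rfl⟩ := Submodule.mem_sup.1
    (h₁₂.codisjoint.eq_top ▸ Submodule.mem_top : w ∈ F₁ ⊔ F₂)
  obtain ⟨v₁, hv₁, v₂, hv₂, rfl⟩ := Submodule.mem_sup.1
    (h₁₂.codisjoint.eq_top ▸ Submodule.mem_top : v ∈ F₁ ⊔ F₂)
  simp [h11 v₁ hv₁ w₁ hw₁, h12 v₂ hv₂ w₁ hw₁, h21 v₁ hv₁ w₂ hw₂, h22 v₂ hv₂ w₂ hw₂]

variable {E : Type*} [NormedAddCommGroup E] [NormedSpace ℂ E] [FiniteDimensional ℂ E]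
  {M : Type*} [TopologicalSpace M] [ChartedSpace E M] [IsManifold 𝓘(ℂ, E) ω M]
  {n : ℕ} {S : CP1 → ∀ x : M, Submodule ℂ (TangentSpace 𝓘(ℂ, E) x)}

theorem IsHolomorphicFamily.difference_mem (hS : IsHolomorphicFamily n S) {t : CP1}
    {D D' : AffineConnection E M} (hD : Preserves D (S t)) (hD' : Preserves D' (S t)) (x : M)
    {w : TangentSpace 𝓘(ℂ, E) x} (hw : w ∈ S t x) (v : TangentSpace 𝓘(ℂ, E) x) :
    CovariantDerivative.difference D' D x w v ∈ S t x := by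
  obtain ⟨X, hX, rfl, hXS⟩ := hS.exists_section t hw
  obtain ⟨U, hU, hxU, hXU, hXUS⟩ := hX.exists_isHolomorphicOn hXS
  have h : CovariantDerivative.difference D' D x (X x) = D' X x - D X x :=
    IsCovariantDerivativeOn.difference_apply _ _ (Set.mem_univ x) hX.isDiffAt
  rw [h]
  exact (S t x).sub_mem (hD' U X hU hXU hXUS x hxU v) (hD U X hU hXU hXUS x hxU v)

theorem torsion_sub_torsion [CompleteSpace E] (D D' : AffineConnection E M) (x : M)
    (v w : TangentSpace 𝓘(ℂ, E) x) :
    D'.torsion x v w - D.torsion x v w = CovariantDerivative.difference D' D x w v -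
      CovariantDerivative.difference D' D x v w := by
  have hd : ∀ u : TangentSpace 𝓘(ℂ, E) x, CovariantDerivative.difference D' D x u =
      D' (FiberBundle.extend E u) x - D (FiberBundle.extend E u) x := fun u ↦ by
    have h : CovariantDerivative.difference D' D x (FiberBundle.extend E u x) = _ :=
      IsCovariantDerivativeOn.difference_apply _ _ (Set.mem_univ x) (isDiffAt_extend u)
    rwa [FiberBundle.extend_apply_self] at h
  rw [CovariantDerivative.torsion_apply_eq_extend, CovariantDerivative.torsion_apply_eq_extend,
    hd, hd, sub_apply, sub_apply, FiberBundle.extend_apply_self, FiberBundle.extend_apply_self]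
  abel

/-- Three members of a web have at most one Chern connection. -/
theorem IsSL2Web.sameConnection [CompleteSpace E] (hS : IsSL2Web n S)
    (hn : Module.finrank ℂ E = 2 * n) {t₁ t₂ t₃ : CP1} (h₁₂ : t₁ ≠ t₂) (h₁₃ : t₁ ≠ t₃)
    (h₂₃ : t₂ ≠ t₃) {D D' : AffineConnection E M}
    (hD : IsChernConnection (S t₁) (S t₂) (S t₃) D)
    (hD' : IsChernConnection (S t₁) (S t₂) (S t₃) D') : SameConnection D' D := by
  intro X x hX
  have hA : CovariantDerivative.difference D' D x = 0 :=
    eq_zero_of_preserves_three (hS.isCompl hn h₁₂ x) (hS.isCompl hn h₁₃ x) (hS.isCompl hn h₂₃ x)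
      (fun w hw v ↦ hS.holomorphic.difference_mem hD.preserves₁ hD'.preserves₁ x hw v)
      (fun w hw v ↦ hS.holomorphic.difference_mem hD.preserves₂ hD'.preserves₂ x hw v)
      (fun w hw v ↦ hS.holomorphic.difference_mem hD.preserves₃ hD'.preserves₃ x hw v)
      fun v hv w hw ↦ by
        rw [← sub_eq_zero, ← torsion_sub_torsion, hD.torsion x v hv w hw, hD'.torsion x v hv w hw,
          sub_zero]
  have h : CovariantDerivative.difference D' D x (X x) = D' X x - D X x :=
    IsCovariantDerivativeOn.difference_apply _ _ (Set.mem_univ x) hX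
  rw [hA] at h
  exact sub_eq_zero.1 h.symm

/-- Every `SL(2)`-web has a torsion-free holomorphic connection which is the unique Chern connection
of any three members of the web, and whose holonomy lies in `GL(n, ℂ)`. -/
theorem IsSL2Web.exists_connection [CompleteSpace E] (hS : IsSL2Web n S) (hn0 : 0 < n)
    (hn : Module.finrank ℂ E = 2 * n) :
    ∃ D : AffineConnection E M,
      (∀ t₁ t₂ t₃ : CP1, t₁ ≠ t₂ → t₁ ≠ t₃ → t₂ ≠ t₃ →
        IsChernConnection (S t₁) (S t₂) (S t₃) D ∧
        ∀ D' : AffineConnection E M,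
          IsChernConnection (S t₁) (S t₂) (S t₃) D' → SameConnection D' D) ∧
      IsHolomorphicConnection D ∧ D.torsion = 0 ∧ HasHolonomyInGL n D := by
  obtain ⟨e, he, hol, rfl⟩ := hS.exists_isUnitsField hn0 hn
  have hpar := isParallelEnd_unitsConnection he hol
  have hD := isHolomorphicConnection_unitsConnection he hol
  have hT := torsion_unitsConnection he hol hS.involutive
  have hC : ∀ t₁ t₂ t₃ : CP1, IsChernConnection (unitsWeb e t₁) (unitsWeb e t₂) (unitsWeb e t₃)
      (unitsConnection he hol) := fun t₁ t₂ t₃ ↦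
    { holomorphic := hD
      preserves₁ := preserves_unitsWeb hpar t₁
      preserves₂ := preserves_unitsWeb hpar t₂
      preserves₃ := preserves_unitsWeb hpar t₃
      torsion := fun x v _ w _ ↦ by rw [hT]; rfl }
  exact ⟨unitsConnection he hol, fun t₁ t₂ t₃ h₁₂ h₁₃ h₂₃ ↦ ⟨hC t₁ t₂ t₃, fun D' hD' ↦
    hS.sameConnection hn h₁₂ h₁₃ h₂₃ (hC t₁ t₂ t₃) hD'⟩, hD, hT,
    hasHolonomyInGL_of_isParallelEnd hn hD he hpar⟩

end Uniqueness

end SL2Web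

end

theorem mainTheorem2 (n : ℕ) (hn : 0 < n)
    (M : Type*) [TopologicalSpace M] [T2Space M]
    [ChartedSpace (EuclideanSpace ℂ (Fin (2 * n))) M]
    [IsManifold 𝓘(ℂ, EuclideanSpace ℂ (Fin (2 * n))) ω M] :
    (∀ S : SL2Web.CP1 → ∀ x : M,
        Submodule ℂ (TangentSpace 𝓘(ℂ, EuclideanSpace ℂ (Fin (2 * n))) x),
      SL2Web.IsSL2Web n S →
      ∃ D : SL2Web.AffineConnection (EuclideanSpace ℂ (Fin (2 * n))) M,
        (∀ t₁ t₂ t₃ : SL2Web.CP1, t₁ ≠ t₂ → t₁ ≠ t₃ → t₂ ≠ t₃ →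
          SL2Web.IsChernConnection (S t₁) (S t₂) (S t₃) D ∧
          ∀ D' : SL2Web.AffineConnection (EuclideanSpace ℂ (Fin (2 * n))) M,
            SL2Web.IsChernConnection (S t₁) (S t₂) (S t₃) D' → SL2Web.SameConnection D' D) ∧
        SL2Web.IsHolomorphicConnection D ∧
        D.torsion = 0 ∧
        SL2Web.HasHolonomyInGL n D) ∧
    (∀ (x : M) (ρ : Matrix.SpecialLinearGroup (Fin 2) ℂ →*
        (TangentSpace 𝓘(ℂ, EuclideanSpace ℂ (Fin (2 * n))) x ≃ₗ[ℂ]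
          TangentSpace 𝓘(ℂ, EuclideanSpace ℂ (Fin (2 * n))) x)),
      SL2Web.IsSumOfWeightOne n ρ →
      Nonempty (SL2Web.actionCentralizer ρ ≃* GL (Fin n) ℂ)) ∧
    (∀ D : SL2Web.AffineConnection (EuclideanSpace ℂ (Fin (2 * n))) M,
      SL2Web.IsHolomorphicConnection D → D.torsion = 0 → SL2Web.HasHolonomyInGL n D →
      ∃ S : SL2Web.CP1 → ∀ x : M,
          Submodule ℂ (TangentSpace 𝓘(ℂ, EuclideanSpace ℂ (Fin (2 * n))) x),
        SL2Web.IsSL2Web n S ∧ ∀ t, SL2Web.Preserves D (S t)) := by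
  have hfr : Module.finrank ℂ (EuclideanSpace ℂ (Fin (2 * n))) = 2 * n :=
    finrank_euclideanSpace_fin
  exact ⟨fun S hS ↦ hS.exists_connection hn hfr,
    fun x ρ hρ ↦ hρ.nonempty_actionCentralizer_mulEquiv,
    fun D hD hT hH ↦ SL2Web.exists_isSL2Web_of_hasHolonomyInGL hn hfr hD hT hH⟩
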